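/- **Setting.** For a real matrix $M$ let $\|M\|_1=\max_j\sum_i|M_{ij}|$, $\|M\|_\infty=\max_i\sum_j|M_{ij}|$ and $\|M\|_s=\max\{\|M\|_1,\|M\|_\infty\}$. For a matrix $M$ with linearly independent columns, $M^\dagger$ denotes a left inverse of $M$ of minimum $\|\cdot\|_\infty$ (ties broken by any fixed measurable rule). Data points are $y=A^*x^*+\nu\in\mathbb R^m$, where $A^*\in\mathbb R^{m\times n}$ and $(x^*,\nu)$ is a random vector in $\mathbb R^n\times\mathbb R^m$; different examples are independent copies. Write $\ell=1/50$, $\gamma=3/2$. Assume, for parameters $C_1\ge 1$, $c_2>0$, $C_2$, $C_\nu$: * (A1) the columns of $A^*$ are linearly independent; * (A2) the coordinates $x^*_i$ are independent, $x^*_i\in[0,1]$ almost surely, $\mathbb E[x_i^*]\le C_1/n$ and $c_2/n\le\mathbb E[(x_i^*)^2]\le C_2/n$ for all $i$; * (A3) the initial matrix is $A^{(0)}=A^*(\Sigma^{(0)}+E^{(0)})+N^{(0)}$ with $\Sigma^{(0)}$ diagonal, $E^{(0)}$ off-diagonal, $\Sigma^{(0)}\succeq(1-\ell)I$ and $\|E^{(0)}\|_s\le\ell$;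 * moreover $\Sigma^{(0)}\preceq(1+\ell)I$ and $E^{(0)}\ge0$ entrywise. The noise is *adversarial* if $\max_k|\nu_k|\le C_\nu$ almost surely (with arbitrary dependence on $x^*$), and *unbiased* if in addition $\mathbb E[\nu\mid x^*]=0$. **Algorithm (Equilibration).** Parameters: $\alpha,\eta,\lambda,\varepsilon\in\mathbb R$, $T,N\in\mathbb N$. Given a current matrix $A$, an example $y$ is decoded as $x=\phi_\alpha(A^\dagger y)$, where $\phi_\alpha(v)=\max\{v-\alpha,0\}$ entrywise. $\hat{\mathbb E}$ denotes the empirical average over a fresh batch of $N$ examples ($y,y'$ being independent and uniform in the batch, $x,x'$ their decodings). Start with $A=A^{(0)}$, $S=\emptyset$, $D=I$. While $|S|<n$: 1. set $m_j\leftarrow\hat{\mathbb E}[x_j^2]$ for $j\notin S$; 2. while $\max_{j\notin S}m_j<\lambda$: (a) repeat $T$ times: replace simultaneously the columns $i\in S$ of $A$ by the corresponding columns of $(1-\eta)A+r_i\eta\,\hat{\mathbb E}[(y-y')(x-x')^\top]$ with $r_i=3/(5m_i)$; (b) multiply the columns of $A$ in $S$ by $1/(1-\varepsilon)$; (c) set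 $\lambda\leftarrow(1-\varepsilon)^2\lambda$, and $D_{jj}\leftarrow D_{jj}/(1-\varepsilon)$, $m_j\leftarrow(1-\varepsilon)^2m_j$ for $j\in S$; then $m_j\leftarrow\hat{\mathbb E}[x_j^2]$ for $j\notin S$; 3. set $S\leftarrow S\cup\{j:m_j\ge\lambda\}$. Output $A$ (together with the maintained $D$). **Theorem.** There are absolute constants $G,K>0$ and $\varepsilon_0\in(0,1]$ and a polynomial $q$ in four variables such that the following holds for all $n,m$ and all data satisfying the assumptions above and $C_1^3\le G\,c_2^2\,n$. (i) *Adversarial noise.* If the noise is adversarial and $$\max\{C_\nu,\|N^{(0)}\|_\infty\}\le\frac{G\,c_2^4}{C_1^5\,n\,\|(A^*)^\dagger\|_\infty},$$ then there exist $\alpha>0$, $\eta\in(0,1)$, $T\in\mathbb N$ and an initial $\lambda>0$ such that for all $\varepsilon\in(0,\varepsilon_0)$, $\delta\in(0,1)$ and $N\ge q(n,m,1/\varepsilon,1/\delta)$, with probability at least $1-\delta$ the algorithm terminates, and its output satisfies $$A=A^*D(\Sigma+E)+N$$ where $D$ is diagonal with positive diagonal, $\Sigma\succeq(1-\ell)I$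 is diagonal, $E$ is off-diagonal with $\|E\|_s\le\gamma\ell$, $$\|N\|_\infty\le 2\max\Big\{\|N^{(0)}\|_\infty,\;K\,\frac{n\,C_1^2}{c_2^2}\,C_\nu\Big\},\qquad \frac{\max_{i}\mathbb E[(x_i^*)^2]/D_{ii}^2}{\min_{j}\mathbb E[(x_j^*)^2]/D_{jj}^2}\le2 .$$ In particular $\|N\|_\infty\le2\|N^{(0)}\|_\infty$ whenever $K n C_1^2C_\nu/c_2^2\le\|N^{(0)}\|_\infty$. (ii) *Unbiased noise.* If the noise is unbiased and $$\max\{C_\nu,\|N^{(0)}\|_\infty\}\le\min\Big\{\sqrt{\frac{G\,c_2^4}{C_1^5\,n}}\;\frac1{\|(A^*)^\dagger\|_\infty},\;\frac{G\,c_2^2}{C_1^3\,\|(A^*)^\dagger\|_\infty}\Big\},$$ then the same conclusion holds, with the bound on $N$ replaced by $$\|N\|_\infty\le 2\max\Big\{\|N^{(0)}\|_\infty,\;K\,\frac{n\,C_1^2}{c_2^2}\,\|(A^*)^\dagger\|_\infty\,C_\nu^2+\varepsilon\,C_\nu\Big\}.$$ -/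

import Mathlib

open MeasureTheory ProbabilityTheory
open scoped Matrix

noncomputable section

/-- Row norm `‖M‖_∞ = max_i ∑_j |M i j|`. -/
def rowNorm {a b : ℕ} (M : Matrix (Fin a) (Fin b) ℝ) : ℝ :=
  ⨆ i, ∑ j, |M i j|

/-- Column norm `‖M‖_1 = max_j ∑_i |M i j|`. -/
def colNorm {a b : ℕ} (M : Matrix (Fin a) (Fin b) ℝ) : ℝ :=
  ⨆ j, ∑ i, |M i j|

/-- Symmetrized norm `‖M‖_s = max {‖M‖_1, ‖M‖_∞}`. -/
def symNorm {a b : ℕ} (M : Matrix (Fin a) (Fin b) ℝ) : ℝ :=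
  max (colNorm M) (rowNorm M)

/-- The smallest row norm of a left inverse of `A`. For `A` with linearly independent columns this
is `‖A†‖_∞`, where `A†` is the pseudo-inverse of `A` with minimum row norm. -/
def pinvNorm {m n : ℕ} (A : Matrix (Fin m) (Fin n) ℝ) : ℝ :=
  sInf {t | ∃ B : Matrix (Fin n) (Fin m) ℝ, B * A = 1 ∧ rowNorm B = t}

/-- `pinv` computes, for every `A` with linearly independent columns, a pseudo-inverse (that is, a
left inverse) of minimum row norm. The minimizer need not be unique; `pinv` is any measurable way
of choosing one. -/
structure IsMinPinv {m n : ℕ}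
    (pinv : Matrix (Fin m) (Fin n) ℝ → Matrix (Fin n) (Fin m) ℝ) : Prop where
  left_inv : ∀ A : Matrix (Fin m) (Fin n) ℝ, LinearIndependent ℝ A.col → pinv A * A = 1
  minimal : ∀ A : Matrix (Fin m) (Fin n) ℝ, LinearIndependent ℝ A.col →
    ∀ B : Matrix (Fin n) (Fin m) ℝ, B * A = 1 → rowNorm (pinv A) ≤ rowNorm B
  measurable : ∀ i j,
    Measurable fun A : Fin m → Fin n → ℝ => pinv (Matrix.of A) i j

/-! ### The generative model -/

/-- A pair `(x*, ν)` of ground-truth weights and noise. -/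
abbrev Draw (n m : ℕ) : Type := (Fin n → ℝ) × (Fin m → ℝ)

/-- The data point `y = A* x* + ν`. -/
def observe {m n : ℕ} (Astar : Matrix (Fin m) (Fin n) ℝ) (z : Draw n m) : Fin m → ℝ :=
  Astar *ᵥ z.1 + z.2

/-- Second moment `E[(x*_i)²]`. -/
def secondMoment {n m : ℕ} (P : Measure (Draw n m)) (i : Fin n) : ℝ :=
  ∫ z, (z.1 i) ^ 2 ∂P

/-- The assumption on the weights: `x*_i ∈ [0, 1]`, `E[x*_i] ≤ C₁ / n`,
`c₂ / n ≤ E[(x*_i)²] ≤ C₂ / n`, and the `x*_i` are independent. -/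
structure WeightAssumption {n m : ℕ} (P : Measure (Draw n m)) (C₁ c₂ C₂ : ℝ) : Prop where
  mem_Icc : ∀ i, ∀ᵐ z ∂P, z.1 i ∈ Set.Icc (0 : ℝ) 1
  mean_le : ∀ i, ∫ z, z.1 i ∂P ≤ C₁ / n
  le_second : ∀ i, c₂ / n ≤ secondMoment P i
  second_le : ∀ i, secondMoment P i ≤ C₂ / n
  indep : iIndepFun (fun (i : Fin n) (z : Draw n m) => z.1 i) P

/-- Adversarial noise: every entry of `ν` is at most `Cν` in absolute value, almost surely. -/
def AdversarialNoise {n m : ℕ} (P : Measure (Draw n m)) (Cν : ℝ) : Prop :=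
  ∀ᵐ z ∂P, ∀ k, |z.2 k| ≤ Cν

/-- Unbiased noise: bounded as above, and `E[ν | x*] = 0`. -/
def UnbiasedNoise {n m : ℕ} (P : Measure (Draw n m)) (Cν : ℝ) : Prop :=
  AdversarialNoise P Cν ∧
    ∀ k, P[fun z : Draw n m => z.2 k | MeasurableSpace.comap Prod.fst inferInstance] =ᵐ[P] 0

/-- The initialization `A0 = A* (Σ + E) + N`, with `Σ = diag σ ⪰ (1 - ℓ) I`, `E` off-diagonal and
`‖E‖_s ≤ ℓ`. -/
structure InitAssumption {m n : ℕ} (Astar A0 : Matrix (Fin m) (Fin n) ℝ) (ℓ : ℝ)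
    (σ : Fin n → ℝ) (E : Matrix (Fin n) (Fin n) ℝ) (N : Matrix (Fin m) (Fin n) ℝ) : Prop where
  eq : A0 = Astar * (Matrix.diagonal σ + E) + N
  diag_ge : ∀ i, 1 - ℓ ≤ σ i
  offDiag : ∀ i, E i i = 0
  sym_le : symNorm E ≤ ℓ

/-! ### The algorithm -/

/-- Parameters of the algorithm: the rule for the pseudo-inverse, the ReLU threshold `α`, the step
size `η`, the number `T` of iterations of each column update, and the rescaling step `ε`. -/
structure EqParams (m n : ℕ) where
  pinv : Matrix (Fin m) (Fin n) ℝ → Matrix (Fin n) (Fin m) ℝ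
  α : ℝ
  η : ℝ
  T : ℕ
  ε : ℝ

/-- Decoding `x = φ_α(A† y)`, with the ReLU `φ_α(v) = max {v - α, 0}` applied entry-wise. -/
def decode {m n : ℕ} (p : EqParams m n) (A : Matrix (Fin m) (Fin n) ℝ) (y : Fin m → ℝ) :
    Fin n → ℝ :=
  fun i => max ((p.pinv A *ᵥ y) i - p.α) 0

/-- `Ê[(y - y')(x - x')ᵀ]`, over independent uniform `y, y'` from the batch `Y` and their
decodings `x, x'`. -/
def empCross {m n N : ℕ} (p : EqParams m n) (A : Matrix (Fin m) (Fin n) ℝ)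
    (Y : Fin N → Fin m → ℝ) : Matrix (Fin m) (Fin n) ℝ :=
  ((N : ℝ) ^ 2)⁻¹ • ∑ a, ∑ b,
    Matrix.vecMulVec (Y a - Y b) (decode p A (Y a) - decode p A (Y b))

/-- `Ê[x_j²]` over the batch `Y`. -/
def empSecond {m n N : ℕ} (p : EqParams m n) (A : Matrix (Fin m) (Fin n) ℝ)
    (Y : Fin N → Fin m → ℝ) (j : Fin n) : ℝ :=
  (N : ℝ)⁻¹ * ∑ a, (decode p A (Y a) j) ^ 2

/-- `t` iterations of the column update: in each, the columns `i ∈ S` are replaced by those of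
`(1 - η) A + r_i η Ê[(y - y')(x - x')ᵀ]`, where iteration `s` uses the batch `Y s`. -/
def columnUpdate {m n N : ℕ} (p : EqParams m n) (r : Fin n → ℝ) (S : Finset (Fin n))
    (Y : ℕ → Fin N → Fin m → ℝ) (A : Matrix (Fin m) (Fin n) ℝ) :
    ℕ → Matrix (Fin m) (Fin n) ℝ
  | 0 => A
  | t + 1 =>
    let B := columnUpdate p r S Y A t
    Matrix.of fun k i =>
      if i ∈ S then (1 - p.η) * B k i + r i * p.η * empCross p B (Y t) k i else B k i

/-- Column update for `T` iterations, followed by multiplying the columns in `S` by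
`1 / (1 - ε)`. -/
def rescale {m n N : ℕ} (p : EqParams m n) (r : Fin n → ℝ) (S : Finset (Fin n))
    (Y : ℕ → Fin N → Fin m → ℝ) (A : Matrix (Fin m) (Fin n) ℝ) : Matrix (Fin m) (Fin n) ℝ :=
  Matrix.of fun k i =>
    if i ∈ S then (1 / (1 - p.ε)) * columnUpdate p r S Y A p.T k i
    else columnUpdate p r S Y A p.T k i

/-- Control points: the test of the outer loop, the test of the inner loop, termination. -/
inductive Phase
  | outer
  | inner
  | done

/-- Program state: the matrix `A`, the diagonal `D`, the working set `S`, the threshold `lam`, the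
estimates `m_j`, the number of batches of examples consumed so far, and the control point. -/
structure EqState (m n : ℕ) where
  A : Matrix (Fin m) (Fin n) ℝ
  D : Fin n → ℝ
  S : Finset (Fin n)
  lam : ℝ
  est : Fin n → ℝ
  used : ℕ
  phase : Phase

/-- `S = ∅`, `D = I`. -/
def initState {m n : ℕ} (A0 : Matrix (Fin m) (Fin n) ℝ) (lam : ℝ) : EqState m n where
  A := A0
  D := fun _ => 1
  S := ∅
  lam := lam
  est := fun _ => 0
  used := 0
  phase := Phase.outer

/-- One step of the program, where `Y k` is the `k`-th batch of examples:

* outer loop: while `|S| < n`, set `m_j := Ê[x_j²]` for `j ∉ S` and enter the inner loop;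
* inner loop: while `max_{j ∉ S} m_j < lam`, rescale with ratios `3 / (5 m_j)`, set
  `lam := (1 - ε)² lam`, `D_jj := D_jj / (1 - ε)` and `m_j := (1 - ε)² m_j` for `j ∈ S`, and
  `m_j := Ê[x_j²]` for `j ∉ S`;
* after the inner loop: `S := S ∪ {j : m_j ≥ lam}`.

Every iteration of a column update and every estimation uses a fresh batch. -/
def eqStep {m n N : ℕ} (p : EqParams m n) (Y : ℕ → Fin N → Fin m → ℝ) (s : EqState m n) :
    EqState m n :=
  match s.phase with
  | Phase.outer =>
    if s.S.card < n then
      { s with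
        est := fun j => if j ∈ s.S then s.est j else empSecond p s.A (Y s.used) j
        used := s.used + 1
        phase := Phase.inner }
    else { s with phase := Phase.done }
  | Phase.inner =>
    if ∀ j, j ∉ s.S → s.est j < s.lam then
      let A' := rescale p (fun j => 3 / (5 * s.est j)) s.S (fun t => Y (s.used + t)) s.A
      { s with
        A := A'
        D := fun j => if j ∈ s.S then s.D j / (1 - p.ε) else s.D j
        lam := (1 - p.ε) ^ 2 * s.lam
        est := fun j =>
          if j ∈ s.S then (1 - p.ε) ^ 2 * s.est j else empSecond p A' (Y (s.used + p.T)) j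
        used := s.used + p.T + 1 }
    else
      { s with
        S := s.S ∪ Finset.univ.filter fun j => s.lam ≤ s.est j
        phase := Phase.outer }
  | Phase.done => s

/-- The program, started from `A0` with threshold `lam` and run on the batches `Y`, terminates
with output `A` and final diagonal `D`. -/
def Outputs {m n N : ℕ} (p : EqParams m n) (A0 : Matrix (Fin m) (Fin n) ℝ) (lam : ℝ)
    (Y : ℕ → Fin N → Fin m → ℝ) (A : Matrix (Fin m) (Fin n) ℝ) (D : Fin n → ℝ) : Prop :=
  ∃ k, ((eqStep p Y)^[k] (initState A0 lam)).phase = Phase.done ∧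
    ((eqStep p Y)^[k] (initState A0 lam)).A = A ∧
    ((eqStep p Y)^[k] (initState A0 lam)).D = D

/-! ### The guarantee -/

/-- The output is `A = A* D (Σ + E) + N` with `D` a positive diagonal matrix, `Σ ⪰ (1 - ℓ) I`
diagonal, `E` off-diagonal with `‖E‖_s ≤ γ ℓ`, and `‖N‖_∞ ≤ bound`; and the numbers
`E[(x*_i)²] / D_ii²` are within a factor of `2` from each other. -/
def GoodOutput {m n : ℕ} (Astar : Matrix (Fin m) (Fin n) ℝ) (P : Measure (Draw n m))
    (γ ℓ bound : ℝ) (A : Matrix (Fin m) (Fin n) ℝ) (D : Fin n → ℝ) : Prop :=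
  (∀ i, 0 < D i) ∧
  (∃ (σ : Fin n → ℝ) (E : Matrix (Fin n) (Fin n) ℝ) (N : Matrix (Fin m) (Fin n) ℝ),
    A = Astar * Matrix.diagonal D * (Matrix.diagonal σ + E) + N ∧
    (∀ i, 1 - ℓ ≤ σ i) ∧ (∀ i, E i i = 0) ∧ symNorm E ≤ γ * ℓ ∧ rowNorm N ≤ bound) ∧
  ∀ i j, secondMoment P i / D i ^ 2 ≤ 2 * (secondMoment P j / D j ^ 2)

/-- For suitable `α, η, T, lam`, every `0 < ε < ε₀`, `0 < δ < 1` and every batch size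
`N ≥ q(n, m, 1/ε, 1/δ)`, the algorithm run on batches of `N` independent examples terminates with a
good output, except on an event of (outer) probability at most `δ`. The bound on the noise term of
the output may depend on `ε`. -/
def EquilibrationGuarantee {m n : ℕ} (ε₀ : ℝ) (q : MvPolynomial (Fin 4) ℝ)
    (Astar A0 : Matrix (Fin m) (Fin n) ℝ) (P : Measure (Draw n m))
    (γ ℓ : ℝ) (bound : ℝ → ℝ) : Prop :=
  ∃ (α η : ℝ) (T : ℕ) (lam : ℝ), 0 < α ∧ 0 < η ∧ η < 1 ∧ 0 < lam ∧
    ∀ pinv : Matrix (Fin m) (Fin n) ℝ → Matrix (Fin n) (Fin m) ℝ, IsMinPinv pinv →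
    ∀ (ε δ : ℝ) (N : ℕ), 0 < ε → ε < ε₀ → 0 < δ → δ < 1 →
      MvPolynomial.eval ![(n : ℝ), (m : ℝ), 1 / ε, 1 / δ] q ≤ (N : ℝ) →
      Measure.infinitePi (fun _ : ℕ => Measure.pi fun _ : Fin N => P)
        {ω : ℕ → Fin N → Draw n m |
          ¬ ∃ (A : Matrix (Fin m) (Fin n) ℝ) (D : Fin n → ℝ),
            Outputs ⟨pinv, α, η, T, ε⟩ A0 lam (fun k a => observe Astar (ω k a)) A D ∧
            GoodOutput Astar P γ ℓ (bound ε) A D}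
        ≤ ENNReal.ofReal δ

end

/-!
Every inner iteration decodes with a minimal left inverse `A†` of a matrix `A = A* D (Σ + E) + N`.
Up to a small error `A† A* D` is `(Σ + E)⁻¹`, and the argument follows the three parts `D`, `E` and
`N` through the updates.

*Covariances.* A decoded coordinate is `φ_α(∑ₖ zₖ xₖ + e)`. For the covariance with the `j`-th
weight it is compared with `φ_α(∑_{k ≠ j} zₖ xₖ)`, which is independent of `xⱼ`. If `zⱼ` is
negative or tiny, the two differ only if the other weights contribute at least `α / 2`, which by
Markov's inequality has probability `O(C₁ / (n α))` (`SparseWeights.covariance_bounds`,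
`SparseWeights.abs_covariance_sub_le`). Since `E ≥ 0` entrywise, up to a negligible part, the
off-diagonal entries of `(Σ + E)⁻¹` are negative to first order, so only its second order part and
the small error are active, and the expected update leaves `E` essentially at its contracted old
value (`Factored.exists_decodeSplit`, `Factored.rescale`). The covariance of adversarial noise
with a decoded coordinate is `O(C_ν)` times the mean of the latter. For unbiased noise the
covariance with the noise-free coordinate vanishes, so only the change that the noise itself
causes remains, which by the same comparison is small (`AdversarialNoise.abs_covariance_le`,
`UnbiasedNoise.abs_covariance_le`).

*Sampling.* The empirical covariances are close to their expectations uniformly over all decoders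
with bounded coefficients: Hoeffding's inequality on a grid of coefficient vectors, and the
Lipschitz dependence on the coefficients (`measure_not_representative_le`). By uniformity a decoder
may depend on the batch, so only the number of batches enters the union bound.

*The loop.* The empirical second moment of a decoded coordinate is the scaled moment
`E[xⱼ²] / D_jj²`, up to a factor near `1`. A column enters `S` when this estimate reaches `λ`, and
from then on `λ`, the estimate and the scaled moment shrink by the same factor; a coordinate
outside `S` has an estimate below `λ`. Hence at the end all scaled moments are within a factor of
`2`. A column not in `S` is never changed, and its error does not exceed that of the
initialization. A column in `S` loses `3 / 4` of its error in each update before new errors are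
added, so these accumulate only to a geometric series; this keeps `‖E‖_s ≤ 3ℓ / 2` and each entry
of `N` within a fixed amount of the initial one (`LoopInvariant`). A coordinate outside `S` keeps
its moment, which is at least `c₂ / n`, so `λ` cannot fall far below `c₂ / n` and the loop stops
after `O(n / ε)` batches (`Progress`, `exists_goodOutput`).
-/

/-! ### Row and column sums of matrices -/

/-- All absolute row sums of `M` are at most `c`; that is, `‖M‖_∞ ≤ c`, without the convention for
the supremum over an empty index set. -/
def RowLe {ι κ : Type*} [Fintype κ] (M : Matrix ι κ ℝ) (c : ℝ) : Prop :=
  ∀ i, ∑ j, |M i j| ≤ c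

/-- All absolute column sums of `M` are at most `c`; that is, `‖M‖_1 ≤ c`. -/
def ColLe {ι κ : Type*} [Fintype ι] (M : Matrix ι κ ℝ) (c : ℝ) : Prop :=
  RowLe Mᵀ c

/-- The off-diagonal part of a square matrix. -/
def offDiagPart {ι : Type*} [DecidableEq ι] (M : Matrix ι ι ℝ) : Matrix ι ι ℝ :=
  Matrix.of fun i j => if i = j then 0 else M i j

lemma offDiagPart_transpose {ι : Type*} [DecidableEq ι] (M : Matrix ι ι ℝ) :
    offDiagPart Mᵀ = (offDiagPart M)ᵀ := by
  ext i j
  simp [offDiagPart, eq_comm]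

lemma rowLe_rowNorm {a b : ℕ} (M : Matrix (Fin a) (Fin b) ℝ) : RowLe M (rowNorm M) :=
  fun i => le_ciSup (f := fun i => ∑ j, |M i j|) (Set.finite_range _).bddAbove i

lemma colLe_colNorm {a b : ℕ} (M : Matrix (Fin a) (Fin b) ℝ) : ColLe M (colNorm M) :=
  fun j => le_ciSup (f := fun j => ∑ i, |M i j|) (Set.finite_range _).bddAbove j

lemma rowNorm_le {a b : ℕ} {M : Matrix (Fin a) (Fin b) ℝ} {c : ℝ} (h : RowLe M c) (hc : 0 ≤ c) :
    rowNorm M ≤ c :=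
  Real.iSup_le h hc

lemma rowNorm_nonneg {a b : ℕ} (M : Matrix (Fin a) (Fin b) ℝ) : 0 ≤ rowNorm M :=
  Real.iSup_nonneg fun _ => Finset.sum_nonneg fun _ _ => abs_nonneg _

lemma symNorm_le {a b : ℕ} {M : Matrix (Fin a) (Fin b) ℝ} {c : ℝ} (h : RowLe M c) (h' : ColLe M c)
    (hc : 0 ≤ c) : symNorm M ≤ c :=
  max_le (Real.iSup_le h' hc) (Real.iSup_le h hc)

section
variable {ι κ ι' : Type*} [Fintype κ]

lemma RowLe.mono {M : Matrix ι κ ℝ} {c d : ℝ} (h : RowLe M c) (hcd : c ≤ d) : RowLe M d :=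
  fun i => (h i).trans hcd

lemma RowLe.of_abs_le {M M' : Matrix ι κ ℝ} {c : ℝ} (h : RowLe M' c)
    (hM : ∀ i j, |M i j| ≤ |M' i j|) : RowLe M c :=
  fun i => (Finset.sum_le_sum fun j _ => hM i j).trans (h i)

lemma RowLe.add {M M' : Matrix ι κ ℝ} {c d : ℝ} (h : RowLe M c) (h' : RowLe M' d) :
    RowLe (M + M') (c + d) := fun i => by
  calc ∑ j, |(M + M') i j| ≤ ∑ j, (|M i j| + |M' i j|) :=
        Finset.sum_le_sum fun j _ => abs_add_le _ _
    _ ≤ c + d := by rw [Finset.sum_add_distrib]; exact add_le_add (h i) (h' i)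

lemma RowLe.smul {M : Matrix ι κ ℝ} {c : ℝ} (h : RowLe M c) {r : ℝ} (hr : 0 ≤ r) :
    RowLe (r • M) (r * c) := fun i => by
  simp only [Matrix.smul_apply, smul_eq_mul, abs_mul, abs_of_nonneg hr, ← Finset.mul_sum]
  exact mul_le_mul_of_nonneg_left (h i) hr

lemma RowLe.abs_apply_le {M : Matrix ι κ ℝ} {c : ℝ} (h : RowLe M c) (i : ι) (j : κ) :
    |M i j| ≤ c :=
  (Finset.single_le_sum (f := fun j => |M i j|) (fun _ _ => abs_nonneg _)
    (Finset.mem_univ j)).trans (h i)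

lemma RowLe.of_forall_abs_le {M : Matrix ι κ ℝ} {c : ℝ} (h : ∀ i j, |M i j| ≤ c) :
    RowLe M (Fintype.card κ * c) := fun i =>
  (Finset.sum_le_sum fun j _ => h i j).trans (by simp)

lemma RowLe.map_abs {M : Matrix ι κ ℝ} {c : ℝ} (h : RowLe M c) : RowLe (M.map abs) c :=
  fun i => by simpa using h i

lemma sum_abs_sum_mul_le [Fintype ι'] {B : Matrix κ ι' ℝ} {b : ℝ} (hB : RowLe B b) (x : κ → ℝ) :
    ∑ j, |∑ k, x k * B k j| ≤ (∑ k, |x k|) * b := by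
  calc ∑ j, |∑ k, x k * B k j| ≤ ∑ j, ∑ k, |x k| * |B k j| :=
        Finset.sum_le_sum fun j _ => (Finset.abs_sum_le_sum_abs _ _).trans
          (by simp [abs_mul])
    _ = ∑ k, |x k| * ∑ j, |B k j| := by
        rw [Finset.sum_comm]; simp [Finset.mul_sum]
    _ ≤ ∑ k, |x k| * b :=
        Finset.sum_le_sum fun k _ => mul_le_mul_of_nonneg_left (hB k) (abs_nonneg _)
    _ = _ := by rw [Finset.sum_mul]

lemma RowLe.mul [Fintype ι'] {A : Matrix ι κ ℝ} {B : Matrix κ ι' ℝ} {a b : ℝ} (hA : RowLe A a)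
    (hB : RowLe B b) (hb : 0 ≤ b) : RowLe (A * B) (a * b) := fun i => by
  simp only [Matrix.mul_apply]
  exact (sum_abs_sum_mul_le hB (A i)).trans (mul_le_mul_of_nonneg_right (hA i) hb)

lemma ColLe.mul [Fintype ι'] [Fintype ι] {A : Matrix ι κ ℝ} {B : Matrix κ ι' ℝ} {a b : ℝ}
    (hA : ColLe A a) (hB : ColLe B b) (ha : 0 ≤ a) : ColLe (A * B) (a * b) := by
  unfold ColLe
  rw [Matrix.transpose_mul, mul_comm]
  exact RowLe.mul hB hA ha

end

/-! ### Inverses of diagonally dominant matrices -/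

section
variable {ι : Type*} [Fintype ι] [DecidableEq ι] {σ : ι → ℝ} {E X : Matrix ι ι ℝ} {s e : ℝ}

lemma det_diagonal_add_ne_zero (hσ : ∀ i, s ≤ σ i) (hE : RowLe E e) (hes : e < s) :
    (Matrix.diagonal σ + E).det ≠ 0 := by
  apply det_ne_zero_of_sum_row_lt_diag
  intro k
  have h1 : ∑ j ∈ Finset.univ.erase k, ‖(Matrix.diagonal σ + E) k j‖
      = ∑ j ∈ Finset.univ.erase k, |E k j| := by
    refine Finset.sum_congr rfl fun j hj => ?_
    rw [Matrix.add_apply, Matrix.diagonal_apply_ne _ (Finset.ne_of_mem_erase hj).symm, zero_add,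
      Real.norm_eq_abs]
  have h2 := Finset.sum_erase_add Finset.univ (fun j => |E k j|) (Finset.mem_univ k)
  have h3 := hE k
  rw [h1, Matrix.add_apply, Matrix.diagonal_apply_eq, Real.norm_eq_abs]
  have h4 : σ k - |E k k| ≤ |σ k + E k k| := by
    have := neg_abs_le (E k k)
    exact (by linarith : σ k - |E k k| ≤ σ k + E k k).trans (le_abs_self _)
  have := hσ k
  linarith

/-- Entrywise form of `X (Σ + E) = 1`. -/
lemma mul_diagonal_add_apply (h : X * (Matrix.diagonal σ + E) = 1) (i j : ι) :
    X i j * σ j = (1 : Matrix ι ι ℝ) i j - ∑ k, X i k * E k j := by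
  rw [← h, Matrix.mul_add, Matrix.add_apply, Matrix.mul_diagonal, Matrix.mul_apply]
  ring

lemma rowLe_of_mul_diagonal_add (hs : 0 ≤ s) (hσ : ∀ i, s ≤ σ i) (hE : RowLe E e) (hes : e < s)
    (h : X * (Matrix.diagonal σ + E) = 1) : RowLe X (1 / (s - e)) := fun i => by
  have h1 : (∑ j, |X i j|) * s ≤ 1 + (∑ j, |X i j|) * e := by
    calc (∑ j, |X i j|) * s ≤ ∑ j, |X i j * σ j| := by
          rw [Finset.sum_mul]
          refine Finset.sum_le_sum fun j _ => ?_
          rw [abs_mul, abs_of_nonneg (hs.trans (hσ j))]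
          exact mul_le_mul_of_nonneg_left (hσ j) (abs_nonneg _)
      _ ≤ ∑ j, (|(1 : Matrix ι ι ℝ) i j| + |∑ k, X i k * E k j|) := by
          refine Finset.sum_le_sum fun j _ => ?_
          rw [mul_diagonal_add_apply h]
          exact abs_sub _ _
      _ ≤ 1 + (∑ j, |X i j|) * e := by
          rw [Finset.sum_add_distrib]
          refine add_le_add ?_ (sum_abs_sum_mul_le hE _)
          simp [Matrix.one_apply, apply_ite abs]
  rw [le_div_iff₀ (by linarith)]
  linarith

lemma rowLe_offDiagPart_of_mul (hs : 0 < s) (hσ : ∀ i, s ≤ σ i) (hE : RowLe E e) (he : 0 ≤ e)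
    {x : ℝ} (hX : RowLe X x) (h : X * (Matrix.diagonal σ + E) = 1) :
    RowLe (offDiagPart X) (x * e / s) := fun i => by
  rw [le_div_iff₀ hs, Finset.sum_mul]
  calc ∑ j, |offDiagPart X i j| * s ≤ ∑ j, |∑ k, X i k * E k j| := by
        refine Finset.sum_le_sum fun j _ => ?_
        by_cases hij : i = j
        · simp [offDiagPart, hij]
        · have h1 := mul_diagonal_add_apply h i j
          rw [Matrix.one_apply_ne hij, zero_sub] at h1
          rw [← abs_neg (∑ k, X i k * E k j), ← h1, abs_mul, abs_of_pos (hs.trans_le (hσ j))]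
          simp only [offDiagPart, Matrix.of_apply, if_neg hij]
          exact mul_le_mul_of_nonneg_left (hσ j) (abs_nonneg _)
    _ ≤ (∑ k, |X i k|) * e := sum_abs_sum_mul_le hE _
    _ ≤ x * e := mul_le_mul_of_nonneg_right (hX i) he

lemma abs_diag_mul_sub_one_le (hE : RowLe E e) (hE0 : ∀ i, E i i = 0) {x : ℝ}
    (hX : RowLe (offDiagPart X) x) (he : 0 ≤ e) (h : X * (Matrix.diagonal σ + E) = 1) (i : ι) :
    |X i i * σ i - 1| ≤ x * e := by
  rw [mul_diagonal_add_apply h, Matrix.one_apply_eq, sub_sub_cancel_left, abs_neg]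
  calc |∑ k, X i k * E k i| ≤ ∑ k, |X i k * E k i| := Finset.abs_sum_le_sum_abs _ _
    _ ≤ ∑ k, |offDiagPart X i k| * e := by
        refine Finset.sum_le_sum fun k _ => ?_
        by_cases hik : i = k
        · simp [hik, hE0, offDiagPart]
        · rw [abs_mul]
          simp only [offDiagPart, Matrix.of_apply, if_neg hik]
          exact mul_le_mul_of_nonneg_left (hE.abs_apply_le k i) (abs_nonneg _)
    _ ≤ x * e := by rw [← Finset.sum_mul]; exact mul_le_mul_of_nonneg_right (hX i) he

/-- To first order the off-diagonal entries of `(Σ + E)⁻¹` are negative multiples of those of `E`,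
so their positive part is controlled by the negative part of `E` and a second-order term. -/
lemma offDiag_inverse_le (hs : 0 < s) (hσ : ∀ i, s ≤ σ i)
    (h : (Matrix.diagonal σ + E) * X = 1) {G : Matrix ι ι ℝ} (hG : ∀ i j, -G i j ≤ E i j)
    (hG0 : ∀ i j, 0 ≤ G i j)
    {x : ℝ} (hX0 : ∀ i, 0 ≤ X i i) (hX : ∀ i, X i i ≤ x) {i j : ι} (hij : i ≠ j) :
    X i j ≤ (x / s) * G i j + (E.map abs * (offDiagPart X).map abs) i j / s := by
  have h1 : σ i * X i j = -∑ k, E i k * X k j := by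
    have := congrFun (congrFun h i) j
    rw [Matrix.add_mul, Matrix.add_apply, Matrix.diagonal_mul, Matrix.one_apply_ne hij,
      Matrix.mul_apply] at this
    linarith
  have h2 : -∑ k, E i k * X k j ≤ x * G i j + (E.map abs * (offDiagPart X).map abs) i j := by
    rw [Matrix.mul_apply, ← Finset.add_sum_erase _ _ (Finset.mem_univ j), neg_add,
      ← Finset.add_sum_erase (a := j) (s := Finset.univ)
        (f := fun k => E.map abs i k * (offDiagPart X).map abs k j) (h := Finset.mem_univ j)]
    have h3 : -(E i j * X j j) ≤ x * G i j := by
      nlinarith [hG i j, hG0 i j, hX0 j, hX j, mul_nonneg (hX0 j) (by linarith [hG i j] :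
        0 ≤ E i j + G i j), mul_nonneg (hG0 i j) (by linarith [hX j] : 0 ≤ x - X j j)]
    have h4 : -∑ k ∈ Finset.univ.erase j, E i k * X k j ≤
        ∑ k ∈ Finset.univ.erase j, E.map abs i k * (offDiagPart X).map abs k j := by
      rw [← Finset.sum_neg_distrib]
      refine Finset.sum_le_sum fun k hk => ?_
      have : k ≠ j := Finset.ne_of_mem_erase hk
      simp only [offDiagPart, Matrix.map_apply, Matrix.of_apply, if_neg this]
      rw [← abs_mul]
      exact neg_le_abs _
    have h5 : 0 ≤ E.map abs i j * (offDiagPart X).map abs j j := by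
      simp [offDiagPart]
    linarith
  by_cases hpos : 0 ≤ X i j
  · have h6 : X i j * s ≤ x * G i j + (E.map abs * (offDiagPart X).map abs) i j := by
      nlinarith [hσ i]
    rw [div_mul_eq_mul_div, ← add_div, le_div_iff₀ hs]
    exact h6
  · have h7 : 0 ≤ x := (hX0 i).trans (hX i)
    have h8 : 0 ≤ (E.map abs * (offDiagPart X).map abs) i j := by
      rw [Matrix.mul_apply]
      exact Finset.sum_nonneg fun k _ => by simp only [Matrix.map_apply]; positivity
    have := hG0 i j
    push Not at hpos
    exact hpos.le.trans (by positivity)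

end

/-! ### Factored matrices and their left inverses -/

/-- The form in which the current matrix `A` is maintained: `A = A* D (Σ + E) + N`, with
`-G ≤ E ≤ E₀ + F` entrywise. The columns of `F` and `G` outside the working set `S` vanish, and the
bound on the negative part `G` of `E` is much smaller than the one on `F`; the noise exceeds the
initial noise by at most `b` in every entry. -/
structure Factored {m n : ℕ} (Astar : Matrix (Fin m) (Fin n) ℝ) (E₀ : Matrix (Fin n) (Fin n) ℝ)
    (N₀ : Matrix (Fin m) (Fin n) ℝ) (b : ℝ) (S : Finset (Fin n)) (A : Matrix (Fin m) (Fin n) ℝ)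
    (D σ : Fin n → ℝ) (E : Matrix (Fin n) (Fin n) ℝ) (N : Matrix (Fin m) (Fin n) ℝ)
    (F G : Matrix (Fin n) (Fin n) ℝ) : Prop where
  eq : A = Astar * Matrix.diagonal D * (Matrix.diagonal σ + E) + N
  one_le_D : ∀ i, 1 ≤ D i
  D_eq : ∀ i, i ∉ S → D i = 1
  σ_ge : ∀ i, 0.98 ≤ σ i
  σ_le : ∀ i, σ i ≤ 1.25
  σ_le' : ∀ i, i ∉ S → σ i ≤ 1.02
  E_diag : ∀ i, E i i = 0
  lower : ∀ i j, -G i j ≤ E i j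
  upper : ∀ i j, E i j ≤ E₀ i j + F i j
  F_nonneg : ∀ i j, 0 ≤ F i j
  G_nonneg : ∀ i j, 0 ≤ G i j
  F_zero : ∀ i j, j ∉ S → F i j = 0
  G_zero : ∀ i j, j ∉ S → G i j = 0
  F_row : RowLe F 0.008
  F_col : ColLe F 0.008
  G_row : RowLe G 0.0001
  G_col : ColLe G 0.0001
  N_le : ∀ k i, |N k i| ≤ |N₀ k i| + b

/-- What is needed of `Z = A† A* D`, the matrix that maps the scaled weights `D⁻¹ x*` to the decoded
ones before thresholding. It is split into `Q = (Σ + E)⁻¹` and a part `U` due to the noise in `A`.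
The matrix `W` collects the terms of second order in `E`. -/
structure DecodeSplit {n : ℕ} (σ : Fin n → ℝ) (G Z Q U W : Matrix (Fin n) (Fin n) ℝ)
    (ρ : ℝ) : Prop where
  eq : Z = Q + U
  U_le : ∀ i j, |U i j| ≤ ρ
  Q_row : RowLe (offDiagPart Q) 0.0323
  Q_col : ColLe (offDiagPart Q) 0.0323
  Z_offDiag : RowLe (offDiagPart Z) 0.033
  Z_row : RowLe Z 1.1
  diag : ∀ i, |Z i i * σ i - 1| ≤ 0.002
  Q_le : ∀ i j, i ≠ j → Q i j ≤ 1.1 * G i j + W i j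
  W_nonneg : ∀ i j, 0 ≤ W i j
  W_row : RowLe W 0.0011
  W_col : ColLe W 0.0011

section
variable {m n : ℕ} {Astar A : Matrix (Fin m) (Fin n) ℝ} {E₀ : Matrix (Fin n) (Fin n) ℝ}
  {N₀ : Matrix (Fin m) (Fin n) ℝ} {b : ℝ} {S : Finset (Fin n)}
  {D σ : Fin n → ℝ} {E : Matrix (Fin n) (Fin n) ℝ} {N : Matrix (Fin m) (Fin n) ℝ}
  {F G : Matrix (Fin n) (Fin n) ℝ}

lemma Factored.abs_E_le (h : Factored Astar E₀ N₀ b S A D σ E N F G) (hE₀ : ∀ i j, 0 ≤ E₀ i j)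
    (i j : Fin n) : |E i j| ≤ |(E₀ + F + G) i j| := by
  have h1 := h.lower i j
  have h2 := h.upper i j
  have h3 := h.F_nonneg i j
  have h4 := h.G_nonneg i j
  have h5 := hE₀ i j
  rw [Matrix.add_apply, Matrix.add_apply,
    abs_of_nonneg (by positivity : 0 ≤ E₀ i j + F i j + G i j)]
  exact abs_le.2 ⟨by linarith, by linarith⟩

lemma Factored.E_row (h : Factored Astar E₀ N₀ b S A D σ E N F G) (hE₀ : ∀ i j, 0 ≤ E₀ i j)
    (hrow : RowLe E₀ 0.02) : RowLe E 0.03 :=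
  (((hrow.add h.F_row).add h.G_row).of_abs_le (h.abs_E_le hE₀)).mono (by norm_num)

lemma Factored.E_col (h : Factored Astar E₀ N₀ b S A D σ E N F G) (hE₀ : ∀ i j, 0 ≤ E₀ i j)
    (hcol : ColLe E₀ 0.02) : ColLe E 0.03 := by
  have h1 : RowLe (E₀ + F + G)ᵀ (0.02 + 0.008 + 0.0001) := by
    rw [Matrix.transpose_add, Matrix.transpose_add]
    exact (RowLe.add hcol h.F_col).add h.G_col
  exact (h1.of_abs_le (fun i j => h.abs_E_le hE₀ j i)).mono (by norm_num)

lemma Factored.N_row (h : Factored Astar E₀ N₀ b S A D σ E N F G) :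
    RowLe N (rowNorm N₀ + n * b) := fun k => by
  calc ∑ i, |N k i| ≤ ∑ i, (|N₀ k i| + b) := Finset.sum_le_sum fun i _ => h.N_le k i
    _ ≤ _ := by
      rw [Finset.sum_add_distrib]
      simpa using rowLe_rowNorm N₀ k

/-- A left inverse of `A` with row norm at most `1.1 ‖(A*)†‖_∞`, obtained from one of `A*`. -/
lemma Factored.exists_leftInverse (h : Factored Astar E₀ N₀ b S A D σ E N F G)
    (hE₀ : ∀ i j, 0 ≤ E₀ i j) (hrow : RowLe E₀ 0.02) {P : Matrix (Fin n) (Fin m) ℝ} {p : ℝ}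
    (hp : RowLe P p) (hp0 : 0 ≤ p) (hb : 0 ≤ b) (hP : P * Astar = 1)
    (hN : p * (rowNorm N₀ + n * b) ≤ 0.01) :
    ∃ B : Matrix (Fin n) (Fin m) ℝ, B * A = 1 ∧ RowLe B (1.1 * p) := by
  set Di : Matrix (Fin n) (Fin n) ℝ := Matrix.diagonal fun i => (D i)⁻¹ with hDi
  have hDpos : ∀ i, 0 < D i := fun i => one_pos.trans_le (h.one_le_D i)
  have hDD : Di * Matrix.diagonal D = 1 := by
    rw [hDi, Matrix.diagonal_mul_diagonal, ← Matrix.diagonal_one]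
    congr 1
    ext i
    exact inv_mul_cancel₀ (hDpos i).ne'
  have hDP : RowLe (Di * P) p := hp.of_abs_le fun i j => by
    rw [hDi, Matrix.diagonal_mul, abs_mul, abs_of_pos (inv_pos.2 (hDpos i))]
    exact mul_le_of_le_one_left (abs_nonneg _) (inv_le_one_of_one_le₀ (h.one_le_D i))
  have hN0 : 0 ≤ rowNorm N₀ + n * b := add_nonneg (rowNorm_nonneg _) (by positivity)
  have hE' : RowLe (E + Di * P * N) 0.04 :=
    ((h.E_row hE₀ hrow).add (hDP.mul h.N_row hN0)).mono (by linarith)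
  set M := Matrix.diagonal σ + (E + Di * P * N) with hM
  have hdet : M.det ≠ 0 := det_diagonal_add_ne_zero h.σ_ge hE' (by norm_num)
  have hinv : M⁻¹ * M = 1 := Matrix.nonsing_inv_mul _ (isUnit_iff_ne_zero.2 hdet)
  refine ⟨M⁻¹ * (Di * P), ?_, ?_⟩
  · have : Di * P * A = M := by
      rw [h.eq, Matrix.mul_add, hM, ← add_assoc]
      congr 1
      calc Di * P * (Astar * Matrix.diagonal D * (Matrix.diagonal σ + E))
          = Di * (P * Astar) * Matrix.diagonal D * (Matrix.diagonal σ + E) := by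
            simp only [Matrix.mul_assoc]
        _ = _ := by rw [hP, Matrix.mul_one, hDD, Matrix.one_mul]
    rw [Matrix.mul_assoc, this, hinv]
  · have := rowLe_of_mul_diagonal_add (by norm_num) h.σ_ge hE' (by norm_num) hinv
    refine (this.mul hDP hp0).mono ?_
    exact mul_le_mul_of_nonneg_right (by norm_num) hp0

lemma linearIndependent_col_of_mul_eq_one {B : Matrix (Fin n) (Fin m) ℝ} (h : B * A = 1) :
    LinearIndependent ℝ A.col := by
  rw [← Matrix.mulVec_injective_iff]
  intro x y hxy
  have : B *ᵥ (A *ᵥ x) = B *ᵥ (A *ᵥ y) := by rw [hxy]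
  simpa [Matrix.mulVec_mulVec, h] using this

lemma Factored.exists_decodeSplit (h : Factored Astar E₀ N₀ b S A D σ E N F G)
    (hE₀ : ∀ i j, 0 ≤ E₀ i j) (hrow : RowLe E₀ 0.02) (hcol : ColLe E₀ 0.02) (hb : 0 ≤ b)
    {B : Matrix (Fin n) (Fin m) ℝ} (hB : B * A = 1) {p ρ : ℝ} (hp0 : 0 ≤ p)
    (hBp : RowLe B (1.1 * p))
    (hρ : 1.2 * (p * (rowNorm N₀ + n * b)) ≤ ρ) (hρ' : ρ ≤ 0.0001) :
    ∃ Q U W, DecodeSplit σ G (B * Astar * Matrix.diagonal D) Q U W ρ := by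
  have hErow := h.E_row hE₀ hrow
  have hEcol := h.E_col hE₀ hcol
  set M := Matrix.diagonal σ + E with hM
  have hdet : M.det ≠ 0 := det_diagonal_add_ne_zero h.σ_ge hErow (by norm_num)
  have hinv : M⁻¹ * M = 1 := Matrix.nonsing_inv_mul _ (isUnit_iff_ne_zero.2 hdet)
  have hinv' : M * M⁻¹ = 1 := Matrix.mul_nonsing_inv _ (isUnit_iff_ne_zero.2 hdet)
  have hinvT : (M⁻¹)ᵀ * (Matrix.diagonal σ + Eᵀ) = 1 := by
    rw [← Matrix.transpose_one, ← hinv', Matrix.transpose_mul, hM, Matrix.transpose_add,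
      Matrix.diagonal_transpose]
  have hN0 : 0 ≤ rowNorm N₀ + n * b := add_nonneg (rowNorm_nonneg _) (by positivity)
  set Q := M⁻¹ with hQ
  have hQrow : RowLe Q (1 / (0.98 - 0.03)) :=
    rowLe_of_mul_diagonal_add (by norm_num) h.σ_ge hErow (by norm_num) hinv
  have hQcol : ColLe Q (1 / (0.98 - 0.03)) :=
    rowLe_of_mul_diagonal_add (by norm_num) h.σ_ge hEcol (by norm_num) hinvT
  have hQoff : RowLe (offDiagPart Q) 0.0323 :=
    (rowLe_offDiagPart_of_mul (by norm_num) h.σ_ge hErow (by norm_num) hQrow hinv).mono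
      (by norm_num)
  have hQoffT : ColLe (offDiagPart Q) 0.0323 := by
    unfold ColLe
    rw [← offDiagPart_transpose]
    exact (rowLe_offDiagPart_of_mul (by norm_num) h.σ_ge hEcol (by norm_num) hQcol hinvT).mono
      (by norm_num)
  have hdiag := abs_diag_mul_sub_one_le hErow h.E_diag hQoff (by norm_num) hinv
  have hQd : ∀ i, 0 ≤ Q i i ∧ Q i i ≤ 1.03 := fun i => by
    have h1 := abs_le.1 (hdiag i)
    have h2 := h.σ_ge i
    constructor <;> nlinarith
  have hU : RowLe (-(B * N * Q)) ρ := by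
    have h1 := (hBp.mul h.N_row hN0).mul hQrow (by norm_num)
    have h2 : RowLe (B * N * Q) ρ := h1.mono (by
      have h3 := mul_nonneg hp0 hN0
      nlinarith)
    exact h2.of_abs_le fun i j => by simp
  set U := -(B * N * Q) with hUdef
  have hZ : B * Astar * Matrix.diagonal D = Q + U := by
    have h1 : B * Astar * Matrix.diagonal D * M + B * N = 1 := by
      rw [← hB, h.eq, Matrix.mul_add B, ← hM]
      simp only [Matrix.mul_assoc]
    calc B * Astar * Matrix.diagonal D = B * Astar * Matrix.diagonal D * M * Q := by
          rw [Matrix.mul_assoc _ M, hinv', Matrix.mul_one]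
      _ = (1 - B * N) * Q := by rw [← h1, add_sub_cancel_right]
      _ = Q + U := by rw [Matrix.sub_mul, Matrix.one_mul, sub_eq_add_neg]
  have hEabs : RowLe (E.map abs) 0.03 := hErow.map_abs
  have hEabsT : ColLe (E.map abs) 0.03 := RowLe.map_abs hEcol
  have hQabs : RowLe ((offDiagPart Q).map abs) 0.0323 := hQoff.map_abs
  have hQabsT : ColLe ((offDiagPart Q).map abs) 0.0323 := RowLe.map_abs hQoffT
  refine ⟨Q, U, (1 / 0.98 : ℝ) • (E.map abs * (offDiagPart Q).map abs), hZ,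
    fun i j => hU.abs_apply_le i j, hQoff, hQoffT, ?_, ?_, ?_, ?_, ?_, ?_, ?_⟩
  · have h1 : RowLe (offDiagPart Q + U) (0.0323 + ρ) := hQoff.add hU
    refine RowLe.of_abs_le (h1.mono (by linarith)) fun i j => ?_
    rw [hZ]
    by_cases hij : i = j
    · simp [offDiagPart, hij]
    · simp [offDiagPart, hij]
  · rw [hZ]
    exact (hQrow.add hU).mono (by norm_num at *; linarith)
  · intro i
    rw [hZ, Matrix.add_apply, add_mul]
    have h1 := abs_le.1 (hdiag i)
    have h2 : |U i i * σ i| ≤ 0.0001 * 1.25 := by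
      rw [abs_mul]
      exact mul_le_mul ((hU.abs_apply_le i i).trans hρ')
        (abs_le.2 ⟨by linarith [h.σ_ge i], h.σ_le i⟩) (abs_nonneg _) (by norm_num)
    have h3 := abs_le.1 h2
    exact abs_le.2 ⟨by linarith, by linarith⟩
  · intro i j hij
    have h1 := offDiag_inverse_le (s := 0.98) (x := 1.03) (by norm_num) h.σ_ge hinv' h.lower
      h.G_nonneg (fun i => (hQd i).1) (fun i => (hQd i).2) hij
    refine h1.trans ?_
    rw [Matrix.smul_apply, smul_eq_mul]
    have := h.G_nonneg i j
    refine add_le_add (mul_le_mul_of_nonneg_right (by norm_num) this) (le_of_eq (by ring))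
  · intro i j
    rw [Matrix.smul_apply, smul_eq_mul, Matrix.mul_apply]
    refine mul_nonneg (by norm_num) (Finset.sum_nonneg fun k _ => ?_)
    simp only [Matrix.map_apply]
    positivity
  · exact ((hEabs.mul hQabs (by norm_num)).smul (by norm_num)).mono (by norm_num)
  · exact (RowLe.smul (ColLe.mul hEabsT hQabsT (by norm_num)) (by norm_num)).mono (by norm_num)

end

/-! ### Population moments of a decoded coordinate -/

section
variable {Ω : Type*} [MeasurableSpace Ω]

/-- Independent random variables with values in `[0, 1]` whose means are at most `μ`: the weights
`x*`, or their scaled versions `D⁻¹ x*`. -/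
structure SparseWeights {n : ℕ} (P : Measure Ω) (x : Fin n → Ω → ℝ) (μ : ℝ) : Prop where
  meas : ∀ i, Measurable (x i)
  mem_Icc : ∀ᵐ ω ∂P, ∀ i, x i ω ∈ Set.Icc (0 : ℝ) 1
  indep : iIndepFun x P
  mean_le : ∀ i, ∫ ω, x i ω ∂P ≤ μ

/-- The random variable `φ_α(∑ₖ zₖ xₖ + e)`: a decoded coordinate, where `e` is the contribution of
the noise in the data. -/
def thresholded {n : ℕ} (α : ℝ) (z : Fin n → ℝ) (x : Fin n → Ω → ℝ) (e : Ω → ℝ) (ω : Ω) : ℝ :=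
  max (∑ k, z k * x k ω + e ω - α) 0

lemma integrable_of_ae_abs_le {P : Measure Ω} [IsFiniteMeasure P] {f : Ω → ℝ} (hf : Measurable f)
    {C : ℝ} (h : ∀ᵐ ω ∂P, |f ω| ≤ C) : Integrable f P :=
  Integrable.of_bound hf.aestronglyMeasurable C h

/-- The effect of the `j`-th weight `x` on a thresholded coordinate. Here `a` stands for
the contribution of the other weights and `q + u` for the coefficient of `x`. A negative `q`, the
small part `u` and the noise `e` matter only if `a` exceeds `α / 2`, which has small probability by
Markov's inequality; only a positive `q` can make the coordinate fire by itself. -/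
lemma thresholded_sub_bounds {a q u x e α β L : ℝ} (hα : 0 < α) (hx0 : 0 ≤ x) (hx1 : x ≤ 1)
    (hu : |u| ≤ α / 4) (he : |e| ≤ β) (hβ : β ≤ α / 4) (haL : |a| ≤ L) :
    max (a + (q + u) * x + e - α) 0 - max (a - α) 0
        ≤ max q 0 * x + ((|q| + |u|) * x + β) * (2 / α * L) ∧
      -(((|q| + |u|) * x + β) * (2 / α * L))
        ≤ max (a + (q + u) * x + e - α) 0 - max (a - α) 0 := by
  have hL : 0 ≤ L := (abs_nonneg _).trans haL
  have hβ0 : 0 ≤ β := (abs_nonneg _).trans he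
  have h0 : 0 ≤ (|q| + |u|) * x + β := by positivity
  have ht : 0 ≤ 2 / α * L := by positivity
  have hp := mul_nonneg h0 ht
  have hux : |u * x| ≤ |u| * x := by rw [abs_mul, abs_of_nonneg hx0]
  have hqx : |q * x| ≤ |q| * x := by rw [abs_mul, abs_of_nonneg hx0]
  have hux' : |u| * x ≤ α / 4 := (mul_le_of_le_one_right (abs_nonneg _) hx1).trans hu
  have hqx' : q * x ≤ max q 0 * x := mul_le_mul_of_nonneg_right (le_max_left _ _) hx0
  have hq0 : 0 ≤ max q 0 * x := mul_nonneg (le_max_right _ _) hx0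
  have a1 := abs_le.1 hux
  have a2 := abs_le.1 hqx
  have a3 := abs_le.1 he
  by_cases ha : a ≤ α / 2
  · rw [max_eq_right (by linarith : a - α ≤ 0), sub_zero]
    refine ⟨max_le ?_ ?_, (neg_nonpos.2 hp).trans (le_max_right _ _)⟩
    · nlinarith
    · linarith
  · push Not at ha
    have ht1 : 1 ≤ 2 / α * L := by
      rw [div_mul_eq_mul_div, le_div_iff₀ hα]
      linarith [le_abs_self a]
    have hb : (|q| + |u|) * x + β ≤ ((|q| + |u|) * x + β) * (2 / α * L) :=
      le_mul_of_one_le_right h0 ht1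
    have hlip : |max (a + (q + u) * x + e - α) 0 - max (a - α) 0| ≤
        |(a + (q + u) * x + e - α) - (a - α)| := abs_max_sub_max_le_abs _ _ _
    have h1 : |(a + (q + u) * x + e - α) - (a - α)| ≤ (|q| + |u|) * x + β :=
      abs_le.2 ⟨by nlinarith, by nlinarith⟩
    have h2 := abs_le.1 (hlip.trans h1)
    exact ⟨by linarith, by linarith⟩

variable {n : ℕ} {P : Measure Ω} {x : Fin n → Ω → ℝ} {μ : ℝ}

namespace SparseWeights

lemma mean_nonneg (h : SparseWeights P x μ) (i : Fin n) : 0 ≤ ∫ ω, x i ω ∂P :=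
  integral_nonneg_of_ae (by filter_upwards [h.mem_Icc] with ω hω using (hω i).1)

/-- The total weighted contribution of the weights other than the `j`-th. -/
def rest (z : Fin n → ℝ) (x : Fin n → Ω → ℝ) (j : Fin n) (ω : Ω) : ℝ :=
  ∑ k ∈ Finset.univ.erase j, z k * x k ω

lemma rest_measurable (h : SparseWeights P x μ) (z : Fin n → ℝ) (j : Fin n) :
    Measurable (rest z x j) :=
  Finset.measurable_sum _ fun k _ => (h.meas k).const_mul _

lemma sum_eq_rest_add {Ω : Type*} (z : Fin n → ℝ) (x : Fin n → Ω → ℝ) (j : Fin n) (ω : Ω) :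
    ∑ k, z k * x k ω = rest z x j ω + z j * x j ω :=
  (Finset.sum_erase_add _ _ (Finset.mem_univ j)).symm

lemma abs_rest_le (h : SparseWeights P x μ) (z : Fin n → ℝ) (j : Fin n) :
    ∀ᵐ ω ∂P, |rest z x j ω| ≤ rest (fun k => |z k|) x j ω := by
  filter_upwards [h.mem_Icc] with ω hω
  refine (Finset.abs_sum_le_sum_abs _ _).trans (Finset.sum_le_sum fun k _ => ?_)
  rw [abs_mul, abs_of_nonneg (hω k).1]

lemma rest_abs_le (h : SparseWeights P x μ) (z : Fin n → ℝ) (j : Fin n) :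
    ∀ᵐ ω ∂P, 0 ≤ rest (fun k => |z k|) x j ω ∧
      rest (fun k => |z k|) x j ω ≤ ∑ k ∈ Finset.univ.erase j, |z k| := by
  filter_upwards [h.mem_Icc] with ω hω
  exact ⟨Finset.sum_nonneg fun k _ => mul_nonneg (abs_nonneg _) (hω k).1,
    Finset.sum_le_sum fun k _ => mul_le_of_le_one_right (abs_nonneg _) (hω k).2⟩

/-- The `j`-th weight is independent of everything that is computed from the other ones. -/
lemma indepFun_rest (h : SparseWeights P x μ) (z : Fin n → ℝ) (j : Fin n) :
    IndepFun (x j) (rest z x j) P := by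
  have h1 := h.indep.indepFun_finset {j} (Finset.univ.erase j) (by simp) h.meas
  have h2 : Measurable fun v : ({j} : Finset (Fin n)) → ℝ => v ⟨j, Finset.mem_singleton_self j⟩ :=
    measurable_pi_apply _
  have h3 : Measurable fun v : {k // k ∈ Finset.univ.erase j} → ℝ =>
      ∑ k, z k.1 * v k :=
    Finset.measurable_sum _ fun k _ => (measurable_pi_apply k).const_mul _
  have h4 := h1.comp h2 h3
  have h5 : rest z x j = (fun v : {k // k ∈ Finset.univ.erase j} → ℝ =>
      ∑ k, z k.1 * v k) ∘ fun ω k => x k ω := by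
    ext ω
    exact (Finset.sum_coe_sort (Finset.univ.erase j) fun k => z k * x k ω).symm
  rw [h5]
  exact h4

lemma integral_mul_comp_rest (h : SparseWeights P x μ) (z : Fin n → ℝ) (j : Fin n)
    {f g : ℝ → ℝ} (hf : Measurable f) (hg : Measurable g) :
    ∫ ω, f (x j ω) * g (rest z x j ω) ∂P = (∫ ω, f (x j ω) ∂P) * ∫ ω, g (rest z x j ω) ∂P :=
  ((h.indepFun_rest z j).comp hf hg).integral_fun_mul_eq_mul_integral
    (hf.comp (h.meas j)).aestronglyMeasurable
    (hg.comp (h.rest_measurable z j)).aestronglyMeasurable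

lemma thresholded_measurable (h : SparseWeights P x μ) (α : ℝ) (z : Fin n → ℝ) {e : Ω → ℝ}
    (he : Measurable e) : Measurable (thresholded α z x e) :=
  (((Finset.measurable_sum _ fun k _ => (h.meas k).const_mul _).add he).sub_const α).max
    measurable_const

lemma thresholded_nonneg {Ω : Type*} (α : ℝ) (z : Fin n → ℝ) (x : Fin n → Ω → ℝ) (e : Ω → ℝ)
    (ω : Ω) : 0 ≤ thresholded α z x e ω :=
  le_max_right _ _

lemma thresholded_le (h : SparseWeights P x μ) {α β : ℝ} (z : Fin n → ℝ) {e : Ω → ℝ}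
    (he : ∀ᵐ ω ∂P, |e ω| ≤ β) (hβ : β ≤ α) :
    ∀ᵐ ω ∂P, thresholded α z x e ω ≤ ∑ k, |z k| * x k ω := by
  filter_upwards [he, h.mem_Icc] with ω h1 h2
  have h3 : ∑ k, z k * x k ω ≤ ∑ k, |z k| * x k ω := Finset.sum_le_sum fun k _ =>
    mul_le_mul_of_nonneg_right (le_abs_self _) (h2 k).1
  have h4 : 0 ≤ ∑ k, |z k| * x k ω :=
    Finset.sum_nonneg fun k _ => mul_nonneg (abs_nonneg _) (h2 k).1
  have h5 := (abs_le.1 h1).2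
  exact max_le (by linarith) h4

lemma thresholded_le_const (h : SparseWeights P x μ) {α β : ℝ} {z : Fin n → ℝ} {e : Ω → ℝ}
    (he : ∀ᵐ ω ∂P, |e ω| ≤ β) (hβ : β ≤ α) (hz : ∑ k, |z k| ≤ 3 / 2) :
    ∀ᵐ ω ∂P, |thresholded α z x e ω| ≤ 3 / 2 := by
  filter_upwards [h.thresholded_le z he hβ, h.mem_Icc] with ω h1 h2
  rw [abs_of_nonneg (thresholded_nonneg _ _ _ _ _)]
  exact (h1.trans (Finset.sum_le_sum fun k _ =>
    mul_le_of_le_one_right (abs_nonneg _) (h2 k).2)).trans hz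

/-- Up to the threshold and the other weights, the `i`-th decoded coordinate is `z_i x_i`. -/
lemma abs_thresholded_sub_le (h : SparseWeights P x μ) {α β : ℝ} {z : Fin n → ℝ} {e : Ω → ℝ}
    (he : ∀ᵐ ω ∂P, |e ω| ≤ β) (hβ : β ≤ α) (i : Fin n) (hzi : 0 ≤ z i) :
    ∀ᵐ ω ∂P, |thresholded α z x e ω - z i * x i ω| ≤ rest (fun k => |z k|) x i ω + 2 * α ∧
      thresholded α z x e ω ≤ z i * x i ω + rest (fun k => |z k|) x i ω := by
  filter_upwards [he, h.mem_Icc, h.abs_rest_le z i] with ω h1 h2 h3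
  have h4 : 0 ≤ z i * x i ω := mul_nonneg hzi (h2 i).1
  have h5 := abs_le.1 h1
  have h6 := abs_le.1 h3
  have h7 : 0 ≤ rest (fun k => |z k|) x i ω := (abs_nonneg _).trans h3
  simp only [thresholded, sum_eq_rest_add z x i ω]
  constructor
  · nth_rewrite 2 [← max_eq_left h4]
    refine (abs_max_sub_max_le_abs _ _ _).trans (abs_le.2 ⟨by linarith, by linarith⟩)
  · exact max_le (by linarith) (by linarith)

lemma integrable_mul (h : SparseWeights P x μ) (i : Fin n) {f : Ω → ℝ} (hf : Integrable f P) :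
    Integrable (fun ω => x i ω * f ω) P :=
  hf.bdd_mul (h.meas i).aestronglyMeasurable (c := 1) (by
    filter_upwards [h.mem_Icc] with ω hω
    rw [Real.norm_eq_abs, abs_of_nonneg (hω i).1]
    exact (hω i).2)

variable [IsProbabilityMeasure P]

lemma integrable (h : SparseWeights P x μ) (i : Fin n) : Integrable (x i) P :=
  integrable_of_ae_abs_le (h.meas i) (C := 1) (by
    filter_upwards [h.mem_Icc] with ω hω using abs_le.2 ⟨by linarith [(hω i).1], (hω i).2⟩)

lemma integrable_sq (h : SparseWeights P x μ) (i : Fin n) : Integrable (fun ω => x i ω ^ 2) P :=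
  integrable_of_ae_abs_le ((h.meas i).pow_const 2) (C := 1) (by
    filter_upwards [h.mem_Icc] with ω hω
    rw [abs_of_nonneg (sq_nonneg _)]
    exact pow_le_one₀ (hω i).1 (hω i).2)

lemma integrable_rest (h : SparseWeights P x μ) (z : Fin n → ℝ) (j : Fin n) :
    Integrable (rest z x j) P :=
  integrable_finsetSum _ fun k _ => (h.integrable k).const_mul _

lemma integral_rest_abs_le (h : SparseWeights P x μ) (z : Fin n → ℝ) (j : Fin n) :
    ∫ ω, rest (fun k => |z k|) x j ω ∂P ≤ (∑ k ∈ Finset.univ.erase j, |z k|) * μ := by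
  unfold rest
  rw [integral_finsetSum _ fun k _ => (h.integrable k).const_mul _, Finset.sum_mul]
  refine Finset.sum_le_sum fun k _ => ?_
  rw [integral_const_mul]
  exact mul_le_mul_of_nonneg_left (h.mean_le k) (abs_nonneg _)

lemma integral_thresholded_le (h : SparseWeights P x μ) (hμ : 0 ≤ μ) {α β : ℝ} {z : Fin n → ℝ}
    {e : Ω → ℝ} (hem : Measurable e) (he : ∀ᵐ ω ∂P, |e ω| ≤ β) (hβ : β ≤ α)
    (hz : ∑ k, |z k| ≤ 3 / 2) :
    ∫ ω, thresholded α z x e ω ∂P ≤ 3 / 2 * μ := by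
  have hi : ∀ k ∈ Finset.univ, Integrable (fun ω => |z k| * x k ω) P :=
    fun k _ => (h.integrable k).const_mul _
  calc ∫ ω, thresholded α z x e ω ∂P ≤ ∫ ω, ∑ k, |z k| * x k ω ∂P :=
        integral_mono_ae (integrable_of_ae_abs_le (h.thresholded_measurable α z hem)
          (h.thresholded_le_const he hβ hz)) (integrable_finsetSum _ hi) (h.thresholded_le z he hβ)
    _ ≤ ∑ k, |z k| * μ := by
        rw [integral_finsetSum _ hi]
        refine Finset.sum_le_sum fun k _ => ?_
        rw [integral_const_mul]
        exact mul_le_mul_of_nonneg_left (h.mean_le k) (abs_nonneg _)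
    _ ≤ 3 / 2 * μ := by
        rw [← Finset.sum_mul]
        exact mul_le_mul_of_nonneg_right hz hμ

/-- Covariance of the `j`-th weight with a thresholded coordinate in which it has the coefficient
`q + u`. Up to terms that carry the small factor `3 μ / α` or `μ ^ 2`, it lies
between `0` and `max q 0 * E[x_j²]`. -/
theorem covariance_bounds (h : SparseWeights P x μ) (hμ : 0 ≤ μ) {α β : ℝ} (hα : 0 < α)
    {z : Fin n → ℝ} (hz : ∑ k, |z k| ≤ 3 / 2) {e : Ω → ℝ} (hem : Measurable e)
    (he : ∀ᵐ ω ∂P, |e ω| ≤ β) (hβ0 : 0 ≤ β) (hβ : β ≤ α / 4) (j : Fin n) {q u : ℝ}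
    (hzj : z j = q + u) (hu : |u| ≤ α / 4) :
    ∫ ω, x j ω * thresholded α z x e ω ∂P
          - (∫ ω, x j ω ∂P) * ∫ ω, thresholded α z x e ω ∂P
        ≤ max q 0 * ∫ ω, x j ω ^ 2 ∂P
          + 3 * μ / α * ((|q| + |u|) * (∫ ω, x j ω ^ 2 ∂P + μ ^ 2) + 2 * β * μ) ∧
      -(max q 0 * μ ^ 2
          + 3 * μ / α * ((|q| + |u|) * (∫ ω, x j ω ^ 2 ∂P + μ ^ 2) + 2 * β * μ))
        ≤ ∫ ω, x j ω * thresholded α z x e ω ∂P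
          - (∫ ω, x j ω ∂P) * ∫ ω, thresholded α z x e ω ∂P := by
  set X := thresholded α z x e with hX
  set h0 : Ω → ℝ := fun ω => max (rest z x j ω - α) 0 with hh0
  set t : Ω → ℝ := fun ω => 2 / α * rest (fun k => |z k|) x j ω with ht
  set c := |q| + |u| with hc
  set s := ∫ ω, x j ω ^ 2 ∂P with hs
  set a := ∫ ω, x j ω ∂P with ha
  set T := ∫ ω, t ω ∂P with hT
  have hc0 : 0 ≤ c := by positivity
  have hs0 : 0 ≤ s := integral_nonneg fun ω => sq_nonneg _
  have ha0 : 0 ≤ a := h.mean_nonneg j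
  have haμ : a ≤ μ := h.mean_le j
  have hq0 : 0 ≤ max q 0 := le_max_right _ _
  have hzj' : ∑ k ∈ Finset.univ.erase j, |z k| ≤ 3 / 2 :=
    (Finset.sum_le_sum_of_subset_of_nonneg (Finset.erase_subset _ _)
      fun _ _ _ => abs_nonneg _).trans hz
  have hTμ : T ≤ 3 * μ / α := by
    rw [hT, ht, integral_const_mul, div_mul_eq_mul_div]
    refine div_le_div_of_nonneg_right ?_ hα.le
    have := h.integral_rest_abs_le z j
    nlinarith
  have hT0 : 0 ≤ T := integral_nonneg_of_ae (by
    filter_upwards [h.rest_abs_le z j] with ω hω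
    exact mul_nonneg (by positivity) hω.1)
  have mt : Measurable t := (h.rest_measurable _ j).const_mul _
  have mh0 : Measurable h0 := ((h.rest_measurable z j).sub_const α).max measurable_const
  have mX : Measurable X := h.thresholded_measurable α z hem
  have bX : ∀ᵐ ω ∂P, |X ω| ≤ 3 / 2 := h.thresholded_le_const he (by linarith) hz
  have bt : ∀ᵐ ω ∂P, 0 ≤ t ω ∧ t ω ≤ 2 / α * (3 / 2) := by
    filter_upwards [h.rest_abs_le z j] with ω hω
    exact ⟨mul_nonneg (by positivity) hω.1,
      mul_le_mul_of_nonneg_left (hω.2.trans hzj') (by positivity)⟩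
  have bh0 : ∀ᵐ ω ∂P, |h0 ω| ≤ 3 / 2 := by
    filter_upwards [h.rest_abs_le z j, h.abs_rest_le z j] with ω h1 h2
    rw [abs_of_nonneg (le_max_right _ _)]
    refine max_le ?_ (by norm_num)
    linarith [(abs_le.1 h2).2]
  have bx := h.mem_Icc
  have iX : Integrable X P := integrable_of_ae_abs_le mX bX
  have ih0 : Integrable h0 P := integrable_of_ae_abs_le mh0 bh0
  have ix := h.integrable j
  have ixs := h.integrable_sq j
  have it : Integrable t P := integrable_of_ae_abs_le mt (C := 2 / α * (3 / 2)) (by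
    filter_upwards [bt] with ω hω
    rw [abs_of_nonneg hω.1]
    exact hω.2)
  have bxj : ∀ᵐ ω ∂P, ‖x j ω‖ ≤ 1 := by
    filter_upwards [bx] with ω hω
    rw [Real.norm_eq_abs, abs_of_nonneg (hω j).1]
    exact (hω j).2
  have bxj2 : ∀ᵐ ω ∂P, ‖x j ω ^ 2‖ ≤ 1 := by
    filter_upwards [bx] with ω hω
    rw [Real.norm_eq_abs, abs_of_nonneg (sq_nonneg _)]
    exact pow_le_one₀ (hω j).1 (hω j).2
  have ixX : Integrable (fun ω => x j ω * X ω) P :=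
    iX.bdd_mul (h.meas j).aestronglyMeasurable bxj
  have ixh : Integrable (fun ω => x j ω * h0 ω) P :=
    ih0.bdd_mul (h.meas j).aestronglyMeasurable bxj
  have ixt : Integrable (fun ω => x j ω * t ω) P :=
    it.bdd_mul (h.meas j).aestronglyMeasurable bxj
  have ixst : Integrable (fun ω => x j ω ^ 2 * t ω) P :=
    it.bdd_mul ((h.meas j).pow_const 2).aestronglyMeasurable bxj2
  -- `h0` and `t` do not involve the `j`-th weight
  have exh : ∫ ω, x j ω * h0 ω ∂P = a * ∫ ω, h0 ω ∂P :=
    h.integral_mul_comp_rest z j measurable_id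
      (((measurable_id).sub_const α).max measurable_const)
  have ext : ∫ ω, x j ω * t ω ∂P = a * T :=
    h.integral_mul_comp_rest (fun k => |z k|) j measurable_id (measurable_id.const_mul (2 / α))
  have exst : ∫ ω, x j ω ^ 2 * t ω ∂P = s * T :=
    h.integral_mul_comp_rest (fun k => |z k|) j (measurable_id.pow_const 2)
      (measurable_id.const_mul (2 / α))
  have hΔ : ∀ᵐ ω ∂P, X ω - h0 ω ≤ max q 0 * x j ω + (c * x j ω + β) * t ω ∧
      -((c * x j ω + β) * t ω) ≤ X ω - h0 ω := by
    filter_upwards [bx, he, h.abs_rest_le z j] with ω h1 h2 h3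
    have := thresholded_sub_bounds (q := q) hα (h1 j).1 (h1 j).2 hu h2 hβ h3
    rw [← hzj] at this
    simp only [hX, thresholded, sum_eq_rest_add z x j ω]
    exact this
  have e1 : ∫ ω, (c * x j ω + β) * t ω ∂P = c * (a * T) + β * T := by
    have : ∀ ω, (c * x j ω + β) * t ω = c * (x j ω * t ω) + β * t ω := fun ω => by ring
    simp_rw [this]
    rw [integral_add (ixt.const_mul c) (it.const_mul β), integral_const_mul, integral_const_mul,
      ext]
  have i1 : Integrable (fun ω => (c * x j ω + β) * t ω) P := by
    have : ∀ ω, (c * x j ω + β) * t ω = c * (x j ω * t ω) + β * t ω := fun ω => by ring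
    simp_rw [this]
    exact (ixt.const_mul c).add (it.const_mul β)
  have e2 : ∫ ω, x j ω * ((c * x j ω + β) * t ω) ∂P = c * (s * T) + β * (a * T) := by
    have : ∀ ω, x j ω * ((c * x j ω + β) * t ω) = c * (x j ω ^ 2 * t ω) + β * (x j ω * t ω) :=
      fun ω => by ring
    simp_rw [this]
    rw [integral_add (ixst.const_mul c) (ixt.const_mul β), integral_const_mul,
      integral_const_mul, ext, exst]
  have i2 : Integrable (fun ω => x j ω * ((c * x j ω + β) * t ω)) P :=
    i1.bdd_mul (h.meas j).aestronglyMeasurable bxj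
  have u1 : ∫ ω, X ω ∂P - ∫ ω, h0 ω ∂P ≤ max q 0 * a + (c * (a * T) + β * T) := by
    rw [← integral_sub iX ih0, ← e1, ha, ← integral_const_mul,
      ← integral_add (ix.const_mul _) i1]
    refine integral_mono_ae (iX.sub ih0) ((ix.const_mul _).add i1) ?_
    filter_upwards [hΔ] with ω hω using hω.1
  have l1 : -(c * (a * T) + β * T) ≤ ∫ ω, X ω ∂P - ∫ ω, h0 ω ∂P := by
    rw [← integral_sub iX ih0, ← e1, ← integral_neg]
    refine integral_mono_ae i1.neg (iX.sub ih0) ?_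
    filter_upwards [hΔ] with ω hω using hω.2
  have u2 : ∫ ω, x j ω * X ω ∂P - ∫ ω, x j ω * h0 ω ∂P ≤
      max q 0 * s + (c * (s * T) + β * (a * T)) := by
    rw [← integral_sub ixX ixh, ← e2, hs, ← integral_const_mul,
      ← integral_add (ixs.const_mul _) i2]
    refine integral_mono_ae (ixX.sub ixh) ((ixs.const_mul _).add i2) ?_
    filter_upwards [hΔ, bx] with ω hω h1
    have := mul_le_mul_of_nonneg_left hω.1 (h1 j).1
    linarith
  have l2 : -(c * (s * T) + β * (a * T)) ≤
      ∫ ω, x j ω * X ω ∂P - ∫ ω, x j ω * h0 ω ∂P := by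
    rw [← integral_sub ixX ixh, ← e2, ← integral_neg]
    refine integral_mono_ae i2.neg (ixX.sub ixh) ?_
    filter_upwards [hΔ, bx] with ω hω h1
    have := mul_le_mul_of_nonneg_left hω.2 (h1 j).1
    linarith
  have u1' := mul_le_mul_of_nonneg_left u1 ha0
  have l1' := mul_le_mul_of_nonneg_left l1 ha0
  have ha2 : a * a ≤ μ ^ 2 := by nlinarith
  have key : c * (s * T) + β * (a * T) + a * (c * (a * T) + β * T) ≤
      3 * μ / α * (c * (s + μ ^ 2) + 2 * β * μ) := by
    have k1 : c * (s * T) + β * (a * T) + a * (c * (a * T) + β * T)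
        = T * (c * (s + a * a) + 2 * β * a) := by ring
    rw [k1]
    have k2 : c * (s + a * a) + 2 * β * a ≤ c * (s + μ ^ 2) + 2 * β * μ := by
      have := mul_le_mul_of_nonneg_left ha2 hc0
      have := mul_le_mul_of_nonneg_left haμ hβ0
      linarith
    exact mul_le_mul hTμ k2 (by positivity) (by positivity)
  have hqa : a * (max q 0 * a) ≤ max q 0 * μ ^ 2 := by
    have := mul_le_mul_of_nonneg_left ha2 hq0
    linarith
  constructor
  · linarith
  · linarith

lemma integrable_thresholded (h : SparseWeights P x μ) {α β : ℝ} {z : Fin n → ℝ}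
    (hz : ∑ k, |z k| ≤ 3 / 2) {e : Ω → ℝ} (hem : Measurable e) (he : ∀ᵐ ω ∂P, |e ω| ≤ β)
    (hβ : β ≤ α) : Integrable (thresholded α z x e) P :=
  integrable_of_ae_abs_le (h.thresholded_measurable α z hem) (h.thresholded_le_const he hβ hz)

lemma integral_mul_rest_add (h : SparseWeights P x μ) (z : Fin n → ℝ) (i : Fin n) (C : ℝ) :
    ∫ ω, x i ω * (rest z x i ω + C) ∂P
      = (∫ ω, x i ω ∂P) * (∫ ω, rest z x i ω ∂P + C) := by
  have h1 := h.integral_mul_comp_rest z i measurable_id (measurable_id.add_const C)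
  have h2 : ∫ ω, (rest z x i ω + C) ∂P = ∫ ω, rest z x i ω ∂P + C := by
    rw [integral_add (h.integrable_rest z i) (integrable_const C)]
    simp
  rw [← h2]
  exact h1

theorem abs_covariance_sub_le (h : SparseWeights P x μ) (hμ : 0 ≤ μ) {α β : ℝ} (hα : 0 < α)
    {z : Fin n → ℝ} (hz : ∑ k, |z k| ≤ 3 / 2) {e : Ω → ℝ} (hem : Measurable e)
    (he : ∀ᵐ ω ∂P, |e ω| ≤ β) (hβ : β ≤ α) (i : Fin n) (hzi : 0 ≤ z i) :
    |∫ ω, x i ω * thresholded α z x e ω ∂P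
          - (∫ ω, x i ω ∂P) * ∫ ω, thresholded α z x e ω ∂P - z i * ∫ ω, x i ω ^ 2 ∂P|
      ≤ 3 * μ ^ 2 + 2 * α * μ := by
  set X := thresholded α z x e with hX
  have iX : Integrable X P := h.integrable_thresholded hz hem he hβ
  have hEX := h.integral_thresholded_le hμ hem he hβ hz
  have hEX0 : 0 ≤ ∫ ω, X ω ∂P := integral_nonneg fun ω => thresholded_nonneg _ _ _ _ _
  have hzi' : ∑ k ∈ Finset.univ.erase i, |z k| ≤ 3 / 2 :=
    (Finset.sum_le_sum_of_subset_of_nonneg (Finset.erase_subset _ _)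
      fun _ _ _ => abs_nonneg _).trans hz
  have hL := h.integral_rest_abs_le z i
  have hL0 : 0 ≤ ∫ ω, rest (fun k => |z k|) x i ω ∂P := integral_nonneg_of_ae (by
    filter_upwards [h.rest_abs_le z i] with ω hω using hω.1)
  have ha0 := h.mean_nonneg i
  have haμ := h.mean_le i
  have h1 : |∫ ω, x i ω * X ω ∂P - z i * ∫ ω, x i ω ^ 2 ∂P| ≤
      ∫ ω, x i ω * (rest (fun k => |z k|) x i ω + 2 * α) ∂P := by
    rw [← integral_const_mul, ← integral_sub (h.integrable_mul i iX)
      ((h.integrable_sq i).const_mul _)]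
    refine (abs_integral_le_integral_abs).trans (integral_mono_ae ?_ ?_ ?_)
    · exact ((h.integrable_mul i iX).sub ((h.integrable_sq i).const_mul _)).abs
    · exact h.integrable_mul i ((h.integrable_rest _ i).add (integrable_const _))
    · filter_upwards [h.abs_thresholded_sub_le he hβ i hzi, h.mem_Icc] with ω h2 h3
      have : x i ω * X ω - z i * x i ω ^ 2 = x i ω * (X ω - z i * x i ω) := by ring
      rw [this, abs_mul, abs_of_nonneg (h3 i).1]
      exact mul_le_mul_of_nonneg_left h2.1 (h3 i).1
  rw [h.integral_mul_rest_add] at h1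
  have h2 : (∫ ω, x i ω ∂P) * (∫ ω, rest (fun k => |z k|) x i ω ∂P + 2 * α) ≤
      μ * (3 / 2 * μ + 2 * α) := by
    refine mul_le_mul haμ ?_ (by positivity) hμ
    nlinarith
  have h3 : (∫ ω, x i ω ∂P) * ∫ ω, X ω ∂P ≤ μ * (3 / 2 * μ) := mul_le_mul haμ hEX hEX0 hμ
  have h4 := mul_nonneg ha0 hEX0
  have h5 := abs_le.1 h1
  exact abs_le.2 ⟨by nlinarith, by nlinarith⟩

theorem second_moment_bounds (h : SparseWeights P x μ) (hμ : 0 ≤ μ) {α β : ℝ} (hα : 0 < α)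
    {z : Fin n → ℝ} (hz : ∑ k, |z k| ≤ 3 / 2) {e : Ω → ℝ} (hem : Measurable e)
    (he : ∀ᵐ ω ∂P, |e ω| ≤ β) (hβ : β ≤ α) (i : Fin n) (hzi : 0 ≤ z i) {o s : ℝ}
    (ho : ∑ k ∈ Finset.univ.erase i, |z k| ≤ o) (hs : ∀ k, ∫ ω, x k ω ^ 2 ∂P ≤ s) :
    z i ^ 2 * ∫ ω, x i ω ^ 2 ∂P - 2 * z i * μ * (o * μ + 2 * α)
        ≤ ∫ ω, thresholded α z x e ω ^ 2 ∂P ∧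
      ∫ ω, thresholded α z x e ω ^ 2 ∂P
        ≤ z i ^ 2 * ∫ ω, x i ω ^ 2 ∂P + 2 * z i * μ * (o * μ) + o ^ 2 * s := by
  set X := thresholded α z x e with hX
  set L := rest (fun k => |z k|) x i with hL
  have mX : Measurable X := h.thresholded_measurable α z hem
  have iX2 : Integrable (fun ω => X ω ^ 2) P :=
    integrable_of_ae_abs_le (mX.pow_const 2) (C := (3 / 2) ^ 2) (by
      filter_upwards [h.thresholded_le_const he hβ hz] with ω hω
      rw [abs_pow]
      exact pow_le_pow_left₀ (abs_nonneg _) hω 2)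
  have hL' := h.integral_rest_abs_le z i
  have hL0 : 0 ≤ ∫ ω, L ω ∂P := integral_nonneg_of_ae (by
    filter_upwards [h.rest_abs_le z i] with ω hω using hω.1)
  have ho0 : 0 ≤ o := (Finset.sum_nonneg fun _ _ => abs_nonneg _).trans ho
  have ha0 := h.mean_nonneg i
  have haμ := h.mean_le i
  have hLo : ∫ ω, L ω ∂P ≤ o * μ := hL'.trans (mul_le_mul_of_nonneg_right ho hμ)
  have mL : Measurable L := h.rest_measurable _ i
  have iL : Integrable L P := h.integrable_rest _ i
  have ixL : ∀ C, Integrable (fun ω => x i ω * (L ω + C)) P := fun C =>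
    h.integrable_mul i (iL.add (integrable_const _))
  have key := h.abs_thresholded_sub_le he hβ i hzi
  constructor
  · have h1 : z i ^ 2 * ∫ ω, x i ω ^ 2 ∂P - 2 * z i * ∫ ω, x i ω * (L ω + 2 * α) ∂P
        ≤ ∫ ω, X ω ^ 2 ∂P := by
      rw [← integral_const_mul, ← integral_const_mul,
        ← integral_sub ((h.integrable_sq i).const_mul _) ((ixL _).const_mul _)]
      refine integral_mono_ae (((h.integrable_sq i).const_mul _).sub ((ixL _).const_mul _)) iX2 ?_
      filter_upwards [key, h.mem_Icc] with ω h2 h3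
      have h4 : 0 ≤ z i * x i ω := mul_nonneg hzi (h3 i).1
      have h5 := (abs_le.1 h2.1).1
      have h6 : (z i * x i ω) * (z i * x i ω - X ω) ≤ (z i * x i ω) * (L ω + 2 * α) :=
        mul_le_mul_of_nonneg_left (by linarith) h4
      have h7 := sq_nonneg (X ω - z i * x i ω)
      nlinarith
    rw [h.integral_mul_rest_add] at h1
    have h2 : (∫ ω, x i ω ∂P) * (∫ ω, L ω ∂P + 2 * α) ≤ μ * (o * μ + 2 * α) :=
      mul_le_mul haμ (by linarith) (by positivity) hμ
    have h3 := mul_le_mul_of_nonneg_left h2 (by positivity : 0 ≤ 2 * z i)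
    linarith
  · have hw : ∀ k ∈ Finset.univ.erase i, Integrable (fun ω => |z k| * x k ω ^ 2) P :=
      fun k _ => (h.integrable_sq k).const_mul _
    set V : Ω → ℝ := fun ω => ∑ k ∈ Finset.univ.erase i, |z k| * x k ω ^ 2 with hV
    have iV : Integrable V P := integrable_finsetSum _ hw
    have hs0 : 0 ≤ s := (integral_nonneg fun ω => sq_nonneg _).trans (hs i)
    have hEV : ∫ ω, V ω ∂P ≤ o * s := by
      rw [hV, integral_finsetSum _ hw]
      calc _ ≤ ∑ k ∈ Finset.univ.erase i, |z k| * s := by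
            refine Finset.sum_le_sum fun k _ => ?_
            rw [integral_const_mul]
            exact mul_le_mul_of_nonneg_left (hs k) (abs_nonneg _)
        _ ≤ o * s := by
            rw [← Finset.sum_mul]
            exact mul_le_mul_of_nonneg_right ho hs0
    have h1 : ∫ ω, X ω ^ 2 ∂P ≤ z i ^ 2 * ∫ ω, x i ω ^ 2 ∂P
        + 2 * z i * ∫ ω, x i ω * (L ω + 0) ∂P + o * ∫ ω, V ω ∂P := by
      rw [← integral_const_mul, ← integral_const_mul, ← integral_const_mul,
        ← integral_add ((h.integrable_sq i).const_mul _) ((ixL _).const_mul _),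
        ← integral_add (f := fun ω => z i ^ 2 * x i ω ^ 2 + 2 * z i * (x i ω * (L ω + 0)))
          (((h.integrable_sq i).const_mul _).add ((ixL _).const_mul _)) (iV.const_mul _)]
      refine integral_mono_ae iX2 ((((h.integrable_sq i).const_mul _).add
        ((ixL _).const_mul _)).add (iV.const_mul _)) ?_
      filter_upwards [key, h.mem_Icc] with ω h2 h3
      have h4 : 0 ≤ X ω := thresholded_nonneg _ _ _ _ _
      have h5 : X ω ^ 2 ≤ (z i * x i ω + L ω) ^ 2 := pow_le_pow_left₀ h4 h2.2 2
      -- Cauchy-Schwarz keeps the bound linear in the second moments of the other weights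
      have h6 : L ω ^ 2 ≤ (∑ k ∈ Finset.univ.erase i, |z k|) * V ω :=
        Finset.sum_sq_le_sum_mul_sum_of_sq_le_mul _ (fun k _ => abs_nonneg _)
          (fun k _ => by positivity) (fun k _ => le_of_eq (by ring))
      have h7 : 0 ≤ V ω := Finset.sum_nonneg fun k _ => by positivity
      have h8 := h6.trans (mul_le_mul_of_nonneg_right ho h7)
      nlinarith
    rw [h.integral_mul_rest_add] at h1
    have h2 : (∫ ω, x i ω ∂P) * (∫ ω, L ω ∂P + 0) ≤ μ * (o * μ) :=
      mul_le_mul haμ (by linarith) (by linarith) hμ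
    have h3 := mul_le_mul_of_nonneg_left h2 (by positivity : 0 ≤ 2 * z i)
    have h4 := mul_le_mul_of_nonneg_left hEV ho0
    nlinarith

/-- If `ν` is uncorrelated with every function of the weights, then its correlation with a decoded
coordinate is due to the noise `e` in this coordinate, which matters only when the coordinate is
active. -/
theorem abs_integral_noise_mul_le (h : SparseWeights P x μ) (hμ : 0 ≤ μ) {α β : ℝ} (hα : 0 < α)
    {z : Fin n → ℝ} (hz : ∑ k, |z k| ≤ 3 / 2) {e ν : Ω → ℝ} (hem : Measurable e)
    (he : ∀ᵐ ω ∂P, |e ω| ≤ β) (hβ0 : 0 ≤ β) (hβ : β ≤ α / 4) (hν : Measurable ν) {C : ℝ}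
    (hC : 0 ≤ C) (hνC : ∀ᵐ ω ∂P, |ν ω| ≤ C)
    (hν0 : ∫ ω, ν ω * thresholded α z x (fun _ => 0) ω ∂P = 0) :
    |∫ ω, ν ω * thresholded α z x e ω ∂P| ≤ C * (β * (3 * μ / α)) := by
  have he0 : ∀ᵐ ω ∂P, |(fun _ => 0 : Ω → ℝ) ω| ≤ β := Filter.Eventually.of_forall fun ω => by
    simpa using hβ0
  have iX := h.integrable_thresholded (α := α) hz hem he (by linarith)
  have iX0 := h.integrable_thresholded (α := α) hz measurable_const he0 (by linarith)
  have hνC' : ∀ᵐ ω ∂P, ‖ν ω‖ ≤ C := hνC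
  have i1 := iX.bdd_mul hν.aestronglyMeasurable hνC'
  have i0 := iX0.bdd_mul hν.aestronglyMeasurable hνC'
  have hi : ∀ k ∈ Finset.univ, Integrable (fun ω => |z k| * x k ω) P :=
    fun k _ => (h.integrable k).const_mul _
  have h1 : ∫ ω, ν ω * thresholded α z x e ω ∂P = ∫ ω, (ν ω * thresholded α z x e ω
      - ν ω * thresholded α z x (fun _ => 0) ω) ∂P := by
    rw [integral_sub i1 i0, hν0, sub_zero]
  rw [h1]
  calc _ ≤ ∫ ω, |ν ω * thresholded α z x e ω
          - ν ω * thresholded α z x (fun _ => 0) ω| ∂P := abs_integral_le_integral_abs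
    _ ≤ ∫ ω, C * (β * (2 / α)) * ∑ k, |z k| * x k ω ∂P := by
        refine integral_mono_ae (i1.sub i0).abs ((integrable_finsetSum _ hi).const_mul _) ?_
        filter_upwards [he, h.mem_Icc, hνC] with ω h2 h3 h4
        have h5 : |∑ k, z k * x k ω| ≤ ∑ k, |z k| * x k ω :=
          (Finset.abs_sum_le_sum_abs _ _).trans (Finset.sum_le_sum fun k _ => by
            rw [abs_mul, abs_of_nonneg (h3 k).1])
        have h6 := thresholded_sub_bounds (q := 0) (u := 0) (x := 0) hα le_rfl zero_le_one
          (by rw [abs_zero]; positivity) h2 hβ h5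
        simp only [add_zero, mul_zero, abs_zero, zero_add] at h6
        rw [← mul_sub, abs_mul, mul_assoc]
        refine mul_le_mul h4 ?_ (abs_nonneg _) hC
        simp only [thresholded, add_zero]
        exact abs_le.2 ⟨by linarith, by linarith⟩
    _ ≤ C * (β * (3 * μ / α)) := by
        rw [integral_const_mul, integral_finsetSum _ hi, mul_assoc]
        refine mul_le_mul_of_nonneg_left ?_ hC
        have h2 : ∑ k, ∫ ω, |z k| * x k ω ∂P ≤ 3 / 2 * μ := by
          calc _ ≤ ∑ k, |z k| * μ := Finset.sum_le_sum fun k _ => by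
                rw [integral_const_mul]
                exact mul_le_mul_of_nonneg_left (h.mean_le k) (abs_nonneg _)
            _ ≤ _ := by
                rw [← Finset.sum_mul]
                exact mul_le_mul_of_nonneg_right hz hμ
        rw [mul_assoc]
        refine mul_le_mul_of_nonneg_left ?_ hβ0
        calc _ ≤ 2 / α * (3 / 2 * μ) := mul_le_mul_of_nonneg_left h2 (by positivity)
          _ = 3 * μ / α := by ring

end SparseWeights

end

/-! ### Empirical quantities -/

/-- Empirical mean of a sample. -/
noncomputable def sampleMean {N : ℕ} (f : Fin N → ℝ) : ℝ :=
  (N : ℝ)⁻¹ * ∑ a, f a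

/-- Empirical covariance of a sample of pairs. -/
noncomputable def sampleCov {N : ℕ} (f g : Fin N → ℝ) : ℝ :=
  sampleMean (fun a => f a * g a) - sampleMean f * sampleMean g

/-- The decoded coordinate `φ_α(u · x* + v · ν)` as a function of the draw `(x*, ν)`. -/
noncomputable def feature {n m : ℕ} (α : ℝ) (u : Fin n → ℝ) (v : Fin m → ℝ) : Draw n m → ℝ :=
  thresholded α u (fun j z => z.1 j) (fun z => ∑ k, v k * z.2 k)

/-- A batch of draws is representative if, uniformly over all decoded coordinates with bounded
coefficients, the covariances with the weights and the second moment are within `τ` of their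
population values, and the covariances with the noise are at most `ω`. As this holds for all
coordinates at once, the matrix that is used for decoding may depend on the batch. -/
structure Representative {n m N : ℕ} (P : Measure (Draw n m)) (α V τ ω : ℝ)
    (z : Fin N → Draw n m) : Prop where
  cov : ∀ u v, ∑ j, |u j| ≤ 3 / 2 → ∑ k, |v k| ≤ V → ∀ j,
    |sampleCov (fun a => (z a).1 j) (fun a => feature α u v (z a))
      - (∫ y, y.1 j * feature α u v y ∂P - (∫ y, y.1 j ∂P) * ∫ y, feature α u v y ∂P)| ≤ τ
  second : ∀ u v, ∑ j, |u j| ≤ 3 / 2 → ∑ k, |v k| ≤ V →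
    |sampleMean (fun a => feature α u v (z a) ^ 2) - ∫ y, feature α u v y ^ 2 ∂P| ≤ τ
  noise : ∀ u v, ∑ j, |u j| ≤ 3 / 2 → ∑ k, |v k| ≤ V → ∀ k,
    |sampleCov (fun a => (z a).2 k) (fun a => feature α u v (z a))| ≤ ω

section
variable {m n N : ℕ}

lemma sum_sum_sub_mul_sub (f g : Fin N → ℝ) :
    ((N : ℝ) ^ 2)⁻¹ * ∑ a, ∑ b, (f a - f b) * (g a - g b) = 2 * sampleCov f g := by
  have h1 : ∀ a b, (f a - f b) * (g a - g b) = f a * g a + f b * g b - f a * g b - g a * f b :=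
    fun a b => by ring
  have h2 : ∑ a, ∑ b, (f a - f b) * (g a - g b)
      = 2 * ((N : ℝ) * ∑ a, f a * g a) - 2 * ((∑ a, f a) * ∑ a, g a) := by
    simp only [h1, Finset.sum_sub_distrib, Finset.sum_add_distrib]
    simp only [Finset.sum_const, Finset.card_univ, Fintype.card_fin, nsmul_eq_mul]
    simp only [← Finset.mul_sum, ← Finset.sum_mul]
    ring
  rw [h2]
  simp only [sampleCov, sampleMean]
  rcases eq_or_ne (N : ℝ) 0 with h | h
  · simp [h]
  · field_simp

lemma sampleCov_sum_left {ι : Type*} (s : Finset ι) (c : ι → ℝ) (f : ι → Fin N → ℝ)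
    (g : Fin N → ℝ) :
    sampleCov (fun a => ∑ i ∈ s, c i * f i a) g = ∑ i ∈ s, c i * sampleCov (f i) g := by
  have h1 : ∀ a, (∑ i ∈ s, c i * f i a) * g a = ∑ i ∈ s, c i * (f i a * g a) := fun a => by
    rw [Finset.sum_mul]
    exact Finset.sum_congr rfl fun i _ => by ring
  simp only [sampleCov, sampleMean, h1]
  rw [Finset.sum_comm, Finset.sum_comm (s := Finset.univ) (t := s)]
  simp only [← Finset.mul_sum, mul_sub, Finset.sum_sub_distrib]
  congr 1
  · rw [Finset.mul_sum]
    exact Finset.sum_congr rfl fun i _ => by ring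
  · rw [Finset.mul_sum, Finset.sum_mul]
    exact Finset.sum_congr rfl fun i _ => by ring

lemma sampleCov_add_left (f f' g : Fin N → ℝ) :
    sampleCov (fun a => f a + f' a) g = sampleCov f g + sampleCov f' g := by
  simp only [sampleCov, sampleMean, add_mul, Finset.sum_add_distrib]
  ring

lemma decode_observe (q : EqParams m n) (A Astar : Matrix (Fin m) (Fin n) ℝ) (z : Draw n m)
    (i : Fin n) :
    decode q A (observe Astar z) i = feature q.α ((q.pinv A * Astar) i) (q.pinv A i) z := by
  simp only [decode, observe, feature, thresholded, Matrix.mulVec_add, Matrix.mulVec_mulVec]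
  rfl

lemma empSecond_observe (q : EqParams m n) (A Astar : Matrix (Fin m) (Fin n) ℝ)
    (z : Fin N → Draw n m) (i : Fin n) :
    empSecond q A (fun a => observe Astar (z a)) i
      = sampleMean fun a => feature q.α ((q.pinv A * Astar) i) (q.pinv A i) (z a) ^ 2 := by
  simp only [empSecond, decode_observe, sampleMean]

lemma empCross_observe (q : EqParams m n) (A Astar : Matrix (Fin m) (Fin n) ℝ)
    (z : Fin N → Draw n m) (k : Fin m) (i : Fin n) :
    empCross q A (fun a => observe Astar (z a)) k i
      = ∑ j, Astar k j * (2 * sampleCov (fun a => (z a).1 j)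
          fun a => feature q.α ((q.pinv A * Astar) i) (q.pinv A i) (z a))
        + 2 * sampleCov (fun a => (z a).2 k)
          fun a => feature q.α ((q.pinv A * Astar) i) (q.pinv A i) (z a) := by
  have h1 : empCross q A (fun a => observe Astar (z a)) k i = 2 * sampleCov
      (fun a => observe Astar (z a) k)
      fun a => feature q.α ((q.pinv A * Astar) i) (q.pinv A i) (z a) := by
    rw [← sum_sum_sub_mul_sub]
    simp only [empCross, Matrix.smul_apply, smul_eq_mul, Matrix.sum_apply, Matrix.vecMulVec_apply,
      Pi.sub_apply, decode_observe]
  have h2 : ∀ a, observe Astar (z a) k = ∑ j, Astar k j * (z a).1 j + (z a).2 k := fun a => rfl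
  simp only [h1, h2]
  rw [sampleCov_add_left, sampleCov_sum_left, mul_add, Finset.mul_sum]
  congr 1
  exact Finset.sum_congr rfl fun j _ => by ring

end

/-! ### Estimates for the decoded examples of a representative batch -/

/-- The standing assumptions, in the normalization in which the argument uses them: `μ` bounds the
means of the weights and `c` bounds their second moments from below, `p` is a bound on the row norm
of a left inverse of `A*`, `β` bounds the effect of the noise on a decoded coordinate, `ρ` that of
the noise in the current matrix, `τ` and `ω` are the accuracies of a representative batch, and `b`
is the amount by which an entry of the noise matrix may grow. All error terms are dominated by
`10⁻⁶`, relative to the scale on which they act. -/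
structure Regime {n m : ℕ} (Astar : Matrix (Fin m) (Fin n) ℝ) (E₀ : Matrix (Fin n) (Fin n) ℝ)
    (N₀ : Matrix (Fin m) (Fin n) ℝ) (P : Measure (Draw n m)) (p μ c α β ρ τ ω b : ℝ) : Prop where
  n_pos : 1 ≤ (n : ℝ)
  weights : SparseWeights P (fun i z => z.1 i) μ
  μ_nonneg : 0 ≤ μ
  c_pos : 0 < c
  le_second : ∀ i, c ≤ secondMoment P i
  noise : ∀ v : Fin m → ℝ, ∑ k, |v k| ≤ 1.1 * p → ∀ᵐ z ∂P, |∑ k, v k * z.2 k| ≤ β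
  E₀_nonneg : ∀ i j, 0 ≤ E₀ i j
  E₀_row : RowLe E₀ 0.02
  E₀_col : ColLe E₀ 0.02
  p_nonneg : 0 ≤ p
  leftInv : ∃ B : Matrix (Fin n) (Fin m) ℝ, B * Astar = 1 ∧ RowLe B p
  b_nonneg : 0 ≤ b
  α_pos : 0 < α
  μ_sq_le : μ ^ 2 ≤ 0.000001 * c
  α_mul_μ_le : α * μ ≤ 0.000001 * c
  θ_le : 3 * μ / α ≤ 0.000001
  le_ρ : 1.2 * (p * (rowNorm N₀ + n * b)) ≤ ρ
  ρ_le : ρ ≤ 0.000001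
  ρ_le_α : ρ ≤ α / 4
  ρ_mul_le : n * (3 * μ / α) * ρ ≤ 0.000001
  β_nonneg : 0 ≤ β
  β_le : β ≤ α / 4
  β_mul_le : n * (3 * μ / α) * (β * μ) ≤ 0.000001 * c
  τ_nonneg : 0 ≤ τ
  τ_le : n * τ ≤ 0.000001 * c
  ω_le : 3 * ω ≤ b * c

/-- Second moment of the scaled weight `x*_j / D_jj`. -/
noncomputable def scaledMoment {n m : ℕ} (P : Measure (Draw n m)) (D : Fin n → ℝ) (j : Fin n) : ℝ :=
  secondMoment P j / D j ^ 2

section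
variable {m n : ℕ} {Astar A : Matrix (Fin m) (Fin n) ℝ} {E₀ : Matrix (Fin n) (Fin n) ℝ}
  {N₀ : Matrix (Fin m) (Fin n) ℝ} {P : Measure (Draw n m)} {p μ c α β ρ τ ω b : ℝ}
  {S : Finset (Fin n)} {D σ : Fin n → ℝ} {E : Matrix (Fin n) (Fin n) ℝ}
  {N : Matrix (Fin m) (Fin n) ℝ} {F G : Matrix (Fin n) (Fin n) ℝ}
  {pinv : Matrix (Fin m) (Fin n) ℝ → Matrix (Fin n) (Fin m) ℝ}

/-- Scaling down the weights keeps them in `[0, 1]` and does not increase their means. -/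
lemma SparseWeights.scale {x : Fin n → Draw n m → ℝ} (h : SparseWeights P x μ)
    (hD : ∀ i, 1 ≤ D i) : SparseWeights P (fun i z => x i z / D i) μ where
  meas i := (h.meas i).div_const _
  mem_Icc := by
    filter_upwards [h.mem_Icc] with z hz i
    have := one_pos.trans_le (hD i)
    exact ⟨div_nonneg (hz i).1 this.le, (div_le_one this).2 ((hz i).2.trans (hD i))⟩
  indep := h.indep.comp (fun i t => t / D i) fun i => measurable_id.div_const _
  mean_le i := by
    rw [integral_div]
    exact (div_le_self (h.mean_nonneg i) (hD i)).trans (h.mean_le i)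

lemma integral_scaled_sq (D : Fin n → ℝ) (j : Fin n) :
    ∫ z : Draw n m, (z.1 j / D j) ^ 2 ∂P = scaledMoment P D j := by
  simp only [div_pow, integral_div, scaledMoment, secondMoment]

lemma Factored.pinv_spec (hF : Factored Astar E₀ N₀ b S A D σ E N F G)
    (hR : Regime Astar E₀ N₀ P p μ c α β ρ τ ω b) (hpinv : IsMinPinv pinv) :
    pinv A * A = 1 ∧ RowLe (pinv A) (1.1 * p) := by
  obtain ⟨B₀, hB₀, hB₀p⟩ := hR.leftInv
  have h1 := hR.le_ρ
  have h2 := hR.ρ_le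
  have h3 := hR.p_nonneg
  obtain ⟨B, hB, hBp⟩ := hF.exists_leftInverse hR.E₀_nonneg hR.E₀_row hB₀p hR.p_nonneg
    hR.b_nonneg hB₀ (by linarith)
  have hA := linearIndependent_col_of_mul_eq_one hB
  exact ⟨hpinv.left_inv A hA, fun i => (rowLe_rowNorm _ i).trans
    ((hpinv.minimal A hA B hB).trans (rowNorm_le hBp (by positivity)))⟩

lemma Factored.exists_split (hF : Factored Astar E₀ N₀ b S A D σ E N F G)
    (hR : Regime Astar E₀ N₀ P p μ c α β ρ τ ω b) (hpinv : IsMinPinv pinv) :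
    ∃ Q U W, DecodeSplit σ G (pinv A * Astar * Matrix.diagonal D) Q U W ρ :=
  hF.exists_decodeSplit hR.E₀_nonneg hR.E₀_row hR.E₀_col hR.b_nonneg (hF.pinv_spec hR hpinv).1
    hR.p_nonneg (hF.pinv_spec hR hpinv).2 hR.le_ρ (hR.ρ_le.trans (by norm_num))

variable {Q U W : Matrix (Fin n) (Fin n) ℝ}

lemma DecodeSplit.Z_diag {Z : Matrix (Fin n) (Fin n) ℝ} (hs : DecodeSplit σ G Z Q U W ρ)
    (hσ : ∀ i, 0.98 ≤ σ i) (i : Fin n) : 0 ≤ Z i i ∧ Z i i ≤ 1.1 := by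
  have h1 := abs_le.1 (hs.diag i)
  have h2 := hσ i
  constructor <;> nlinarith

lemma DecodeSplit.row_erase {Z : Matrix (Fin n) (Fin n) ℝ} (hs : DecodeSplit σ G Z Q U W ρ)
    (i : Fin n) : ∑ k ∈ Finset.univ.erase i, |Z i k| ≤ 0.033 := by
  refine le_trans (le_of_eq ?_) (hs.Z_offDiag i)
  rw [← Finset.add_sum_erase _ _ (Finset.mem_univ i)]
  simp only [offDiagPart, Matrix.of_apply, if_true, abs_zero, zero_add]
  refine Finset.sum_congr rfl fun k hk => ?_
  rw [if_neg (Finset.ne_of_mem_erase hk).symm]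

/-- A decoded coordinate in terms of the scaled weights. -/
lemma feature_eq_thresholded (hD : ∀ i, 1 ≤ D i) (B : Matrix (Fin n) (Fin m) ℝ) (i : Fin n) :
    feature α ((B * Astar) i) (B i) = thresholded α ((B * Astar * Matrix.diagonal D) i)
      (fun j z => z.1 j / D j) (fun z => ∑ k, B i k * z.2 k) := by
  ext z
  have h1 : ∑ j, (B * Astar) i j * z.1 j
      = ∑ j, (B * Astar * Matrix.diagonal D) i j * (z.1 j / D j) := by
    refine Finset.sum_congr rfl fun j _ => ?_
    have := (one_pos.trans_le (hD j)).ne'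
    rw [Matrix.mul_diagonal]
    field_simp
  simp only [feature, thresholded, h1]

lemma sum_abs_coeff_le {Z : Matrix (Fin n) (Fin n) ℝ} (hD : ∀ i, 1 ≤ D i)
    {B : Matrix (Fin n) (Fin m) ℝ} (hZ : Z = B * Astar * Matrix.diagonal D)
    (hrow : RowLe Z 1.1) (i : Fin n) : ∑ j, |(B * Astar) i j| ≤ 3 / 2 := by
  refine le_trans (Finset.sum_le_sum fun j _ => ?_) ((hrow i).trans (by norm_num))
  rw [hZ, Matrix.mul_diagonal, abs_mul]
  exact le_mul_of_one_le_right (abs_nonneg _) ((hD j).trans (le_abs_self _))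

variable [IsProbabilityMeasure P] {T : ℕ} {y : Fin T → Draw n m}

/-- The empirical covariance of the scaled weight `x*_j / D_jj` with the `i`-th decoded
coordinate, `j ≠ i`. -/
lemma Factored.sampleCov_offDiag (hF : Factored Astar E₀ N₀ b S A D σ E N F G)
    (hR : Regime Astar E₀ N₀ P p μ c α β ρ τ ω b) (hpinv : IsMinPinv pinv)
    (hs : DecodeSplit σ G (pinv A * Astar * Matrix.diagonal D) Q U W ρ)
    (hy : Representative P α (1.1 * p) τ ω y) (i j : Fin n) :
    sampleCov (fun a => (y a).1 j) (fun a => feature α ((pinv A * Astar) i) (pinv A i) (y a)) / D j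
        ≤ max (Q i j) 0 * scaledMoment P D j
          + 3 * μ / α * ((|Q i j| + |U i j|) * (scaledMoment P D j + μ ^ 2) + 2 * β * μ) + τ ∧
      -(max (Q i j) 0 * μ ^ 2
          + 3 * μ / α * ((|Q i j| + |U i j|) * (scaledMoment P D j + μ ^ 2) + 2 * β * μ) + τ)
        ≤ sampleCov (fun a => (y a).1 j)
          (fun a => feature α ((pinv A * Astar) i) (pinv A i) (y a)) / D j := by
  obtain ⟨hB, hBp⟩ := hF.pinv_spec hR hpinv
  have hw := hR.weights.scale hF.one_le_D
  have hDj := hF.one_le_D j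
  have hz : ∑ k, |(pinv A * Astar * Matrix.diagonal D) i k| ≤ 3 / 2 :=
    (hs.Z_row i).trans (by norm_num)
  have key := hw.covariance_bounds hR.μ_nonneg hR.α_pos hz
    (e := fun z : Draw n m => ∑ k, pinv A i k * z.2 k) (by fun_prop) (hR.noise _ (hBp i))
    hR.β_nonneg hR.β_le j (q := Q i j) (u := U i j) (by rw [hs.eq]; rfl)
    ((hs.U_le i j).trans hR.ρ_le_α)
  rw [← feature_eq_thresholded hF.one_le_D, integral_scaled_sq] at key
  have h1 := hy.cov _ _ (sum_abs_coeff_le hF.one_le_D rfl hs.Z_row i) (hBp i) j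
  set X := feature α ((pinv A * Astar) i) (pinv A i) with hX
  have h2 : ∫ z : Draw n m, z.1 j / D j * X z ∂P = (∫ z : Draw n m, z.1 j * X z ∂P) / D j := by
    rw [← integral_div]
    exact integral_congr_ae (Filter.Eventually.of_forall fun z => by ring)
  rw [h2, integral_div, div_mul_eq_mul_div, ← sub_div] at key
  set C := ∫ z : Draw n m, z.1 j * X z ∂P - (∫ z : Draw n m, z.1 j ∂P) * ∫ z, X z ∂P with hC
  set C' := sampleCov (fun a => (y a).1 j) fun a => X (y a) with hC'
  have h3 : |C' / D j - C / D j| ≤ τ := by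
    rw [← sub_div, abs_div, abs_of_pos (one_pos.trans_le hDj)]
    exact (div_le_self (abs_nonneg _) hDj).trans h1
  have h4 := abs_le.1 h3
  exact ⟨by linarith [key.1], by linarith [key.2]⟩

lemma Factored.sampleCov_diag (hF : Factored Astar E₀ N₀ b S A D σ E N F G)
    (hR : Regime Astar E₀ N₀ P p μ c α β ρ τ ω b) (hpinv : IsMinPinv pinv)
    (hs : DecodeSplit σ G (pinv A * Astar * Matrix.diagonal D) Q U W ρ)
    (hy : Representative P α (1.1 * p) τ ω y) (i : Fin n) :
    |sampleCov (fun a => (y a).1 i) (fun a => feature α ((pinv A * Astar) i) (pinv A i) (y a)) / D i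
        - (pinv A * Astar * Matrix.diagonal D) i i * scaledMoment P D i|
      ≤ 3 * μ ^ 2 + 2 * α * μ + τ := by
  obtain ⟨hB, hBp⟩ := hF.pinv_spec hR hpinv
  have hw := hR.weights.scale hF.one_le_D
  have hDi := hF.one_le_D i
  have hz : ∑ k, |(pinv A * Astar * Matrix.diagonal D) i k| ≤ 3 / 2 :=
    (hs.Z_row i).trans (by norm_num)
  have key := hw.abs_covariance_sub_le hR.μ_nonneg hR.α_pos hz
    (e := fun z : Draw n m => ∑ k, pinv A i k * z.2 k) (by fun_prop) (hR.noise _ (hBp i))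
    (hR.β_le.trans (by linarith [hR.α_pos])) i (hs.Z_diag hF.σ_ge i).1
  rw [← feature_eq_thresholded hF.one_le_D, integral_scaled_sq] at key
  have h1 := hy.cov _ _ (sum_abs_coeff_le hF.one_le_D rfl hs.Z_row i) (hBp i) i
  set X := feature α ((pinv A * Astar) i) (pinv A i) with hX
  have h2 : ∫ z : Draw n m, z.1 i / D i * X z ∂P = (∫ z : Draw n m, z.1 i * X z ∂P) / D i := by
    rw [← integral_div]
    exact integral_congr_ae (Filter.Eventually.of_forall fun z => by ring)
  rw [h2, integral_div, div_mul_eq_mul_div, ← sub_div] at key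
  set C := ∫ z : Draw n m, z.1 i * X z ∂P - (∫ z : Draw n m, z.1 i ∂P) * ∫ z, X z ∂P with hC
  set C' := sampleCov (fun a => (y a).1 i) fun a => X (y a) with hC'
  have h3 : |C' / D i - C / D i| ≤ τ := by
    rw [← sub_div, abs_div, abs_of_pos (one_pos.trans_le hDi)]
    exact (div_le_self (abs_nonneg _) hDi).trans h1
  have h4 := abs_le.1 h3
  have h5 := abs_le.1 key
  exact abs_le.2 ⟨by linarith, by linarith⟩

lemma Factored.empSecond_bounds (hF : Factored Astar E₀ N₀ b S A D σ E N F G)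
    (hR : Regime Astar E₀ N₀ P p μ c α β ρ τ ω b) (hpinv : IsMinPinv pinv)
    (hs : DecodeSplit σ G (pinv A * Astar * Matrix.diagonal D) Q U W ρ)
    (hy : Representative P α (1.1 * p) τ ω y) (i : Fin n) {s : ℝ}
    (hsm : ∀ j, scaledMoment P D j ≤ s) {η ε : ℝ} {t : ℕ} :
    (pinv A * Astar * Matrix.diagonal D) i i ^ 2 * scaledMoment P D i - 0.00001 * c
        ≤ empSecond ⟨pinv, α, η, t, ε⟩ A (fun a => observe Astar (y a)) i ∧
      empSecond ⟨pinv, α, η, t, ε⟩ A (fun a => observe Astar (y a)) i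
        ≤ (pinv A * Astar * Matrix.diagonal D) i i ^ 2 * scaledMoment P D i
          + 0.0011 * s + 0.00001 * c := by
  obtain ⟨hB, hBp⟩ := hF.pinv_spec hR hpinv
  have hw := hR.weights.scale hF.one_le_D
  have hz : ∑ k, |(pinv A * Astar * Matrix.diagonal D) i k| ≤ 3 / 2 :=
    (hs.Z_row i).trans (by norm_num)
  have hZ := hs.Z_diag hF.σ_ge i
  have key := hw.second_moment_bounds hR.μ_nonneg hR.α_pos hz
    (e := fun z : Draw n m => ∑ k, pinv A i k * z.2 k) (by fun_prop) (hR.noise _ (hBp i))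
    (hR.β_le.trans (by linarith [hR.α_pos])) i hZ.1 (hs.row_erase i)
    (s := s) (fun k => (integral_scaled_sq D k).trans_le (hsm k))
  rw [← feature_eq_thresholded hF.one_le_D, integral_scaled_sq] at key
  have h1 := abs_le.1 (hy.second _ _ (sum_abs_coeff_le hF.one_le_D rfl hs.Z_row i) (hBp i))
  rw [empSecond_observe]
  have hτ : τ ≤ 0.000001 * c := by
    have := mul_le_mul_of_nonneg_right hR.n_pos hR.τ_nonneg
    linarith [hR.τ_le]
  have hμ := hR.μ_sq_le
  have hαμ := hR.α_mul_μ_le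
  have hc := hR.c_pos
  have hs0 : 0 ≤ s := (div_nonneg (integral_nonneg fun z => sq_nonneg _) (sq_nonneg _)).trans
    (hsm i)
  set ζ := (pinv A * Astar * Matrix.diagonal D) i i with hζ
  have h2 : 2 * ζ * μ * (0.033 * μ + 2 * α) ≤ 0.000007 * c := by
    have : 2 * ζ * μ * (0.033 * μ + 2 * α) = ζ * (0.066 * μ ^ 2 + 4 * (α * μ)) := by ring
    rw [this]
    calc _ ≤ 1.1 * (0.066 * (0.000001 * c) + 4 * (0.000001 * c)) :=
          mul_le_mul hZ.2 (by linarith)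
            (by have := mul_nonneg hR.α_pos.le hR.μ_nonneg; positivity) (by norm_num)
      _ ≤ _ := by linarith
  have h3 : 2 * ζ * μ * (0.033 * μ) ≤ 0.000007 * c := by
    refine le_trans (mul_le_mul_of_nonneg_left ?_ ?_) h2
    · linarith [hR.α_pos]
    · have := hR.μ_nonneg
      have := hZ.1
      positivity
  simp only at h1 ⊢
  constructor
  · linarith [key.1, h1.1]
  · have : (0.033 : ℝ) ^ 2 * s ≤ 0.0011 * s := by norm_num; linarith
    linarith [key.2, h1.2]

end

/-! ### One column update and rescaling -/

/-- An off-diagonal covariance `C`, multiplied by twice the ratio `3 / (5 M)`, where `M` estimates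
the second moment of the decoded coordinate. -/
lemma ratio_mul_offDiag_bounds {M c s q w μ θ βμ τ C : ℝ} (hc : 0 < c) (hM : 0.8 * c ≤ M)
    (hs : s ≤ 1.1 * M) (hμ : μ ^ 2 ≤ 0.000001 * c) (hθ : 0 ≤ θ) (hw : 0 ≤ w)
    (hq : 0 ≤ q) (hβμ : 0 ≤ βμ) (hτ : 0 ≤ τ)
    (hu : C ≤ q * s + θ * (w * (s + μ ^ 2) + 2 * βμ) + τ)
    (hl : -(q * μ ^ 2 + θ * (w * (s + μ ^ 2) + 2 * βμ) + τ) ≤ C) :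
    6 / (5 * M) * C ≤ 1.32 * q + (1.4 * θ * w + (3 * (θ * βμ) / c + 1.5 * τ / c)) ∧
      -(0.0000015 * q + (1.4 * θ * w + (3 * (θ * βμ) / c + 1.5 * τ / c))) ≤ 6 / (5 * M) * C := by
  have hM0 : 0 < M := by linarith
  have e1 : ∀ x : ℝ, 6 / (5 * M) * C ≤ x ↔ 6 * C ≤ x * (5 * M) := fun x => by
    rw [div_mul_eq_mul_div, div_le_iff₀ (by positivity)]
  have e2 : ∀ x : ℝ, x ≤ 6 / (5 * M) * C ↔ x * (5 * M) ≤ 6 * C := fun x => by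
    rw [div_mul_eq_mul_div, le_div_iff₀ (by positivity)]
  have hμM : μ ^ 2 ≤ 0.00000125 * M := by linarith
  have h1 : q * s ≤ q * (1.1 * M) := mul_le_mul_of_nonneg_left hs hq
  have h1' : q * μ ^ 2 ≤ q * (0.00000125 * M) := mul_le_mul_of_nonneg_left hμM hq
  have hθw := mul_nonneg hθ hw
  have h2 : θ * w * (s + μ ^ 2) ≤ θ * w * (1.11 * M) :=
    mul_le_mul_of_nonneg_left (by linarith) hθw
  have h3 : θ * βμ ≤ θ * βμ / c * (1.25 * M) := by
    rw [div_mul_eq_mul_div, le_div_iff₀ hc]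
    exact mul_le_mul_of_nonneg_left (by linarith) (by positivity)
  have h4 : τ ≤ τ / c * (1.25 * M) := by
    rw [div_mul_eq_mul_div, le_div_iff₀ hc]
    exact mul_le_mul_of_nonneg_left (by linarith) hτ
  have h5 : 0 ≤ θ * w * M := by positivity
  have r1 : 3 * (θ * βμ) / c = 3 * (θ * βμ / c) := by ring
  have r2 : 1.5 * τ / c = 1.5 * (τ / c) := by ring
  rw [e1, e2, r1, r2]
  constructor <;> nlinarith

/-- The diagonal part of the update drives `σ` towards about `√1.2 ≈ 1.1`, the fixed point of
`σ ↦ σ / 4 + 0.9 / σ`. -/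
lemma diag_update_bounds {σ Z s M C c : ℝ} (hc : 0 < c) (hM : 0.8 * c ≤ M) (hσ : 0.98 ≤ σ)
    (hσ' : σ ≤ 1.25) (hZ : |Z * σ - 1| ≤ 0.002) (hs : 0.95 * M ≤ s) (hs' : s ≤ 1.05 * M)
    (hC : |C - Z * s| ≤ 0.00001 * c) :
    0.98 ≤ 1 / 4 * σ + 3 / 4 * (6 / (5 * M) * C) ∧
      1 / 4 * σ + 3 / 4 * (6 / (5 * M) * C) ≤ 1.25 := by
  have hM0 : 0 < M := by linarith
  have hσ0 : 0 < σ := by linarith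
  have h1 := abs_le.1 hZ
  have h2 := abs_le.1 hC
  have hZ0 : 0 ≤ Z := by nlinarith
  have e : 3 / 4 * (6 / (5 * M) * C) = 0.9 * (C / M) := by
    field_simp
    ring
  have hCl : 0.95 * Z - 0.0000125 ≤ C / M := by
    rw [le_div_iff₀ hM0]
    nlinarith [mul_le_mul_of_nonneg_left hs hZ0]
  have hCu : C / M ≤ 1.05 * Z + 0.0000125 := by
    rw [div_le_iff₀ hM0]
    nlinarith [mul_le_mul_of_nonneg_left hs' hZ0]
  have hZl : 0.998 / σ ≤ Z := by
    rw [div_le_iff₀ hσ0]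
    linarith
  have hZu : Z ≤ 1.002 / σ := by
    rw [le_div_iff₀ hσ0]
    linarith
  -- `σ ↦ σ / 4 + k / σ` is bounded on `[0.98, 1.25]` by tangents and chords
  have hinv : σ⁻¹ * σ = 1 := inv_mul_cancel₀ hσ0.ne'
  have hinv0 : 0 < σ⁻¹ := inv_pos.2 hσ0
  have hl : 0.8 ≤ σ⁻¹ := by nlinarith
  have hu : σ⁻¹ ≤ 1.021 := by nlinarith
  have htan : 1.6 - 0.64 * σ ≤ σ⁻¹ := by nlinarith [sq_nonneg (σ - 1.25)]
  have hchord : σ⁻¹ ≤ (0.98 + 1.25 - σ) / (0.98 * 1.25) := by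
    rw [le_div_iff₀ (by norm_num)]
    nlinarith [mul_nonneg (mul_nonneg (by linarith : 0 ≤ σ - 0.98) (by linarith : 0 ≤ 1.25 - σ))
      hinv0.le]
  rw [e]
  rw [div_eq_mul_inv] at hZl hZu hchord
  constructor <;> linarith

section
variable {m n : ℕ} {Astar A : Matrix (Fin m) (Fin n) ℝ} {E₀ : Matrix (Fin n) (Fin n) ℝ}
  {N₀ : Matrix (Fin m) (Fin n) ℝ} {P : Measure (Draw n m)} {p μ c α β ρ τ ω b : ℝ}
  {S : Finset (Fin n)} {D σ : Fin n → ℝ} {E : Matrix (Fin n) (Fin n) ℝ}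
  {N : Matrix (Fin m) (Fin n) ℝ} {F G : Matrix (Fin n) (Fin n) ℝ}
  {pinv : Matrix (Fin m) (Fin n) ℝ → Matrix (Fin n) (Fin m) ℝ}

lemma scaledMoment_nonneg (D : Fin n → ℝ) (j : Fin n) : 0 ≤ scaledMoment P D j :=
  div_nonneg (integral_nonneg fun _ => sq_nonneg _) (sq_nonneg _)

variable [IsProbabilityMeasure P] {T : ℕ} {y : Fin T → Draw n m}

/-- The off-diagonal part of an update, entry by entry. In the positive direction it is of second
order in `E`, and in the negative direction it is negligible. -/
theorem Factored.exists_update_bounds (hF : Factored Astar E₀ N₀ b S A D σ E N F G)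
    (hR : Regime Astar E₀ N₀ P p μ c α β ρ τ ω b) (hpinv : IsMinPinv pinv)
    (hy : Representative P α (1.1 * p) τ ω y) {lam : ℝ} (hlam : 0.8 * c ≤ lam)
    (hsm : ∀ j, scaledMoment P D j ≤ 1.1 * lam) :
    ∃ Lo Hi : Matrix (Fin n) (Fin n) ℝ, (∀ j i, 0 ≤ Lo j i) ∧ (∀ j i, 0 ≤ Hi j i) ∧
      RowLe Lo 0.00001 ∧ ColLe Lo 0.00001 ∧ RowLe Hi 0.0017 ∧ ColLe Hi 0.0017 ∧
      ∀ M : ℝ, lam ≤ M → ∀ i j, i ≠ j →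
        6 / (5 * M) * (sampleCov (fun a => (y a).1 j)
          (fun a => feature α ((pinv A * Astar) i) (pinv A i) (y a)) / D j) ≤ Hi j i ∧
        -Lo j i ≤ 6 / (5 * M) * (sampleCov (fun a => (y a).1 j)
          (fun a => feature α ((pinv A * Astar) i) (pinv A i) (y a)) / D j) := by
  obtain ⟨Q, U, W, hs⟩ := hF.exists_split hR hpinv
  have hc := hR.c_pos
  set θ := 3 * μ / α with hθ
  have hθ0 : 0 ≤ θ := div_nonneg (by linarith [hR.μ_nonneg]) hR.α_pos.le
  have hθ1 : θ ≤ 0.000001 := hR.θ_le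
  have hβμ0 : 0 ≤ β * μ := mul_nonneg hR.β_nonneg hR.μ_nonneg
  have hτ0 := hR.τ_nonneg
  have hρ0 : 0 ≤ ρ := by
    refine le_trans ?_ hR.le_ρ
    have h1 := rowNorm_nonneg N₀
    have h2 := hR.b_nonneg
    have h3 := hR.p_nonneg
    positivity
  set κ := 1.4 * θ * ρ + (3 * (θ * (β * μ)) / c + 1.5 * τ / c) with hκ
  have hκ0 : 0 ≤ κ := by positivity
  have hκn : n * κ ≤ 0.0000059 := by
    have h1 := hR.ρ_mul_le
    have h2 : n * (3 * (θ * (β * μ)) / c) ≤ 0.000003 := by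
      rw [← mul_div_assoc, div_le_iff₀ hc]
      linarith [hR.β_mul_le]
    have h3 : n * (1.5 * τ / c) ≤ 0.0000015 := by
      rw [← mul_div_assoc, div_le_iff₀ hc]
      linarith [hR.τ_le]
    rw [hκ]
    linarith
  set K : Matrix (Fin n) (Fin n) ℝ := Matrix.of fun _ _ => κ with hK
  have hKrow : RowLe K (n * κ) := by
    have := RowLe.of_forall_abs_le (M := K) (c := κ) fun i j => by simp [hK, abs_of_nonneg hκ0]
    simpa using this
  have hKcol : ColLe K (n * κ) := hKrow
  set Qa := (offDiagPart Q).map abs with hQa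
  have hQr : RowLe Qa 0.0323 := hs.Q_row.map_abs
  have hQc : ColLe Qa 0.0323 := RowLe.map_abs hs.Q_col
  have hQa0 : ∀ i j, 0 ≤ Qa i j := fun i j => abs_nonneg _
  set J : Matrix (Fin n) (Fin n) ℝ := (1.1 : ℝ) • G + W with hJ
  have hJ0 : ∀ i j, 0 ≤ J i j := fun i j => add_nonneg
    (mul_nonneg (by norm_num) (hF.G_nonneg i j)) (hs.W_nonneg i j)
  have hJr : RowLe J (1.1 * 0.0001 + 0.0011) := (hF.G_row.smul (by norm_num)).add hs.W_row
  have hJc : ColLe J (1.1 * 0.0001 + 0.0011) :=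
    (RowLe.smul hF.G_col (by norm_num)).add hs.W_col
  have hr : 0 ≤ 0.0000015 + 1.4 * θ := by positivity
  have hr' : 0 ≤ 1.4 * θ := by positivity
  refine ⟨((0.0000015 + 1.4 * θ) • Qa + K)ᵀ, ((1.32 : ℝ) • J + (1.4 * θ) • Qa + K)ᵀ,
    ?_, ?_, ?_, ?_, ?_, ?_, ?_⟩
  · exact fun j i => add_nonneg (mul_nonneg hr (hQa0 i j)) hκ0
  · exact fun j i => add_nonneg (add_nonneg (mul_nonneg (by norm_num) (hJ0 i j))
      (mul_nonneg hr' (hQa0 i j))) hκ0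
  · exact RowLe.mono ((RowLe.smul hQc hr).add hKcol) (by linarith)
  · exact RowLe.mono ((RowLe.smul hQr hr).add hKrow) (by linarith)
  · exact RowLe.mono (((RowLe.smul hJc (by norm_num)).add (RowLe.smul hQc hr')).add hKcol)
      (by linarith)
  · exact RowLe.mono (((RowLe.smul hJr (by norm_num)).add (RowLe.smul hQr hr')).add hKrow)
      (by linarith)
  · intro M hM i j hij
    have key := hF.sampleCov_offDiag hR hpinv hs hy i j
    have hQij : Qa i j = |Q i j| := by simp [hQa, offDiagPart, hij]
    have hpos : max (Q i j) 0 ≤ J i j := max_le (hs.Q_le i j hij) (hJ0 i j)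
    have hpos' : max (Q i j) 0 ≤ Qa i j := by
      rw [hQij]
      exact max_le (le_abs_self _) (abs_nonneg _)
    have hw : 1.4 * θ * (|Q i j| + |U i j|) ≤ 1.4 * θ * Qa i j + 1.4 * θ * ρ := by
      rw [hQij, mul_add]
      have := mul_le_mul_of_nonneg_left (hs.U_le i j) hr'
      linarith
    rw [← hθ, mul_assoc 2 β μ] at key
    have h1 := ratio_mul_offDiag_bounds hc (hlam.trans hM)
      ((hsm j).trans (by linarith)) hR.μ_sq_le hθ0
      (add_nonneg (abs_nonneg _) (abs_nonneg _)) (le_max_right _ _) hβμ0 hτ0 key.1 key.2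
    simp only [Matrix.transpose_apply, Matrix.add_apply, Matrix.smul_apply, smul_eq_mul, hK,
      Matrix.of_apply]
    constructor
    · linarith [h1.1]
    · linarith [h1.2]

/-- Entrywise form of the factorization. -/
lemma Factored.apply (hF : Factored Astar E₀ N₀ b S A D σ E N F G) (k : Fin m) (i : Fin n) :
    A k i = ∑ j, Astar k j * (D j * (Matrix.diagonal σ + E) j i) + N k i := by
  conv_lhs => rw [hF.eq]
  rw [Matrix.add_apply, Matrix.mul_assoc, Matrix.mul_apply]
  simp only [Matrix.diagonal_mul]

/-- A column update followed by a rescaling preserves the factored form. In the columns of `S` the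
update shrinks `E` and `N` by the factor `1 / 4`, which makes up for the rescaling of these columns
by `1 / (1 - ε)`. In the other columns the entries of `E` can only get smaller, because `D`
grows. -/
theorem Factored.rescale (hF : Factored Astar E₀ N₀ b S A D σ E N F G)
    (hR : Regime Astar E₀ N₀ P p μ c α β ρ τ ω b) (hpinv : IsMinPinv pinv)
    {Y : ℕ → Fin T → Draw n m} (hy : Representative P α (1.1 * p) τ ω (Y 0)) {lam : ℝ}
    (hlam : 0.8 * c ≤ lam) (hsm : ∀ j, scaledMoment P D j ≤ 1.1 * lam) {est : Fin n → ℝ}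
    (hest : ∀ i ∈ S, lam ≤ est i ∧ 0.95 * est i ≤ scaledMoment P D i ∧
      scaledMoment P D i ≤ 1.05 * est i) {ε : ℝ} (hε : 0 < ε) (hε' : ε < 1 / 100) :
    ∃ σ' E' N' F' G', Factored Astar E₀ N₀ b S
      (rescale ⟨pinv, α, 3 / 4, 1, ε⟩ (fun j => 3 / (5 * est j)) S
        (fun t a => observe Astar (Y t a)) A)
      (fun j => if j ∈ S then D j / (1 - ε) else D j) σ' E' N' F' G' := by
  obtain ⟨Q, U, W, hs⟩ := hF.exists_split hR hpinv
  obtain ⟨Lo, Hi, hLo0, hHi0, hLor, hLoc, hHir, hHic, hLH⟩ :=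
    hF.exists_update_bounds hR hpinv hy hlam hsm
  have hBp := (hF.pinv_spec hR hpinv).2
  have hc := hR.c_pos
  have hb := hR.b_nonneg
  set X : Fin n → Fin T → ℝ := fun i a =>
    feature α ((pinv A * Astar) i) (pinv A i) (Y 0 a) with hX
  set f : Fin n → Fin n → ℝ := fun j i =>
    6 / (5 * est i) * (sampleCov (fun a => (Y 0 a).1 j) (X i) / D j) with hf
  set v : Fin m → Fin n → ℝ := fun k i =>
    6 / (5 * est i) * sampleCov (fun a => (Y 0 a).2 k) (X i) with hv
  set M : Matrix (Fin n) (Fin n) ℝ := Matrix.diagonal σ + E with hM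
  set g : ℝ := 1 / (1 - ε) with hg
  have h1ε : 0 < 1 - ε := by linarith
  have hg1 : 1 ≤ g := by rw [hg, le_div_iff₀ h1ε]; linarith
  have hg2 : g ≤ 1.02 := by rw [hg, div_le_iff₀ h1ε]; linarith
  set w : Fin n → ℝ := fun j => if j ∈ S then g else 1 with hw
  have hw1 : ∀ j, 1 ≤ w j := fun j => by
    simp only [hw]; split_ifs <;> linarith
  have hw2 : ∀ i j, w i / w j ≤ g := fun i j => by
    refine (div_le_self (by linarith [hw1 i]) (hw1 j)).trans ?_
    simp only [hw]; split_ifs <;> linarith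
  have hw0 : ∀ i j, 0 ≤ w i / w j := fun i j =>
    div_nonneg (by linarith [hw1 i]) (by linarith [hw1 j])
  have hDpos : ∀ j, 0 < D j := fun j => one_pos.trans_le (hF.one_le_D j)
  have hD' : (fun j => if j ∈ S then D j / (1 - ε) else D j) = fun j => D j * w j := by
    ext j
    simp only [hw, hg]
    split_ifs <;> ring
  rw [hD']
  set base : Fin n → Fin n → ℝ := fun j i =>
    if i ∈ S then 1 / 4 * E j i + 3 / 4 * f j i else E j i with hbase
  set σ' : Fin n → ℝ := fun i => if i ∈ S then 1 / 4 * σ i + 3 / 4 * f i i else σ i with hσ'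
  set E' : Matrix (Fin n) (Fin n) ℝ := Matrix.of fun j i =>
    if j = i then 0 else base j i * (w i / w j) with hE'
  set N' : Matrix (Fin m) (Fin n) ℝ := Matrix.of fun k i =>
    if i ∈ S then g * (1 / 4 * N k i + 3 / 4 * v k i) else N k i with hN'
  set F' : Matrix (Fin n) (Fin n) ℝ := Matrix.of fun j i =>
    if i ∈ S then g * (1 / 4 * F j i + 3 / 4 * Hi j i) else 0 with hF'
  set G' : Matrix (Fin n) (Fin n) ℝ := Matrix.of fun j i =>
    if i ∈ S then g * (1 / 4 * G j i + 3 / 4 * Lo j i) else 0 with hG'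
  have hF'le : ∀ j i, |F' j i| ≤ |(g • ((1 / 4 : ℝ) • F + (3 / 4 : ℝ) • Hi)) j i| := fun j i => by
    simp only [hF', Matrix.of_apply, Matrix.smul_apply, Matrix.add_apply, smul_eq_mul]
    split_ifs
    · exact le_rfl
    · rw [abs_zero]; positivity
  have hG'le : ∀ j i, |G' j i| ≤ |(g • ((1 / 4 : ℝ) • G + (3 / 4 : ℝ) • Lo)) j i| := fun j i => by
    simp only [hG', Matrix.of_apply, Matrix.smul_apply, Matrix.add_apply, smul_eq_mul]
    split_ifs
    · exact le_rfl
    · rw [abs_zero]; positivity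
  have hfS : ∀ j i, i ∈ S → i ≠ j → f j i ≤ Hi j i ∧ -Lo j i ≤ f j i := fun j i hi hij =>
    hLH (est i) (hest i hi).1 i j hij
  have hσS : ∀ i ∈ S, 0.98 ≤ σ' i ∧ σ' i ≤ 1.25 := fun i hi => by
    obtain ⟨e1, e2, e3⟩ := hest i hi
    have hμ := hR.μ_sq_le
    have hα := hR.α_mul_μ_le
    have hτ : τ ≤ 0.000001 * c := by
      have := mul_le_mul_of_nonneg_right hR.n_pos hR.τ_nonneg
      linarith [hR.τ_le]
    simp only [hσ', if_pos hi]
    exact diag_update_bounds hc (hlam.trans e1) (hF.σ_ge i) (hF.σ_le i) (hs.diag i) e2 e3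
      ((hF.sampleCov_diag hR hpinv hs hy i).trans (by linarith))
  refine ⟨σ', E', N', F', G', ?_, ?_, ?_, ?_, ?_, ?_, ?_, ?_, ?_, ?_, ?_, ?_, ?_, ?_, ?_, ?_, ?_,
    ?_⟩
  · ext k i
    -- in the rescaled coordinates the entry `(j, i)` of `Σ + E` is multiplied by `w i / w j`
    have hM' : ∀ j, D j * w j * (Matrix.diagonal σ' + E') j i
        = w i * (if i ∈ S then 1 / 4 * (D j * M j i) + 3 / 4 * (D j * f j i) else D j * M j i) := by
      intro j
      have hwj : w j ≠ 0 := (one_pos.trans_le (hw1 j)).ne'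
      by_cases hji : j = i
      · subst hji
        simp only [Matrix.add_apply, Matrix.diagonal_apply_eq, hE', Matrix.of_apply, if_true,
          add_zero, hM, hF.E_diag, hσ']
        split_ifs <;> ring
      · simp only [Matrix.add_apply, Matrix.diagonal_apply_ne _ hji, hE', Matrix.of_apply,
          if_neg hji, zero_add, hM, hbase]
        split_ifs <;> field_simp
    have hAki := hF.apply k i
    rw [Matrix.add_apply, Matrix.mul_assoc, Matrix.mul_apply]
    simp only [Matrix.diagonal_mul, hM']
    by_cases hi : i ∈ S
    · have hwi : w i = g := by simp [hw, hi]
      have hDf : ∀ j, D j * f j i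
          = 3 / (5 * est i) * (2 * sampleCov (fun a => (Y 0 a).1 j) (X i)) := fun j => by
        have := (hDpos j).ne'
        simp only [hf]
        field_simp
        ring
      have hvk : v k i = 3 / (5 * est i) * (2 * sampleCov (fun a => (Y 0 a).2 k) (X i)) := by
        simp only [hv]
        ring
      have hsum : ∑ j, Astar k j * (D j * f j i) = 3 / (5 * est i) *
          ∑ j, Astar k j * (2 * sampleCov (fun a => (Y 0 a).1 j) (X i)) := by
        rw [Finset.mul_sum]
        exact Finset.sum_congr rfl fun j _ => by rw [hDf]; ring
      have hcross := empCross_observe ⟨pinv, α, 3 / 4, 1, ε⟩ A Astar (Y 0) k i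
      simp only [_root_.rescale, columnUpdate, Matrix.of_apply, if_pos hi, hN', hwi, hcross]
      have hsplit : ∑ j, Astar k j * (g * (1 / 4 * (D j * M j i) + 3 / 4 * (D j * f j i)))
          = g * (1 / 4 * ∑ j, Astar k j * (D j * M j i)
            + 3 / 4 * ∑ j, Astar k j * (D j * f j i)) := by
        rw [Finset.mul_sum, Finset.mul_sum, ← Finset.sum_add_distrib, Finset.mul_sum]
        exact Finset.sum_congr rfl fun j _ => by ring
      rw [hsplit, hsum, hvk, hAki, ← hg]
      ring
    · have hwi : w i = 1 := by simp [hw, hi]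
      simp only [_root_.rescale, columnUpdate, Matrix.of_apply, if_neg hi, hN', hwi, one_mul]
      exact hAki
  · exact fun i => one_le_mul_of_one_le_of_one_le (hF.one_le_D i) (hw1 i)
  · intro i hi
    simp only [hw, if_neg hi, mul_one]
    exact hF.D_eq i hi
  · intro i
    by_cases hi : i ∈ S
    · exact (hσS i hi).1
    · simp only [hσ', if_neg hi]; exact hF.σ_ge i
  · intro i
    by_cases hi : i ∈ S
    · exact (hσS i hi).2
    · simp only [hσ', if_neg hi]; exact hF.σ_le i
  · intro i hi
    simp only [hσ', if_neg hi]; exact hF.σ_le' i hi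
  · intro i
    simp [hE']
  · intro j i
    by_cases hji : j = i
    · simp only [hE', Matrix.of_apply, if_pos hji, hG', Left.neg_nonpos_iff]
      have h1 := hF.G_nonneg j i
      have h2 := hLo0 j i
      split_ifs <;> positivity
    · simp only [hE', Matrix.of_apply, if_neg hji, hG', hbase]
      have h0 := hw0 i j
      by_cases hi : i ∈ S
      · simp only [if_pos hi]
        have h1 := hF.lower j i
        have h2 := (hfS j i hi (Ne.symm hji)).2
        have h3 : 0 ≤ 1 / 4 * G j i + 3 / 4 * Lo j i := by
          have := hF.G_nonneg j i
          have := hLo0 j i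
          positivity
        have h4 := mul_le_mul_of_nonneg_right (hw2 i j) h3
        have h5 : -(1 / 4 * G j i + 3 / 4 * Lo j i) * (w i / w j)
            ≤ (1 / 4 * E j i + 3 / 4 * f j i) * (w i / w j) :=
          mul_le_mul_of_nonneg_right (by linarith) h0
        linarith
      · simp only [if_neg hi, neg_zero]
        have h1 := hF.lower j i
        rw [hF.G_zero j i hi, neg_zero] at h1
        exact mul_nonneg h1 h0
  · intro j i
    have hE0 := hR.E₀_nonneg j i
    by_cases hji : j = i
    · simp only [hE', Matrix.of_apply, if_pos hji, hF']
      have h1 := hF.F_nonneg j i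
      have h2 := hHi0 j i
      split_ifs <;> positivity
    · simp only [hE', Matrix.of_apply, if_neg hji, hF', hbase]
      have h0 := hw0 i j
      by_cases hi : i ∈ S
      · simp only [if_pos hi]
        have h1 := hF.upper j i
        have h2 := (hfS j i hi (Ne.symm hji)).1
        have h3 : 0 ≤ 1 / 4 * (E₀ j i + F j i) + 3 / 4 * Hi j i := by
          have := hF.F_nonneg j i
          have := hHi0 j i
          positivity
        have h4 := mul_le_mul_of_nonneg_right (hw2 i j) h3
        have h5 : (1 / 4 * E j i + 3 / 4 * f j i) * (w i / w j)
            ≤ (1 / 4 * (E₀ j i + F j i) + 3 / 4 * Hi j i) * (w i / w j) :=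
          mul_le_mul_of_nonneg_right (by linarith) h0
        -- the factor `1 / 4` leaves room to absorb the rescaling `g` into `E₀`
        have h6 : g * (1 / 4 * E₀ j i) ≤ E₀ j i := by nlinarith
        linarith
      · simp only [if_neg hi, add_zero]
        have h1 := hF.lower j i
        rw [hF.G_zero j i hi, neg_zero] at h1
        have h2 := hF.upper j i
        rw [hF.F_zero j i hi, add_zero] at h2
        -- columns outside `S` are not rescaled, so `E` shrinks where `D` grows
        have h3 : w i / w j ≤ 1 := by
          simp only [hw, if_neg hi]
          exact (div_le_one (one_pos.trans_le (hw1 j))).2 (hw1 j)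
        exact (mul_le_of_le_one_right h1 h3).trans h2
  · intro j i
    have h1 := hF.F_nonneg j i
    have h2 := hHi0 j i
    simp only [hF', Matrix.of_apply]
    split_ifs <;> positivity
  · intro j i
    have h1 := hF.G_nonneg j i
    have h2 := hLo0 j i
    simp only [hG', Matrix.of_apply]
    split_ifs <;> positivity
  · intro j i hi
    simp [hF', hi]
  · intro j i hi
    simp [hG', hi]
  · exact (((hF.F_row.smul (by norm_num)).add (hHir.smul (by norm_num))).smul
      (by linarith)).of_abs_le hF'le |>.mono (by linarith)
  · exact RowLe.mono (RowLe.of_abs_le (((RowLe.smul hF.F_col (by norm_num)).add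
      (RowLe.smul hHic (by norm_num))).smul (by linarith)) fun j i => hF'le i j) (by linarith)
  · exact (((hF.G_row.smul (by norm_num)).add (hLor.smul (by norm_num))).smul
      (by linarith)).of_abs_le hG'le |>.mono (by linarith)
  · exact RowLe.mono (RowLe.of_abs_le (((RowLe.smul hF.G_col (by norm_num)).add
      (RowLe.smul hLoc (by norm_num))).smul (by linarith)) fun j i => hG'le i j) (by linarith)
  · intro k i
    have h1 := hF.N_le k i
    by_cases hi : i ∈ S
    · simp only [hN', Matrix.of_apply, if_pos hi]
      have hMpos : 0.8 * c ≤ est i := hlam.trans (hest i hi).1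
      have hest0 : 0 < est i := by linarith
      have h2 := hy.noise _ _ (sum_abs_coeff_le hF.one_le_D rfl hs.Z_row i) (hBp i) k
      -- with this, `g * (N₀ / 4 + b / 4 + 3 / 4 * (b / 2))` stays below `N₀ + b`
      have h3 : |v k i| ≤ b / 2 := by
        simp only [hv]
        rw [abs_mul, abs_of_pos (by positivity), div_mul_eq_mul_div, div_le_iff₀ (by positivity)]
        have h4 := hR.ω_le
        have h5 := mul_le_mul_of_nonneg_left hMpos hb
        linarith
      have h4 : |1 / 4 * N k i + 3 / 4 * v k i| ≤ 1 / 4 * |N k i| + 3 / 4 * |v k i| := by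
        refine (abs_add_le _ _).trans (le_of_eq ?_)
        rw [abs_mul, abs_mul]
        norm_num
      rw [abs_mul, abs_of_nonneg (by linarith : 0 ≤ g)]
      have h5 := mul_le_mul_of_nonneg_left h4 (by linarith : 0 ≤ g)
      have h6 := abs_nonneg (N₀ k i)
      have h7 := abs_nonneg (N k i)
      nlinarith
    · simp only [hN', Matrix.of_apply, if_neg hi]
      exact h1

end

/-! ### The run of the algorithm on representative batches -/

/-- The loop invariant. The scaled second moments `E[(x*_j)²] / D_jj²` never exceed the threshold by
much, and those of the columns in `S` are comparable with it. -/
structure LoopInvariant {m n : ℕ} (Astar : Matrix (Fin m) (Fin n) ℝ) (E₀ : Matrix (Fin n) (Fin n) ℝ)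
    (N₀ : Matrix (Fin m) (Fin n) ℝ) (P : Measure (Draw n m)) (c b : ℝ) (s : EqState m n) :
    Prop where
  factored : ∃ σ E N F G, Factored Astar E₀ N₀ b s.S s.A s.D σ E N F G
  lam_ge : 0.8 * c ≤ s.lam
  moment_le : ∀ j, scaledMoment P s.D j ≤ 1.1 * s.lam
  est_mem : ∀ i ∈ s.S, s.lam ≤ s.est i ∧ 0.95 * s.est i ≤ scaledMoment P s.D i ∧
    scaledMoment P s.D i ≤ 1.05 * s.est i
  inner : s.phase = Phase.inner → s.S.card < n ∧ ∀ j, j ∉ s.S →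
    scaledMoment P s.D j ≤ 1.045 * s.est j + 0.0001 * s.lam ∧
    s.est j ≤ 1.046 * scaledMoment P s.D j + 0.0014 * s.lam
  done : s.phase = Phase.done → n ≤ s.S.card

/-- `1` at the test of the inner loop and `0` elsewhere. -/
def innerIndicator : Phase → ℕ
  | Phase.inner => 1
  | _ => 0

/-- Progress after `k` steps: `r` counts the rescalings, each of which lowers the threshold by the
factor `(1 - ε)²` and consumes two batches. -/
def Progress {m n : ℕ} (ε lam₀ : ℝ) (k : ℕ) (s : EqState m n) : Prop :=
  ∃ r : ℕ, s.lam = (1 - ε) ^ (2 * r) * lam₀ ∧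
    s.used ≤ 2 * r + s.S.card + innerIndicator s.phase ∧
    (s.phase = Phase.done ∨ k ≤ 2 * r + 2 * s.S.card + innerIndicator s.phase)

section
variable {m n : ℕ} {Astar A : Matrix (Fin m) (Fin n) ℝ} {E₀ : Matrix (Fin n) (Fin n) ℝ}
  {N₀ : Matrix (Fin m) (Fin n) ℝ} {P : Measure (Draw n m)} {p μ c α β ρ τ ω b : ℝ}
  {S : Finset (Fin n)} {D σ : Fin n → ℝ} {E : Matrix (Fin n) (Fin n) ℝ}
  {N : Matrix (Fin m) (Fin n) ℝ} {F G : Matrix (Fin n) (Fin n) ℝ}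
  {pinv : Matrix (Fin m) (Fin n) ℝ → Matrix (Fin n) (Fin m) ℝ}

lemma Factored.mono (hF : Factored Astar E₀ N₀ b S A D σ E N F G) {S' : Finset (Fin n)}
    (h : S ⊆ S') : Factored Astar E₀ N₀ b S' A D σ E N F G :=
  { hF with
    D_eq := fun i hi => hF.D_eq i fun h' => hi (h h')
    σ_le' := fun i hi => hF.σ_le' i fun h' => hi (h h')
    F_zero := fun i j hj => hF.F_zero i j fun h' => hj (h h')
    G_zero := fun i j hj => hF.G_zero i j fun h' => hj (h h') }

/-- The number of rescalings is bounded in terms of the ratio of the initial threshold and the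
smallest second moment. -/
lemma two_mul_rescalings_le {ε lam₀ c : ℝ} {r : ℕ} (hε : 0 < ε) (hε1 : ε < 1 / 100) (hc : 0 < c)
    (h : 0.8 * c ≤ (1 - ε) ^ (2 * r) * lam₀) : 2 * (r : ℝ) ≤ lam₀ / (0.8 * c * ε) := by
  have h1 : 1 + ((2 * r : ℕ) : ℝ) * ε ≤ (1 + ε) ^ (2 * r) :=
    one_add_mul_le_pow (by linarith) _
  have h2 : (1 - ε) ^ (2 * r) * (1 + ε) ^ (2 * r) ≤ 1 := by
    rw [← mul_pow]
    exact pow_le_one₀ (by nlinarith) (by nlinarith)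
  have h3 : 0 < (1 - ε) ^ (2 * r) := pow_pos (by linarith) _
  have h4 : 0 ≤ lam₀ := by
    by_contra hneg
    push Not at hneg
    nlinarith [mul_neg_of_pos_of_neg h3 hneg]
  push_cast at h1
  rw [le_div_iff₀ (by positivity)]
  have h5 : (1 - ε) ^ (2 * r) * (1 + 2 * r * ε) ≤ 1 :=
    (mul_le_mul_of_nonneg_left h1 h3.le).trans h2
  have h6 := mul_le_mul_of_nonneg_right h (by positivity : 0 ≤ 1 + 2 * (r : ℝ) * ε)
  have h7 := mul_le_mul_of_nonneg_left h5 h4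
  nlinarith

lemma scaledMoment_div (D : Fin n → ℝ) (S : Finset (Fin n)) (ε : ℝ) (j : Fin n) :
    scaledMoment P (fun j => if j ∈ S then D j / (1 - ε) else D j) j
      = if j ∈ S then (1 - ε) ^ 2 * scaledMoment P D j else scaledMoment P D j := by
  simp only [scaledMoment]
  split_ifs
  · rw [div_pow, div_div_eq_mul_div]
    ring
  · rfl

lemma LoopInvariant.init (hR : Regime Astar E₀ N₀ P p μ c α β ρ τ ω b)
    {A₀ : Matrix (Fin m) (Fin n) ℝ} {σ₀ : Fin n → ℝ}
    (hA₀ : InitAssumption Astar A₀ (1 / 50) σ₀ E₀ N₀) (hσ₀ : ∀ i, σ₀ i ≤ 1 + 1 / 50) {lam₀ : ℝ}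
    (hlam : 0.8 * c ≤ lam₀) (hmom : ∀ j, secondMoment P j ≤ lam₀) :
    LoopInvariant Astar E₀ N₀ P c b (initState A₀ lam₀) where
  factored := by
    have h0 : ∀ {d : ℝ}, 0 ≤ d → RowLe (0 : Matrix (Fin n) (Fin n) ℝ) d := fun hd i => by
      simpa using hd
    refine ⟨σ₀, E₀, N₀, 0, 0, ?_⟩
    exact
      { eq := by
          have h1 : Matrix.diagonal (fun _ : Fin n => (1 : ℝ)) = 1 := Matrix.diagonal_one
          simp only [initState, h1, Matrix.mul_one]
          exact hA₀.eq
        one_le_D := fun _ => le_rfl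
        D_eq := fun _ _ => rfl
        σ_ge := fun i => by linarith [hA₀.diag_ge i]
        σ_le := fun i => by linarith [hσ₀ i]
        σ_le' := fun i _ => by linarith [hσ₀ i]
        E_diag := hA₀.offDiag
        lower := fun i j => by simpa using hR.E₀_nonneg i j
        upper := fun i j => by simp
        F_nonneg := fun i j => le_rfl
        G_nonneg := fun i j => le_rfl
        F_zero := fun _ _ _ => rfl
        G_zero := fun _ _ _ => rfl
        F_row := h0 (by norm_num)
        F_col := h0 (by norm_num)
        G_row := h0 (by norm_num)
        G_col := h0 (by norm_num)
        N_le := fun k i => by linarith [hR.b_nonneg] }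
  lam_ge := hlam
  moment_le j := by
    have h1 : scaledMoment P (initState A₀ lam₀).D j = secondMoment P j := by
      simp [scaledMoment, initState]
    rw [h1]
    have := hmom j
    simp only [initState]
    have := hR.c_pos
    linarith
  est_mem i hi := by simp [initState] at hi
  inner h := by simp [initState] at h
  done h := by simp [initState] at h

variable [IsProbabilityMeasure P] {T : ℕ}

/-- The estimate `Ê[x_j²]` of the second moment for a column that has not been updated. -/
lemma Factored.estimate_bounds (hF : Factored Astar E₀ N₀ b S A D σ E N F G)
    (hR : Regime Astar E₀ N₀ P p μ c α β ρ τ ω b) (hpinv : IsMinPinv pinv)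
    {y : Fin T → Draw n m} (hy : Representative P α (1.1 * p) τ ω y) {lam : ℝ}
    (hlam : 0.8 * c ≤ lam) (hsm : ∀ j, scaledMoment P D j ≤ 1.1 * lam) {j : Fin n} (hj : j ∉ S)
    {η ε : ℝ} {t : ℕ} :
    scaledMoment P D j ≤ 1.045 * empSecond ⟨pinv, α, η, t, ε⟩ A (fun a => observe Astar (y a)) j
        + 0.0001 * lam ∧
      empSecond ⟨pinv, α, η, t, ε⟩ A (fun a => observe Astar (y a)) j
        ≤ 1.046 * scaledMoment P D j + 0.0014 * lam := by
  obtain ⟨Q, U, W, hs⟩ := hF.exists_split hR hpinv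
  have key := hF.empSecond_bounds hR hpinv hs hy j hsm (η := η) (ε := ε) (t := t)
  have h1 := abs_le.1 (hs.diag j)
  have h2 := hF.σ_ge j
  have h3 := hF.σ_le' j hj
  set ζ := (pinv A * Astar * Matrix.diagonal D) j j with hζ
  set e := empSecond ⟨pinv, α, η, t, ε⟩ A (fun a => observe Astar (y a)) j with he
  have hM := scaledMoment_nonneg (P := P) D j
  have hζ0 : 0 ≤ ζ := (hs.Z_diag hF.σ_ge j).1
  have hζl : 0.978 ≤ ζ := by nlinarith
  have hζu : ζ ≤ 1.0225 := by nlinarith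
  have h4 : 0.957 ≤ ζ ^ 2 := by nlinarith [sq_nonneg (ζ - 0.9784), (by nlinarith : 0.9784 ≤ ζ)]
  have h5 : ζ ^ 2 ≤ 1.04551 := by nlinarith
  have h6 := mul_le_mul_of_nonneg_right h4 hM
  have h7 := mul_le_mul_of_nonneg_right h5 hM
  constructor <;> linarith [key.1, key.2]

/-- One step of the program preserves the invariant and makes progress, provided that the batches
that it can reach are representative. -/
theorem LoopInvariant.step {s : EqState m n} (hs : LoopInvariant Astar E₀ N₀ P c b s)
    (hR : Regime Astar E₀ N₀ P p μ c α β ρ τ ω b) (hpinv : IsMinPinv pinv) {ε lam₀ : ℝ}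
    (hε : 0 < ε) (hε' : ε < 1 / 100) {Y : ℕ → Fin T → Draw n m}
    (hY : ∀ k : ℕ, (k : ℝ) ≤ lam₀ / (0.8 * c * ε) + n + 2 →
      Representative P α (1.1 * p) τ ω (Y k)) {k : ℕ} (hk : Progress ε lam₀ k s) :
    LoopInvariant Astar E₀ N₀ P c b
        (eqStep ⟨pinv, α, 3 / 4, 1, ε⟩ (fun k a => observe Astar (Y k a)) s) ∧
      Progress ε lam₀ (k + 1)
        (eqStep ⟨pinv, α, 3 / 4, 1, ε⟩ (fun k a => observe Astar (Y k a)) s) := by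
  obtain ⟨r, hr, hused, hkr⟩ := hk
  obtain ⟨σ, E, N, F, G, hF⟩ := hs.factored
  have hc := hR.c_pos
  have hcard : s.S.card ≤ n := by simpa using Finset.card_le_univ s.S
  have hlam := hs.lam_ge
  have hr2 := two_mul_rescalings_le hε hε' hc (hr ▸ hlam)
  have hreach : ∀ i : ℕ, i ≤ 1 → Representative P α (1.1 * p) τ ω (Y (s.used + i)) := by
    intro i hi
    apply hY
    have h1 : innerIndicator s.phase ≤ 1 := by cases s.phase <;> simp [innerIndicator]
    have h2 : s.used + i ≤ 2 * r + n + 2 := by omega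
    have h3 : ((s.used + i : ℕ) : ℝ) ≤ 2 * r + n + 2 := by exact_mod_cast h2
    linarith
  cases hph : s.phase with
  | outer =>
    simp only [hph, innerIndicator] at hused hkr
    by_cases hlt : s.S.card < n
    · simp only [eqStep, hph, if_pos hlt]
      refine ⟨⟨⟨σ, E, N, F, G, hF⟩, hlam, hs.moment_le, ?_, ?_, by simp⟩, r, hr, ?_, ?_⟩
      · intro i hi
        simp only [if_pos hi]
        exact hs.est_mem i hi
      · refine fun _ => ⟨hlt, fun j hj => ?_⟩
        simp only [if_neg hj]
        exact hF.estimate_bounds hR hpinv (hreach 0 (by simp)) hlam hs.moment_le hj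
      · simp only [innerIndicator]
        omega
      · right
        rcases hkr with h | h
        · cases h
        · simp only [innerIndicator]
          omega
    · simp only [eqStep, hph, if_neg hlt]
      exact ⟨⟨⟨σ, E, N, F, G, hF⟩, hlam, hs.moment_le, hs.est_mem, by simp,
        fun _ => not_lt.1 hlt⟩, r, hr, by simpa [innerIndicator] using hused, Or.inl rfl⟩
  | inner =>
    simp only [hph, innerIndicator] at hused hkr
    obtain ⟨hlt, hacc⟩ := hs.inner hph
    by_cases hall : ∀ j, j ∉ s.S → s.est j < s.lam
    · have hR' := hF.rescale hR hpinv (Y := fun t => Y (s.used + t)) (hreach 0 (by simp)) hlam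
        hs.moment_le hs.est_mem hε hε'
      obtain ⟨σ', E', N', F', G', hF'⟩ := hR'
      have hq : 0.98 ≤ (1 - ε) ^ 2 := by nlinarith
      have hq0 : 0 ≤ (1 - ε) ^ 2 := sq_nonneg _
      have hq1 : (1 - ε) ^ 2 ≤ 1 := pow_le_one₀ (by linarith) (by linarith)
      obtain ⟨j₀, hj₀⟩ : ∃ j, j ∉ s.S := by
        by_contra hcon
        push Not at hcon
        have : s.S = Finset.univ := Finset.eq_univ_iff_forall.2 hcon
        rw [this, Finset.card_univ, Fintype.card_fin] at hlt
        exact lt_irrefl _ hlt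
      have hlam' : 0.8 * c ≤ (1 - ε) ^ 2 * s.lam := by
        have h1 := (hacc j₀ hj₀).1
        have h2 := hall j₀ hj₀
        have h3 := hR.le_second j₀
        rw [scaledMoment, hF.D_eq j₀ hj₀, one_pow, div_one] at h1
        nlinarith
      have hmom : ∀ j, scaledMoment P (fun j => if j ∈ s.S then s.D j / (1 - ε) else s.D j) j
          ≤ 1.1 * ((1 - ε) ^ 2 * s.lam) := by
        intro j
        rw [scaledMoment_div]
        split_ifs with hj
        · have := mul_le_mul_of_nonneg_left (hs.moment_le j) hq0
          linarith
        · have h1 := (hacc j hj).1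
          have h2 := hall j hj
          nlinarith
      simp only [eqStep, hph, if_pos hall]
      refine ⟨⟨⟨σ', E', N', F', G', hF'⟩, hlam', hmom, ?_, ?_, by simp⟩, r + 1, ?_, ?_, ?_⟩
      · intro i hi
        obtain ⟨h1, h2, h3⟩ := hs.est_mem i hi
        simp only [if_pos hi, scaledMoment_div]
        exact ⟨mul_le_mul_of_nonneg_left h1 hq0, by nlinarith, by nlinarith⟩
      · refine fun _ => ⟨hlt, fun j hj => ?_⟩
        simp only [if_neg hj]
        exact hF'.estimate_bounds hR hpinv (hreach 1 le_rfl) hlam' hmom hj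
      · simp only [hr]
        ring
      · simp only [innerIndicator]
        omega
      · right
        rcases hkr with h | h
        · cases h
        · simp only [innerIndicator]
          omega
    · simp only [eqStep, hph, if_neg hall]
      push Not at hall
      obtain ⟨j₀, hj₀, hj₀'⟩ := hall
      set S' := s.S ∪ Finset.univ.filter fun j => s.lam ≤ s.est j with hS'
      have hsub : s.S ⊆ S' := Finset.subset_union_left
      have hcard' : s.S.card < S'.card := Finset.card_lt_card
        ⟨hsub, fun h => hj₀ (h (by simp [hS', hj₀']))⟩
      refine ⟨⟨⟨σ, E, N, F, G, hF.mono hsub⟩, hlam, hs.moment_le, ?_, by simp, by simp⟩,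
        r, hr, ?_, ?_⟩
      · intro i hi
        by_cases hi' : i ∈ s.S
        · exact hs.est_mem i hi'
        · have hi2 : s.lam ≤ s.est i := by simpa [hS', hi'] using hi
          obtain ⟨h1, h2⟩ := hacc i hi'
          exact ⟨hi2, by simp only; linarith, by simp only; linarith⟩
      · simp only [innerIndicator]
        omega
      · right
        rcases hkr with h | h
        · cases h
        · simp only [innerIndicator]
          omega
  | done =>
    have : eqStep ⟨pinv, α, 3 / 4, 1, ε⟩ (fun k a => observe Astar (Y k a)) s = s := by
      simp only [eqStep, hph]
    rw [this]
    exact ⟨hs, r, hr, hused, Or.inl hph⟩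

/-- On representative batches the program terminates with a good output. -/
theorem exists_goodOutput (hR : Regime Astar E₀ N₀ P p μ c α β ρ τ ω b) (hpinv : IsMinPinv pinv)
    {A₀ : Matrix (Fin m) (Fin n) ℝ} {σ₀ : Fin n → ℝ}
    (hA₀ : InitAssumption Astar A₀ (1 / 50) σ₀ E₀ N₀) (hσ₀ : ∀ i, σ₀ i ≤ 1 + 1 / 50)
    {lam₀ : ℝ} (hlam : 0.8 * c ≤ lam₀) (hmom : ∀ j, secondMoment P j ≤ lam₀) {ε : ℝ}
    (hε : 0 < ε) (hε' : ε < 1 / 100) {Y : ℕ → Fin T → Draw n m}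
    (hY : ∀ k : ℕ, (k : ℝ) ≤ lam₀ / (0.8 * c * ε) + n + 2 →
      Representative P α (1.1 * p) τ ω (Y k)) {bound : ℝ} (hbound : rowNorm N₀ + n * b ≤ bound) :
    ∃ (A : Matrix (Fin m) (Fin n) ℝ) (D : Fin n → ℝ),
      Outputs ⟨pinv, α, 3 / 4, 1, ε⟩ A₀ lam₀ (fun k a => observe Astar (Y k a)) A D ∧
      GoodOutput Astar P (3 / 2) (1 / 50) bound A D := by
  set st : ℕ → EqState m n := fun k =>
    (eqStep ⟨pinv, α, 3 / 4, 1, ε⟩ (fun k a => observe Astar (Y k a)))^[k] (initState A₀ lam₀)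
    with hst
  have hrun : ∀ k, LoopInvariant Astar E₀ N₀ P c b (st k) ∧ Progress ε lam₀ k (st k) := by
    intro k
    induction k with
    | zero =>
      exact ⟨LoopInvariant.init hR hA₀ hσ₀ hlam hmom, 0, by simp [hst, initState],
        by simp [hst, initState], Or.inr (by simp)⟩
    | succ k ih =>
      have : st (k + 1) = eqStep ⟨pinv, α, 3 / 4, 1, ε⟩ (fun k a => observe Astar (Y k a)) (st k) :=
        Function.iterate_succ_apply' _ _ _
      rw [this]
      exact ih.1.step hR hpinv hε hε' hY ih.2
  obtain ⟨K, hK⟩ := exists_nat_gt (lam₀ / (0.8 * c * ε) + 2 * n + 1)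
  obtain ⟨hinv, r, hr, -, hkr⟩ := hrun K
  have hdone : (st K).phase = Phase.done := by
    refine hkr.resolve_right fun hle => ?_
    have hr2 := two_mul_rescalings_le hε hε' hR.c_pos (hr ▸ hinv.lam_ge)
    have h1 : innerIndicator (st K).phase ≤ 1 := by cases (st K).phase <;> simp [innerIndicator]
    have h2 : (st K).S.card ≤ n := by simpa using Finset.card_le_univ (st K).S
    have h3 : K ≤ 2 * r + 2 * n + 1 := by omega
    have h4 : (K : ℝ) ≤ 2 * r + 2 * n + 1 := by exact_mod_cast h3
    linarith
  have hS : ∀ i, i ∈ (st K).S := by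
    have h1 := hinv.done hdone
    have h2 : (st K).S = Finset.univ := by
      rw [← Finset.card_eq_iff_eq_univ, Fintype.card_fin]
      exact le_antisymm (by simpa using Finset.card_le_univ (st K).S) h1
    simp [h2]
  obtain ⟨σ, E, N, F, G, hF⟩ := hinv.factored
  refine ⟨(st K).A, (st K).D, ⟨K, hdone, rfl, rfl⟩, fun i => one_pos.trans_le (hF.one_le_D i),
    ⟨σ, E, N, hF.eq, fun i => by linarith [hF.σ_ge i], hF.E_diag, ?_, ?_⟩, fun i j => ?_⟩
  · exact symNorm_le ((hF.E_row hR.E₀_nonneg hR.E₀_row).mono (by norm_num))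
      ((hF.E_col hR.E₀_nonneg hR.E₀_col).mono (by norm_num)) (by norm_num)
  · have h1 : 0 ≤ rowNorm N₀ + n * b := by
      have := rowNorm_nonneg N₀
      have := hR.b_nonneg
      positivity
    exact (rowNorm_le hF.N_row h1).trans hbound
  · have h1 := hinv.moment_le i
    obtain ⟨h2, h3, -⟩ := hinv.est_mem j (hS j)
    have h4 := hinv.lam_ge
    have h5 := hR.c_pos
    simp only [scaledMoment] at h1 h3
    linarith

end

/-! ### Uniform concentration -/

section
variable {Ω : Type*} [MeasurableSpace Ω] {P : Measure Ω} [IsProbabilityMeasure P] {N : ℕ}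

lemma measure_le_sampleMean_sub (hN : 0 < N) {f : Ω → ℝ} (hf : Measurable f) {b : ℝ} (hb0 : 0 < b)
    (hb : ∀ᵐ ω ∂P, |f ω| ≤ b) {t : ℝ} (ht : 0 ≤ t) :
    (Measure.pi fun _ : Fin N => P).real {z | t ≤ sampleMean (fun a => f (z a)) - ∫ ω, f ω ∂P}
      ≤ Real.exp (-(N * t ^ 2 / (2 * b ^ 2))) := by
  set Q := Measure.pi fun _ : Fin N => P with hQ
  have hN' : (0 : ℝ) < N := by exact_mod_cast hN
  set X : Fin N → (Fin N → Ω) → ℝ := fun a z => f (z a) - ∫ ω, f ω ∂P with hX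
  have hind : iIndepFun X Q :=
    iIndepFun_pi (X := fun _ ω => f ω - ∫ ω, f ω ∂P) fun _ => (hf.sub_const _).aemeasurable
  have hint : ∀ a : Fin N, ∫ z, f (z a) ∂Q = ∫ ω, f ω ∂P := fun a => by
    have := (measurePreserving_eval (fun _ : Fin N => P) a).map_eq
    rw [← this, integral_map (measurable_pi_apply a).aemeasurable hf.aestronglyMeasurable]
  have hsub : ∀ a ∈ Finset.univ, HasSubgaussianMGF (X a) ((‖b - -b‖₊ / 2) ^ 2) Q := fun a _ => by
    have h1 := hasSubgaussianMGF_of_mem_Icc (μ := Q) (X := fun z => f (z a)) (a := -b) (b := b)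
      (hf.comp (measurable_pi_apply a)).aemeasurable (by
        have := (Measure.quasiMeasurePreserving_eval (fun _ : Fin N => P) a).ae hb
        filter_upwards [this] with z hz using abs_le.1 hz)
    rw [hint] at h1
    exact h1
  have key := HasSubgaussianMGF.measure_sum_ge_le_of_iIndepFun hind hsub
    (by positivity : 0 ≤ N * t)
  have hset : {z : Fin N → Ω | t ≤ sampleMean (fun a => f (z a)) - ∫ ω, f ω ∂P}
      = {z | N * t ≤ ∑ a, X a z} := by
    ext z
    simp only [Set.mem_ofPred_eq, hX, Finset.sum_sub_distrib, Finset.sum_const, Finset.card_univ,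
      Fintype.card_fin, nsmul_eq_mul, sampleMean]
    rw [← mul_le_mul_iff_right₀ hN', mul_sub, mul_inv_cancel_left₀ hN'.ne']
  rw [hset]
  refine key.trans (le_of_eq ?_)
  congr 1
  have hb2 : ((‖b - -b‖₊ / 2 : NNReal) : ℝ) = b := by
    rw [NNReal.coe_div, coe_nnnorm, Real.norm_eq_abs, sub_neg_eq_add, abs_of_pos (by linarith)]
    simp
  push_cast at hb2
  simp only [Finset.sum_const, Finset.card_univ, Fintype.card_fin, nsmul_eq_mul]
  push_cast
  rw [hb2]
  field_simp

/-- Hoeffding's inequality for the empirical mean of a bounded function. -/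
lemma measure_le_abs_sampleMean_sub (hN : 0 < N) {f : Ω → ℝ} (hf : Measurable f) {b : ℝ}
    (hb0 : 0 < b) (hb : ∀ᵐ ω ∂P, |f ω| ≤ b) {t : ℝ} (ht : 0 ≤ t) :
    (Measure.pi fun _ : Fin N => P) {z | t ≤ |sampleMean (fun a => f (z a)) - ∫ ω, f ω ∂P|}
      ≤ ENNReal.ofReal (2 * Real.exp (-(N * t ^ 2 / (2 * b ^ 2)))) := by
  have h1 := measure_le_sampleMean_sub (P := P) hN hf hb0 hb ht
  have h2 := measure_le_sampleMean_sub (P := P) hN hf.neg hb0 (by simpa using hb) ht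
  rw [← ofReal_measureReal (measure_ne_top _ _)]
  refine ENNReal.ofReal_le_ofReal ?_
  have hsub : {z : Fin N → Ω | t ≤ |sampleMean (fun a => f (z a)) - ∫ ω, f ω ∂P|} ⊆
      {z | t ≤ sampleMean (fun a => f (z a)) - ∫ ω, f ω ∂P} ∪
      {z | t ≤ sampleMean (fun a => (-f) (z a)) - ∫ ω, (-f) ω ∂P} := by
    intro z hz
    have hz' : t ≤ |sampleMean (fun a => f (z a)) - ∫ ω, f ω ∂P| := hz
    rcases le_abs.1 hz' with h | h
    · exact Or.inl h
    · right
      simp only [Set.mem_ofPred_eq, Pi.neg_apply, integral_neg, sampleMean, Finset.sum_neg_distrib,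
        mul_neg] at h ⊢
      linarith
  refine (measureReal_mono hsub).trans ((measureReal_union_le _ _).trans ?_)
  linarith

/-- Truncation towards zero to the grid `h ℤ`. -/
lemma exists_grid_point {h w R : ℝ} (hh : 0 < h) {M : ℕ} (hM : R ≤ M * h) (hw : |w| ≤ R) :
    ∃ k : ℤ, k ∈ Finset.Icc (-(M : ℤ)) M ∧ |k * h| ≤ R ∧ |w - k * h| ≤ h := by
  have hwR := abs_le.1 hw
  have hmem : ∀ k : ℤ, |k * h| ≤ R → k ∈ Finset.Icc (-(M : ℤ)) M := fun k hk => by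
    have h1 := abs_le.1 (hk.trans hM)
    have h2 : (k : ℝ) ≤ M := le_of_mul_le_mul_right h1.2 hh
    have h3 : -(M : ℝ) ≤ k := le_of_mul_le_mul_right (by linarith) hh
    exact Finset.mem_Icc.2 ⟨by exact_mod_cast h3, by exact_mod_cast h2⟩
  rcases le_total 0 w with h0 | h0
  · have h1 : (⌊w / h⌋ : ℝ) * h ≤ w := (le_div_iff₀ hh).1 (Int.floor_le _)
    have h2 : w < (⌊w / h⌋ + 1) * h := (div_lt_iff₀ hh).1 (Int.lt_floor_add_one _)
    have h3 : 0 ≤ (⌊w / h⌋ : ℝ) := by exact_mod_cast Int.floor_nonneg.2 (div_nonneg h0 hh.le)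
    have h4 : |(⌊w / h⌋ : ℝ) * h| ≤ R := by rw [abs_of_nonneg (by positivity)]; linarith
    exact ⟨⌊w / h⌋, hmem _ h4, h4, abs_le.2 ⟨by linarith, by linarith⟩⟩
  · have h1 : w ≤ (⌈w / h⌉ : ℝ) * h := (div_le_iff₀ hh).1 (Int.le_ceil _)
    have h2 : (⌈w / h⌉ - 1) * h < w :=
      (lt_div_iff₀ hh).1 (by linarith [Int.ceil_lt_add_one (w / h)])
    have h3 : (⌈w / h⌉ : ℝ) ≤ 0 := by
      have : ⌈w / h⌉ ≤ 0 := Int.ceil_le.2 (by simpa using div_nonpos_of_nonpos_of_nonneg h0 hh.le)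
      exact_mod_cast this
    have h4 : |(⌈w / h⌉ : ℝ) * h| ≤ R := by
      rw [abs_of_nonpos (mul_nonpos_of_nonpos_of_nonneg h3 hh.le)]; linarith
    exact ⟨⌈w / h⌉, hmem _ h4, h4, abs_le.2 ⟨by linarith, by linarith⟩⟩

lemma abs_sampleMean_sub_le {f g : Fin N → ℝ} {d : ℝ} (hd : 0 ≤ d) (h : ∀ a, |f a - g a| ≤ d) :
    |sampleMean f - sampleMean g| ≤ d := by
  have h1 : sampleMean f - sampleMean g = (N : ℝ)⁻¹ * ∑ a, (f a - g a) := by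
    simp only [sampleMean, Finset.sum_sub_distrib]
    ring
  rw [h1, abs_mul, abs_of_nonneg (by positivity)]
  calc (N : ℝ)⁻¹ * |∑ a, (f a - g a)| ≤ (N : ℝ)⁻¹ * (N * d) := by
        refine mul_le_mul_of_nonneg_left ?_ (by positivity)
        refine (Finset.abs_sum_le_sum_abs _ _).trans ((Finset.sum_le_sum fun a _ => h a).trans ?_)
        simp
    _ ≤ d := by
        rw [← mul_assoc]
        exact mul_le_of_le_one_left hd (inv_mul_le_one)

/-- Finitely many families of bounded functions that depend on a parameter in a box in a Lipschitz
way: with high probability all empirical means are close to the expectations. The proof is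
Hoeffding's inequality on a grid and a union bound. -/
theorem measure_uniform_deviation_le {ι κ : Type*} [Fintype ι] [Fintype κ] (hN : 0 < N)
    {g : κ → (ι → ℝ) → Ω → ℝ} (hg : ∀ s w, Measurable (g s w)) {R b L h τ : ℝ} (hb0 : 0 < b)
    (hb : ∀ᵐ ω ∂P, ∀ s w, (∀ i, |w i| ≤ R) → |g s w ω| ≤ b)
    (hL : ∀ᵐ ω ∂P, ∀ s w w', (∀ i, |w i| ≤ R) → (∀ i, |w' i| ≤ R) → (∀ i, |w i - w' i| ≤ h) →
      |g s w ω - g s w' ω| ≤ L * h)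
    (hh : 0 < h) (hL0 : 0 ≤ L) (hLh : L * h ≤ τ / 4) {M : ℕ} (hM : R ≤ M * h) :
    (Measure.pi fun _ : Fin N => P) {z | ¬ ∀ s w, (∀ i, |w i| ≤ R) →
        |sampleMean (fun a => g s w (z a)) - ∫ ω, g s w ω ∂P| ≤ τ}
      ≤ ENNReal.ofReal (Fintype.card κ * ((2 * M + 1) ^ Fintype.card ι *
          (2 * Real.exp (-(N * (τ / 2) ^ 2 / (2 * b ^ 2)))))) := by
  classical
  set Q := Measure.pi fun _ : Fin N => P with hQ
  have hLh0 : 0 ≤ L * h := by positivity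
  set grid : Finset (ι → ℤ) := Fintype.piFinset fun _ : ι => Finset.Icc (-(M : ℤ)) M with hgrid
  set pt : (ι → ℤ) → ι → ℝ := fun k i => k i * h with hpt
  set good : Finset (ι → ℤ) := grid.filter fun k => ∀ i, |pt k i| ≤ R with hgood
  have hcard : (good.card : ℝ) ≤ (2 * M + 1) ^ Fintype.card ι := by
    have h1 : good.card ≤ grid.card := Finset.card_filter_le _ _
    have h2 : grid.card = (2 * M + 1) ^ Fintype.card ι := by
      rw [hgrid, Fintype.card_piFinset]
      simp only [Int.card_Icc, Finset.prod_const, Finset.card_univ]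
      congr 1
      omega
    rw [h2] at h1
    exact_mod_cast h1
  set bad : κ → (ι → ℤ) → Set (Fin N → Ω) := fun s k =>
    {z | τ / 2 ≤ |sampleMean (fun a => g s (pt k) (z a)) - ∫ ω, g s (pt k) ω ∂P|} with hbad
  set null : Set (Fin N → Ω) := {z | ¬ ∀ a, ∀ s w w', (∀ i, |w i| ≤ R) → (∀ i, |w' i| ≤ R) →
    (∀ i, |w i - w' i| ≤ h) → |g s w (z a) - g s w' (z a)| ≤ L * h} with hnull
  have hnull0 : Q null = 0 := by
    have : ∀ᵐ z ∂Q, ∀ a, ∀ s w w', (∀ i, |w i| ≤ R) → (∀ i, |w' i| ≤ R) →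
        (∀ i, |w i - w' i| ≤ h) → |g s w (z a) - g s w' (z a)| ≤ L * h :=
      ae_all_iff.2 fun a => (Measure.quasiMeasurePreserving_eval (fun _ : Fin N => P) a).ae hL
    exact this
  have hint : ∀ s w, (∀ i, |w i| ≤ R) → Integrable (g s w) P := fun s w hw =>
    integrable_of_ae_abs_le (hg s w) (C := b) (by filter_upwards [hb] with ω hω using hω s w hw)
  have hsub : {z | ¬ ∀ s w, (∀ i, |w i| ≤ R) →
        |sampleMean (fun a => g s w (z a)) - ∫ ω, g s w ω ∂P| ≤ τ}
      ⊆ null ∪ ⋃ s ∈ (Finset.univ : Finset κ), ⋃ k ∈ good, bad s k := by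
    intro z hz
    by_contra hcon
    simp only [Set.mem_union, Set.mem_iUnion, not_or, not_exists, hnull, Set.mem_ofPred_eq,
      not_not, hbad, not_le] at hcon
    obtain ⟨h1, h2⟩ := hcon
    refine hz fun s w hw => ?_
    choose k hk1 hk2 hk3 using fun i => exists_grid_point hh hM (hw i)
    have hk : k ∈ good := by
      simp only [hgood, hgrid, Finset.mem_filter, Fintype.mem_piFinset]
      exact ⟨hk1, hk2⟩
    have h3 := h2 s (Finset.mem_univ s) k hk
    have h4 : |sampleMean (fun a => g s w (z a)) - sampleMean (fun a => g s (pt k) (z a))|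
        ≤ L * h := abs_sampleMean_sub_le hLh0 fun a => h1 a s w (pt k) hw hk2 hk3
    have h5 : |∫ ω, g s w ω ∂P - ∫ ω, g s (pt k) ω ∂P| ≤ L * h := by
      rw [← integral_sub (hint s w hw) (hint s (pt k) hk2)]
      have h6 := norm_integral_le_of_norm_le_const (μ := P) (C := L * h)
        (f := fun ω => g s w ω - g s (pt k) ω) (by
          filter_upwards [hL] with ω hω using hω s w (pt k) hw hk2 hk3)
      simpa using h6
    have a1 := abs_lt.1 h3
    have a2 := abs_le.1 h4
    have a3 := abs_le.1 h5
    exact abs_le.2 ⟨by linarith, by linarith⟩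
  have hτ0 : 0 ≤ τ := by linarith
  calc Q _ ≤ Q null + Q (⋃ s ∈ (Finset.univ : Finset κ), ⋃ k ∈ good, bad s k) :=
        (measure_mono hsub).trans (measure_union_le _ _)
    _ ≤ ∑ s : κ, ∑ k ∈ good, Q (bad s k) := by
        rw [hnull0, zero_add]
        exact (measure_biUnion_finset_le _ _).trans
          (Finset.sum_le_sum fun s _ => measure_biUnion_finset_le _ _)
    _ ≤ ∑ s : κ, ∑ k ∈ good,
          ENNReal.ofReal (2 * Real.exp (-(N * (τ / 2) ^ 2 / (2 * b ^ 2)))) := by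
        refine Finset.sum_le_sum fun s _ => Finset.sum_le_sum fun k hk => ?_
        refine measure_le_abs_sampleMean_sub hN (hg s (pt k)) hb0 ?_ (by linarith)
        filter_upwards [hb] with ω hω using hω s (pt k) (Finset.mem_filter.1 hk).2
    _ ≤ _ := by
        simp only [Finset.sum_const, Finset.card_univ, nsmul_eq_mul]
        rw [← ENNReal.ofReal_natCast, ← ENNReal.ofReal_natCast,
          ← ENNReal.ofReal_mul (by positivity), ← ENNReal.ofReal_mul (by positivity)]
        refine ENNReal.ofReal_le_ofReal ?_
        gcongr

end

/-! ### Batches are representative with high probability -/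

section
variable {Ω : Type*} {ι : Type*} [Fintype ι]

/-- The thresholded linear combination `φ_α(∑ᵢ wᵢ Wᵢ)`. -/
noncomputable def relu (α : ℝ) (w W : ι → ℝ) : ℝ :=
  max (∑ i, w i * W i - α) 0

/-- The functions whose empirical means are controlled: `Wᵢ X`, `X`, `X²` and `Wᵢ`, where
`X = φ_α(w · W)`. -/
noncomputable def testFunction (α : ℝ) (W : Ω → ι → ℝ) :
    Option ι ⊕ Option ι → (ι → ℝ) → Ω → ℝ
  | Sum.inl (some i), w, ω => W ω i * relu α w (W ω)
  | Sum.inl none, w, ω => relu α w (W ω)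
  | Sum.inr none, w, ω => relu α w (W ω) ^ 2
  | Sum.inr (some i), _, ω => W ω i

lemma abs_relu_sub_relu_le {α h : ℝ} {w w' W : ι → ℝ} (hW : ∀ i, |W i| ≤ 1)
    (hw : ∀ i, |w i - w' i| ≤ h) : |relu α w W - relu α w' W| ≤ Fintype.card ι * h := by
  refine (abs_max_sub_max_le_abs _ _ _).trans ?_
  have h1 : (∑ i, w i * W i - α) - (∑ i, w' i * W i - α) = ∑ i, (w i - w' i) * W i := by
    simp only [sub_mul, Finset.sum_sub_distrib]
    ring
  rw [h1]
  refine (Finset.abs_sum_le_sum_abs _ _).trans ((Finset.sum_le_sum fun i _ => ?_).trans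
    (b := ∑ _ : ι, h) (by simp))
  rw [abs_mul]
  exact (mul_le_of_le_one_right (abs_nonneg _) (hW i)).trans (hw i)

lemma abs_relu_le {α R : ℝ} (hα : 0 ≤ α) {w W : ι → ℝ} (hW : ∀ i, |W i| ≤ 1)
    (hw : ∀ i, |w i| ≤ R) (hR : 0 ≤ R) : |relu α w W| ≤ Fintype.card ι * R := by
  have h1 : |∑ i, w i * W i| ≤ Fintype.card ι * R :=
    (Finset.abs_sum_le_sum_abs _ _).trans ((Finset.sum_le_sum fun i _ => by
      rw [abs_mul]
      exact (mul_le_of_le_one_right (abs_nonneg _) (hW i)).trans (hw i)).trans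
        (b := ∑ _ : ι, R) (by simp))
  have h2 := (abs_le.1 h1).2
  rw [relu, abs_of_nonneg (le_max_right _ _)]
  exact max_le (by linarith) (by positivity)

variable [MeasurableSpace Ω]

/-- The empirical means of all test functions with coefficients in `[-3/2, 3/2]` are within `τ` of
their expectations. -/
def Accurate {N : ℕ} (P : Measure Ω) (α τ : ℝ) (W : Ω → ι → ℝ) (z : Fin N → Ω) : Prop :=
  ∀ s w, (∀ i, |w i| ≤ 3 / 2) →
    |sampleMean (fun a => testFunction α W s w (z a)) - ∫ ω, testFunction α W s w ω ∂P| ≤ τ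

lemma union_bound_le {d M : ℕ} (hd : 1 ≤ d) {A δ : ℝ} (hδ : 0 < δ)
    (hA : 8 * (d : ℝ) + 2 * M * d + 1 / δ ≤ A) :
    2 * ((d : ℝ) + 1) * ((2 * M + 1) ^ d * (2 * Real.exp (-A))) ≤ δ := by
  have hd' : (1 : ℝ) ≤ d := by exact_mod_cast hd
  have h1 : 4 * ((d : ℝ) + 1) ≤ Real.exp (8 * d) := by
    linarith [Real.add_one_le_exp (8 * (d : ℝ))]
  have h2 : ((2 * M + 1 : ℝ)) ^ d ≤ Real.exp (2 * M * d) := by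
    rw [mul_comm (2 * (M : ℝ)) d, Real.exp_nat_mul]
    exact pow_le_pow_left₀ (by positivity) (Real.add_one_le_exp _) d
  have h3 : Real.exp (-(1 / δ)) ≤ δ := by
    rw [Real.exp_neg, inv_le_comm₀ (Real.exp_pos _) hδ, ← one_div]
    linarith [Real.add_one_le_exp (1 / δ)]
  calc 2 * ((d : ℝ) + 1) * ((2 * M + 1) ^ d * (2 * Real.exp (-A)))
      = 4 * ((d : ℝ) + 1) * (2 * M + 1) ^ d * Real.exp (-A) := by ring
    _ ≤ Real.exp (8 * d) * Real.exp (2 * M * d) *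
          Real.exp (-(8 * (d : ℝ) + 2 * M * d + 1 / δ)) := by
        gcongr
    _ = Real.exp (-(1 / δ)) := by
        rw [← Real.exp_add, ← Real.exp_add]
        congr 1
        ring
    _ ≤ δ := h3

variable {P : Measure Ω} {N : ℕ}

lemma Accurate.abs_sampleCov_sub_le {W : Ω → ι → ℝ} {α τ : ℝ} {z : Fin N → Ω}
    (hz : Accurate P α τ W z) (hτ : 0 ≤ τ) (hτ1 : τ ≤ 1) {w : ι → ℝ} (hw : ∀ i, |w i| ≤ 3 / 2)
    (i : ι) (hWi : |∫ ω, W ω i ∂P| ≤ 1) (hX : |∫ ω, relu α w (W ω) ∂P| ≤ 3 / 2) :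
    |sampleCov (fun a => W (z a) i) (fun a => relu α w (W (z a)))
      - (∫ ω, W ω i * relu α w (W ω) ∂P - (∫ ω, W ω i ∂P) * ∫ ω, relu α w (W ω) ∂P)|
      ≤ 5 * τ := by
  have h1 := hz (Sum.inl (some i)) w hw
  have h2 := hz (Sum.inl none) w hw
  have h3 := hz (Sum.inr (some i)) w hw
  simp only [testFunction] at h1 h2 h3
  simp only [sampleCov]
  set a := sampleMean fun a => W (z a) i
  set x := sampleMean fun a => relu α w (W (z a))
  set a' := ∫ ω, W ω i ∂P
  set x' := ∫ ω, relu α w (W ω) ∂P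
  have h4 : |a * x - a' * x'| ≤ 4 * τ := by
    have e : a * x - a' * x' = a * (x - x') + x' * (a - a') := by ring
    have h5 : |a| ≤ 2 := by
      have h6 := abs_le.1 h3
      have h7 := abs_le.1 hWi
      exact abs_le.2 ⟨by linarith, by linarith⟩
    rw [e]
    refine (abs_add_le _ _).trans ?_
    rw [abs_mul, abs_mul]
    have h6 := mul_le_mul h5 h2 (abs_nonneg _) (by norm_num)
    have h7 := mul_le_mul hX h3 (abs_nonneg _) (by norm_num)
    linarith
  have h5 := abs_le.1 h1
  have h6 := abs_le.1 h4
  exact abs_le.2 ⟨by linarith, by linarith⟩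

variable [IsProbabilityMeasure P]

theorem measure_not_accurate_le {W : Ω → ι → ℝ} (hW : ∀ i, Measurable fun ω => W ω i)
    (hW1 : ∀ᵐ ω ∂P, ∀ i, |W ω i| ≤ 1) {α τ δ : ℝ} (hα : 0 ≤ α) (hτ : 0 < τ) (hτ1 : τ ≤ 1)
    (hδ : 0 < δ) (hδ1 : δ ≤ 1) (hd : 1 ≤ Fintype.card ι)
    (hN : 8000 * (Fintype.card ι : ℝ) ^ 7 / (τ ^ 3 * δ) ≤ N) :
    (Measure.pi fun _ : Fin N => P) {z | ¬ Accurate P α τ W z} ≤ ENNReal.ofReal δ := by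
  set d := Fintype.card ι with hdef
  have hd' : (1 : ℝ) ≤ d := by exact_mod_cast hd
  have hNpos : 0 < N := by
    have : (0 : ℝ) < N := lt_of_lt_of_le (by positivity) hN
    exact_mod_cast this
  have hm : ∀ w, Measurable fun ω => relu α w (W ω) := fun w =>
    ((Finset.measurable_sum _ fun i _ => (hW i).const_mul _).sub_const α).max measurable_const
  have hg : ∀ s w, Measurable (testFunction α W s w) := by
    rintro ((_ | i) | (_ | i)) w
    · exact hm w
    · exact (hW i).mul (hm w)
    · exact (hm w).pow_const 2
    · exact hW i
  have hd2 : (d : ℝ) ≤ (d : ℝ) ^ 2 := by nlinarith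
  set h := τ / (16 * (d : ℝ) ^ 2) with hh
  have hh0 : 0 < h := by positivity
  set M := ⌈24 * (d : ℝ) ^ 2 / τ⌉₊ with hM
  have hM1 : 24 * (d : ℝ) ^ 2 / τ ≤ M := Nat.le_ceil _
  have hM2 : (M : ℝ) < 24 * (d : ℝ) ^ 2 / τ + 1 := Nat.ceil_lt_add_one (by positivity)
  have key := measure_uniform_deviation_le (P := P) hNpos hg (R := 3 / 2)
    (b := 4 * (d : ℝ) ^ 2) (L := 4 * (d : ℝ) ^ 2) (h := h) (τ := τ) (M := M) (by positivity) ?_ ?_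
    hh0 (by positivity) ?_ ?_
  · refine key.trans (ENNReal.ofReal_le_ofReal ?_)
    have e1 : (N : ℝ) * (τ / 2) ^ 2 / (2 * (4 * (d : ℝ) ^ 2) ^ 2)
        = N * (τ ^ 2 / (128 * (d : ℝ) ^ 4)) := by ring
    have e2 : ((Fintype.card (Option ι ⊕ Option ι) : ℕ) : ℝ) = 2 * ((d : ℝ) + 1) := by
      simp only [Fintype.card_sum, Fintype.card_option]
      push_cast
      rw [← hdef]
      ring
    rw [e1, e2]
    refine union_bound_le hd hδ ?_
    have h1 : 62.5 * (d : ℝ) ^ 3 / (τ * δ) ≤ N * (τ ^ 2 / (128 * (d : ℝ) ^ 4)) := by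
      refine le_trans (le_of_eq ?_) (mul_le_mul_of_nonneg_right hN (by positivity))
      field_simp
      norm_num
    refine le_trans ?_ h1
    rw [le_div_iff₀ (by positivity)]
    have h2 : 2 * (M : ℝ) * d ≤ 48 * (d : ℝ) ^ 3 / τ + 2 * d := by
      have h3 := mul_le_mul_of_nonneg_right hM2.le (by positivity : 0 ≤ 2 * (d : ℝ))
      calc 2 * (M : ℝ) * d = M * (2 * d) := by ring
        _ ≤ _ := h3
        _ = _ := by ring
    have h3 : (8 * (d : ℝ) + 2 * M * d + 1 / δ) * (τ * δ)
        ≤ (10 * (d : ℝ) + 48 * (d : ℝ) ^ 3 / τ + 1 / δ) * (τ * δ) :=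
      mul_le_mul_of_nonneg_right (by linarith) (by positivity)
    have h4 : (10 * (d : ℝ) + 48 * (d : ℝ) ^ 3 / τ + 1 / δ) * (τ * δ)
        = 10 * d * (τ * δ) + 48 * (d : ℝ) ^ 3 * δ + τ := by
      field_simp
    have h5 : τ * δ ≤ 1 := by nlinarith
    have h6 : (d : ℝ) ≤ (d : ℝ) ^ 3 := le_self_pow₀ hd' (by norm_num)
    have h7 : 10 * (d : ℝ) * (τ * δ) ≤ 10 * d := mul_le_of_le_one_right (by positivity) h5
    have h8 : 48 * (d : ℝ) ^ 3 * δ ≤ 48 * (d : ℝ) ^ 3 :=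
      mul_le_of_le_one_right (by positivity) hδ1
    linarith
  · filter_upwards [hW1] with ω hω s w hw
    have h1 := abs_relu_le hα hω hw (by norm_num)
    rw [← hdef] at h1
    rcases s with (_ | i) | (_ | i)
    · simp only [testFunction]
      nlinarith
    · simp only [testFunction, abs_mul]
      have := mul_le_mul (hω i) h1 (abs_nonneg _) zero_le_one
      nlinarith
    · simp only [testFunction, abs_pow]
      have := pow_le_pow_left₀ (abs_nonneg _) h1 2
      nlinarith
    · simp only [testFunction]
      have := hω i
      nlinarith
  · filter_upwards [hW1] with ω hω s w w' hw hw' hww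
    have h1 := abs_relu_sub_relu_le (α := α) hω hww
    have h2 := abs_relu_le hα hω hw (by norm_num)
    have h3 := abs_relu_le hα hω hw' (by norm_num)
    rw [← hdef] at h1 h2 h3
    have h4 : (d : ℝ) * h ≤ (d : ℝ) ^ 2 * h := mul_le_mul_of_nonneg_right hd2 hh0.le
    have h5 : 0 ≤ (d : ℝ) ^ 2 * h := by positivity
    rcases s with (_ | i) | (_ | i)
    · simp only [testFunction]
      linarith
    · simp only [testFunction]
      rw [← mul_sub, abs_mul]
      have := mul_le_mul (hω i) h1 (abs_nonneg _) zero_le_one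
      linarith
    · simp only [testFunction]
      rw [sq_sub_sq, abs_mul]
      have h6 := abs_add_le (relu α w (W ω)) (relu α w' (W ω))
      have h7 : |relu α w (W ω) + relu α w' (W ω)| ≤ 3 * d := by linarith
      have h8 := mul_le_mul h7 h1 (abs_nonneg _) (by positivity)
      have h9 : 3 * (d : ℝ) * (d * h) = 3 * ((d : ℝ) ^ 2 * h) := by ring
      linarith
    · simp only [testFunction, sub_self, abs_zero]
      linarith
  · rw [hh]
    refine le_of_eq ?_
    field_simp
    norm_num
  · refine le_trans (le_of_eq ?_) (mul_le_mul_of_nonneg_right hM1 hh0.le)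
    rw [hh]
    field_simp
    norm_num

end

section
variable {n m N : ℕ} {P : Measure (Draw n m)}

lemma AdversarialNoise.abs_sum_mul_le {Cν V : ℝ} (hν : AdversarialNoise P Cν) (hCν : 0 ≤ Cν)
    {v : Fin m → ℝ} (hv : ∑ k, |v k| ≤ V) : ∀ᵐ z ∂P, |∑ k, v k * z.2 k| ≤ V * Cν := by
  filter_upwards [hν] with y hy
  refine (Finset.abs_sum_le_sum_abs _ _).trans ?_
  calc ∑ k, |v k * y.2 k| ≤ ∑ k, |v k| * Cν := Finset.sum_le_sum fun k _ => by
        rw [abs_mul]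
        exact mul_le_mul_of_nonneg_left (hy k) (abs_nonneg _)
    _ ≤ V * Cν := by
        rw [← Finset.sum_mul]
        exact mul_le_mul_of_nonneg_right hv hCν

variable [IsProbabilityMeasure P]

/-- The draw `(x*, ν)` with the noise scaled to `[-1, 1]`. -/
noncomputable def normalized (Cν : ℝ) (z : Draw n m) : Fin n ⊕ Fin m → ℝ :=
  Sum.elim z.1 fun k => z.2 k / Cν

lemma feature_eq_relu {α Cν : ℝ} (u : Fin n → ℝ) (v : Fin m → ℝ) {z : Draw n m}
    (hz : ∀ k, |z.2 k| ≤ Cν) :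
    feature α u v z = relu α (Sum.elim u fun k => v k * Cν) (normalized Cν z) := by
  have h1 : ∀ k, v k * Cν * (z.2 k / Cν) = v k * z.2 k := fun k => by
    rcases eq_or_ne Cν 0 with h | h
    · have := hz k
      rw [h] at this
      rw [abs_nonpos_iff.1 this]
      simp
    · field_simp
  simp only [feature, thresholded, relu, normalized, Fintype.sum_sum_type, Sum.elim_inl,
    Sum.elim_inr, h1]

/-- A batch of polynomially many draws is representative with high probability. The hypothesis on
`ω₀` concerns the population covariances of the noise with the decoded coordinates. -/
theorem measure_not_representative_le {μ α V Cν τ ω₀ δ : ℝ}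
    (hw : SparseWeights P (fun i z => z.1 i) μ) (hν : AdversarialNoise P Cν) (hCν : 0 ≤ Cν)
    (hα : 0 < α) (hV : V * Cν ≤ α) (hα1 : α ≤ 1) (hn : 1 ≤ n)
    (hω₀ : ∀ u v, ∑ j, |u j| ≤ 3 / 2 → ∑ k, |v k| ≤ V → ∀ k,
      |∫ z, z.2 k * feature α u v z ∂P - (∫ z, z.2 k ∂P) * ∫ z, feature α u v z ∂P| ≤ ω₀)
    (hτ : 0 < τ) (hτ1 : τ ≤ 1) (hδ : 0 < δ) (hδ1 : δ ≤ 1)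
    (hN : 8000 * ((n : ℝ) + m) ^ 7 / (τ ^ 3 * δ) ≤ N) :
    (Measure.pi fun _ : Fin N => P)
        {z | ¬ Representative P α V (5 * τ) (ω₀ + 5 * τ * Cν) z} ≤ ENNReal.ofReal δ := by
  have hcard : (Fintype.card (Fin n ⊕ Fin m) : ℝ) = (n : ℝ) + m := by simp
  have hWm : ∀ i : Fin n ⊕ Fin m, Measurable fun z : Draw n m => normalized Cν z i := by
    rintro (i | k)
    · exact (measurable_pi_apply i).comp measurable_fst
    · exact ((measurable_pi_apply k).comp measurable_snd).div_const _
  have hW1 : ∀ᵐ z ∂P, ∀ i : Fin n ⊕ Fin m, |normalized Cν z i| ≤ 1 := by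
    filter_upwards [hν, hw.mem_Icc] with z h1 h2
    rintro (i | k)
    · exact abs_le.2 ⟨by linarith [(h2 i).1, show normalized Cν z (Sum.inl i) = z.1 i from rfl],
        (h2 i).2⟩
    · change |z.2 k / Cν| ≤ 1
      rw [abs_div, abs_of_nonneg hCν]
      exact div_le_one_of_le₀ (h1 k) hCν
  have hmain := measure_not_accurate_le (P := P) (N := N) hWm hW1 hα.le hτ hτ1 hδ hδ1
    (by simp; omega) (by rw [hcard]; exact hN)
  set Q := Measure.pi fun _ : Fin N => P with hQ
  have hnull : Q {z | ¬ ∀ a k, |(z a).2 k| ≤ Cν} = 0 := by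
    have : ∀ᵐ z ∂Q, ∀ a k, |(z a).2 k| ≤ Cν :=
      ae_all_iff.2 fun a => (Measure.quasiMeasurePreserving_eval (fun _ : Fin N => P) a).ae hν
    exact this
  have hsub : {z : Fin N → Draw n m | ¬ Representative P α V (5 * τ) (ω₀ + 5 * τ * Cν) z} ⊆
      {z | ¬ ∀ a k, |(z a).2 k| ≤ Cν} ∪ {z | ¬ Accurate P α τ (normalized Cν) z} := by
    intro z hz
    by_contra hcon
    simp only [Set.mem_union, Set.mem_ofPred_eq, not_or, not_not] at hcon
    obtain ⟨hzν, hacc⟩ := hcon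
    refine hz ?_
    have hbox : ∀ (u : Fin n → ℝ) (v : Fin m → ℝ), ∑ j, |u j| ≤ 3 / 2 → ∑ k, |v k| ≤ V →
        ∀ i, |Sum.elim u (fun k => v k * Cν) i| ≤ 3 / 2 := by
      intro u v hu hv i
      rcases i with i | k
      · exact (Finset.single_le_sum (f := fun i => |u i|) (fun _ _ => abs_nonneg _)
          (Finset.mem_univ i)).trans hu
      · simp only [Sum.elim_inr, abs_mul, abs_of_nonneg hCν]
        have h1 : |v k| ≤ V := (Finset.single_le_sum (f := fun i => |v i|)
          (fun _ _ => abs_nonneg _) (Finset.mem_univ k)).trans hv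
        have h2 := mul_le_mul_of_nonneg_right h1 hCν
        linarith
    have hfz : ∀ u v a, feature α u v (z a)
        = relu α (Sum.elim u fun k => v k * Cν) (normalized Cν (z a)) :=
      fun u v a => feature_eq_relu u v (hzν a)
    have hfae : ∀ u v, ∀ᵐ y ∂P, feature α u v y
        = relu α (Sum.elim u fun k => v k * Cν) (normalized Cν y) := fun u v => by
      filter_upwards [hν] with y hy using feature_eq_relu u v hy
    have hX : ∀ (u : Fin n → ℝ) (v : Fin m → ℝ), ∑ j, |u j| ≤ 3 / 2 → ∑ k, |v k| ≤ V →
        |∫ y, feature α u v y ∂P| ≤ 3 / 2 := by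
      intro u v hu hv
      have h1 := norm_integral_le_of_norm_le_const (μ := P) (f := feature α u v)
        (hw.thresholded_le_const (hν.abs_sum_mul_le hCν hv) hV hu)
      simpa using h1
    have hXr : ∀ (u : Fin n → ℝ) (v : Fin m → ℝ), ∫ y, feature α u v y ∂P
        = ∫ y, relu α (Sum.elim u fun k => v k * Cν) (normalized Cν y) ∂P := fun u v =>
      integral_congr_ae (hfae u v)
    have hWi : ∀ i : Fin n ⊕ Fin m, |∫ y, normalized Cν y i ∂P| ≤ 1 := fun i => by
      have h1 := norm_integral_le_of_norm_le_const (μ := P) (C := 1)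
        (f := fun y : Draw n m => normalized Cν y i) (by
          filter_upwards [hW1] with y hy using hy i)
      simpa using h1
    have hcov : ∀ (u : Fin n → ℝ) (v : Fin m → ℝ), ∑ j, |u j| ≤ 3 / 2 → ∑ k, |v k| ≤ V → ∀ i,
        |sampleCov (fun a => normalized Cν (z a) i) (fun a => feature α u v (z a))
          - (∫ y, normalized Cν y i * feature α u v y ∂P
            - (∫ y, normalized Cν y i ∂P) * ∫ y, feature α u v y ∂P)| ≤ 5 * τ := by
      intro u v hu hv i
      have h1 := hacc.abs_sampleCov_sub_le hτ.le hτ1 (hbox u v hu hv) i (hWi i)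
        (by rw [← hXr]; exact hX u v hu hv)
      have h2 : ∫ y, normalized Cν y i * feature α u v y ∂P = ∫ y, normalized Cν y i
          * relu α (Sum.elim u fun k => v k * Cν) (normalized Cν y) ∂P :=
        integral_congr_ae (by filter_upwards [hfae u v] with y hy; rw [hy])
      rw [h2, hXr]
      simp only [hfz]
      exact h1
    refine ⟨fun u v hu hv j => hcov u v hu hv (Sum.inl j), fun u v hu hv => ?_,
      fun u v hu hv k => ?_⟩
    · have h1 := hacc (Sum.inr none) _ (hbox u v hu hv)
      simp only [testFunction] at h1
      have h2 : ∫ y, feature α u v y ^ 2 ∂P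
          = ∫ y, relu α (Sum.elim u fun k => v k * Cν) (normalized Cν y) ^ 2 ∂P :=
        integral_congr_ae (by filter_upwards [hfae u v] with y hy; rw [hy])
      rw [h2]
      simp only [hfz]
      linarith
    · have h0 := hω₀ u v hu hv k
      rcases eq_or_ne Cν 0 with hC | hC
      · have h1 : ∀ a, (z a).2 k = 0 := fun a => by
          have := hzν a k
          rw [hC] at this
          exact abs_nonpos_iff.1 this
        have h2 : sampleCov (fun a => (z a).2 k) (fun a => feature α u v (z a)) = 0 := by
          simp [sampleCov, sampleMean, h1]
        rw [h2, abs_zero, hC]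
        linarith [(abs_nonneg _).trans h0]
      · have h1 := hcov u v hu hv (Sum.inr k)
        have e1 : sampleCov (fun a => normalized Cν (z a) (Sum.inr k))
            (fun a => feature α u v (z a))
            = sampleCov (fun a => (z a).2 k) (fun a => feature α u v (z a)) / Cν := by
          have : ∀ a, normalized Cν (z a) (Sum.inr k) = (z a).2 k / Cν := fun a => rfl
          simp only [this, sampleCov, sampleMean, div_mul_eq_mul_div, ← Finset.sum_div]
          ring
        have e2 : ∫ y, normalized Cν y (Sum.inr k) * feature α u v y ∂P
            = (∫ y, y.2 k * feature α u v y ∂P) / Cν := by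
          rw [← integral_div]
          exact integral_congr_ae (Filter.Eventually.of_forall fun y => by
            simp only [normalized, Sum.elim_inr]; ring)
        have e3 : ∫ y : Draw n m, normalized Cν y (Sum.inr k) ∂P = (∫ y, y.2 k ∂P) / Cν :=
          integral_div _ _
        rw [e1, e2, e3, div_mul_eq_mul_div, ← sub_div, ← sub_div, abs_div, abs_of_nonneg hCν,
          div_le_iff₀ (lt_of_le_of_ne hCν hC.symm)] at h1
        have h2 := abs_le.1 h1
        have h3 := abs_le.1 h0
        exact abs_le.2 ⟨by linarith, by linarith⟩
  calc Q _ ≤ Q {z | ¬ ∀ a k, |(z a).2 k| ≤ Cν} + Q {z | ¬ Accurate P α τ (normalized Cν) z} :=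
        (measure_mono hsub).trans (measure_union_le _ _)
    _ ≤ ENNReal.ofReal δ := by rw [hnull, zero_add]; exact hmain

end

/-! ### Covariance of the noise with the decoded coordinates -/

section
variable {n m : ℕ} {P : Measure (Draw n m)} [IsProbabilityMeasure P] {Cν V μ α : ℝ}

lemma measurable_sum_mul_noise (v : Fin m → ℝ) :
    Measurable fun z : Draw n m => ∑ k, v k * z.2 k :=
  Finset.measurable_sum _ fun k _ => ((measurable_pi_apply k).comp measurable_snd).const_mul _

lemma AdversarialNoise.abs_covariance_le (hν : AdversarialNoise P Cν) (hCν : 0 ≤ Cν)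
    (hw : SparseWeights P (fun i z => z.1 i) μ) (hμ : 0 ≤ μ) (hV : V * Cν ≤ α)
    {u : Fin n → ℝ} {v : Fin m → ℝ} (hu : ∑ j, |u j| ≤ 3 / 2) (hv : ∑ k, |v k| ≤ V) (k : Fin m) :
    |∫ z, z.2 k * feature α u v z ∂P - (∫ z, z.2 k ∂P) * ∫ z, feature α u v z ∂P|
      ≤ 3 * (Cν * μ) := by
  have he := hν.abs_sum_mul_le hCν hv
  have hm := measurable_sum_mul_noise (n := n) v
  have hX : ∫ z, feature α u v z ∂P ≤ 3 / 2 * μ := hw.integral_thresholded_le hμ hm he hV hu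
  have hX0 : 0 ≤ ∫ z, feature α u v z ∂P := integral_nonneg fun z =>
    SparseWeights.thresholded_nonneg _ _ _ _ _
  have iX : Integrable (feature α u v) P :=
    integrable_of_ae_abs_le (hw.thresholded_measurable α u hm) (hw.thresholded_le_const he hV hu)
  have h1 : |∫ z, z.2 k * feature α u v z ∂P| ≤ Cν * ∫ z, feature α u v z ∂P := by
    rw [← integral_const_mul]
    rw [← Real.norm_eq_abs]
    refine norm_integral_le_of_norm_le (iX.const_mul _) ?_
    filter_upwards [hν] with z hz
    have h0 : 0 ≤ feature α u v z := SparseWeights.thresholded_nonneg _ _ _ _ _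
    rw [Real.norm_eq_abs, abs_mul, abs_of_nonneg h0]
    exact mul_le_mul_of_nonneg_right (hz k) h0
  have h2 : |∫ z, z.2 k ∂P| ≤ Cν := by
    have h := norm_integral_le_of_norm_le_const (μ := P) (C := Cν) (f := fun z : Draw n m => z.2 k)
      (by filter_upwards [hν] with z hz using hz k)
    simpa using h
  have h3 : |(∫ z, z.2 k ∂P) * ∫ z, feature α u v z ∂P| ≤ Cν * ∫ z, feature α u v z ∂P := by
    rw [abs_mul, abs_of_nonneg hX0]
    exact mul_le_mul_of_nonneg_right h2 hX0
  have h4 := mul_le_mul_of_nonneg_left hX hCν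
  refine (abs_sub _ _).trans ?_
  linarith

/-- Unbiased noise is uncorrelated with every bounded function of the weights. -/
lemma UnbiasedNoise.integral_mul_eq_zero (hν : UnbiasedNoise P Cν) (k : Fin m) {f : Draw n m → ℝ}
    (hf : Measurable[MeasurableSpace.comap Prod.fst inferInstance] f) {C : ℝ}
    (hfC : ∀ᵐ z ∂P, |f z| ≤ C) : ∫ z, z.2 k * f z ∂P = 0 := by
  have hle : MeasurableSpace.comap (Prod.fst : Draw n m → Fin n → ℝ) inferInstance
      ≤ (inferInstance : MeasurableSpace (Draw n m)) := measurable_fst.comap_le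
  have i1 : Integrable (fun z : Draw n m => z.2 k) P :=
    integrable_of_ae_abs_le ((measurable_pi_apply k).comp measurable_snd) (C := Cν)
      (by filter_upwards [hν.1] with z hz using hz k)
  have i2 : Integrable f P := integrable_of_ae_abs_le (hf.mono hle le_rfl) hfC
  have i3 : Integrable ((fun z : Draw n m => z.2 k) * f) P :=
    i2.bdd_mul i1.aestronglyMeasurable (c := Cν) (by filter_upwards [hν.1] with z hz using hz k)
  have h1 := condExp_mul_of_stronglyMeasurable_right hf.stronglyMeasurable i3 i1
  have h2 : P[(fun z : Draw n m => z.2 k) * f | MeasurableSpace.comap Prod.fst inferInstance]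
      =ᵐ[P] 0 := by
    filter_upwards [h1, hν.2 k] with z h3 h4
    rw [h3, Pi.mul_apply, h4, Pi.zero_apply, zero_mul]
  have h3 := integral_condExp (μ := P) hle (f := (fun z : Draw n m => z.2 k) * f)
  rw [integral_congr_ae h2] at h3
  simpa using h3.symm

lemma UnbiasedNoise.abs_covariance_le (hν : UnbiasedNoise P Cν) (hCν : 0 ≤ Cν)
    (hw : SparseWeights P (fun i z => z.1 i) μ) (hμ : 0 ≤ μ) (hα : 0 < α) (hV0 : 0 ≤ V)
    (hV : V * Cν ≤ α / 4) {u : Fin n → ℝ} {v : Fin m → ℝ} (hu : ∑ j, |u j| ≤ 3 / 2)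
    (hv : ∑ k, |v k| ≤ V) (k : Fin m) :
    |∫ z, z.2 k * feature α u v z ∂P - (∫ z, z.2 k ∂P) * ∫ z, feature α u v z ∂P|
      ≤ Cν * (V * Cν * (3 * μ / α)) := by
  have h0 : ∫ z, z.2 k ∂P = 0 := by
    have h := hν.integral_mul_eq_zero k (f := fun _ => 1) (C := 1) measurable_const (by simp)
    simpa using h
  rw [h0, zero_mul, sub_zero]
  refine hw.abs_integral_noise_mul_le hμ hα hu (measurable_sum_mul_noise v)
    (hν.1.abs_sum_mul_le hCν hv) (mul_nonneg hV0 hCν) hV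
    ((measurable_pi_apply k).comp measurable_snd) hCν
    (by filter_upwards [hν.1] with z hz using hz k)
    (hν.integral_mul_eq_zero k (C := 3 / 2) ?_ ?_)
  · have h : Measurable fun x : Fin n → ℝ => max (∑ j, u j * x j + 0 - α) 0 := by fun_prop
    exact h.comp (comap_measurable Prod.fst)
  · exact hw.thresholded_le_const (β := 0) (by simp) hα.le hu

end

/-! ### The least row norm of a left inverse -/

section
variable {m n : ℕ} {Astar : Matrix (Fin m) (Fin n) ℝ}
  {pinv : Matrix (Fin m) (Fin n) ℝ → Matrix (Fin n) (Fin m) ℝ}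

lemma IsMinPinv.rowNorm_eq (h : IsMinPinv pinv) (hA : LinearIndependent ℝ Astar.col) :
    rowNorm (pinv Astar) = pinvNorm Astar := by
  have h1 : IsLeast {t | ∃ B : Matrix (Fin n) (Fin m) ℝ, B * Astar = 1 ∧ rowNorm B = t}
      (rowNorm (pinv Astar)) := by
    refine ⟨⟨pinv Astar, h.left_inv _ hA, rfl⟩, ?_⟩
    rintro _ ⟨B, hB, rfl⟩
    exact h.minimal _ hA B hB
  exact h1.csInf_eq.symm

lemma IsMinPinv.pinvNorm_pos (h : IsMinPinv pinv) (hA : LinearIndependent ℝ Astar.col)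
    (hn : 0 < n) : 0 < pinvNorm Astar := by
  rw [← h.rowNorm_eq hA]
  by_contra hcon
  have h1 : ∀ i k, pinv Astar i k = 0 := fun i k => abs_nonpos_iff.1
    ((Finset.single_le_sum (f := fun k => |pinv Astar i k|) (fun _ _ => abs_nonneg _)
      (Finset.mem_univ k)).trans ((rowLe_rowNorm _ i).trans (not_lt.1 hcon)))
  have h2 := congrFun (congrFun (h.left_inv _ hA) ⟨0, hn⟩) ⟨0, hn⟩
  simp [Matrix.mul_apply, h1] at h2

lemma AdversarialNoise.nonneg {P : Measure (Draw n m)} [IsProbabilityMeasure P] {Cν : ℝ}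
    (hν : AdversarialNoise P Cν) (hp : 0 < pinvNorm Astar) (h : IsMinPinv pinv)
    (hA : LinearIndependent ℝ Astar.col) : 0 ≤ Cν := by
  rcases Nat.eq_zero_or_pos m with rfl | hm
  · rw [← h.rowNorm_eq hA] at hp
    exact absurd (rowNorm_le (M := pinv Astar) (fun i => by simp) le_rfl) (not_le.2 hp)
  · obtain ⟨z, hz⟩ := hν.exists
    exact (abs_nonneg _).trans (hz ⟨0, hm⟩)

end

/-! ### Choice of the constants -/

section
variable {n m : ℕ} {Astar : Matrix (Fin m) (Fin n) ℝ} {E₀ : Matrix (Fin n) (Fin n) ℝ}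
  {N₀ : Matrix (Fin m) (Fin n) ℝ} {P : Measure (Draw n m)} {C₁ c₂ C₂ Cν p B ε ω₀ : ℝ}

lemma WeightAssumption.integrable [IsFiniteMeasure P] (h : WeightAssumption P C₁ c₂ C₂)
    (i : Fin n) : Integrable (fun z : Draw n m => z.1 i) P :=
  integrable_of_ae_abs_le ((measurable_pi_apply i).comp measurable_fst) (C := 1) (by
    filter_upwards [h.mem_Icc i] with z hz using abs_le.2 ⟨by linarith [hz.1], hz.2⟩)

lemma WeightAssumption.secondMoment_le [IsFiniteMeasure P] (h : WeightAssumption P C₁ c₂ C₂)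
    (i : Fin n) : secondMoment P i ≤ C₁ / n := by
  refine (integral_mono_ae ?_ (h.integrable i) ?_).trans (h.mean_le i)
  · refine integrable_of_ae_abs_le (((measurable_pi_apply i).comp measurable_fst).pow_const 2)
      (C := 1) ?_
    filter_upwards [h.mem_Icc i] with z hz
    rw [abs_of_nonneg (sq_nonneg _)]
    exact pow_le_one₀ hz.1 hz.2
  · filter_upwards [h.mem_Icc i] with z hz
    change z.1 i ^ 2 ≤ z.1 i
    rw [sq]
    exact mul_le_of_le_one_left hz.1 hz.2

lemma WeightAssumption.sparseWeights (h : WeightAssumption P C₁ c₂ C₂) :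
    SparseWeights P (fun i z => z.1 i) (C₁ / n) where
  meas i := (measurable_pi_apply i).comp measurable_fst
  mem_Icc := ae_all_iff.2 h.mem_Icc
  indep := h.indep
  mean_le := h.mean_le

lemma WeightAssumption.c₂_le [IsFiniteMeasure P] (h : WeightAssumption P C₁ c₂ C₂) (hn : 0 < n) :
    c₂ ≤ C₁ :=
  (div_le_div_iff_of_pos_right (by exact_mod_cast hn : (0 : ℝ) < n)).1
    ((h.le_second ⟨0, hn⟩).trans (h.secondMoment_le ⟨0, hn⟩))

lemma sq_div_cube_le (hC₁ : 1 ≤ C₁) (hc₂ : 0 < c₂) (hc : c₂ ≤ C₁) :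
    c₂ ^ 2 / C₁ ^ 3 ≤ c₂ / C₁ := by
  rw [div_le_div_iff₀ (by positivity) (by positivity)]
  have h1 : c₂ ^ 2 * C₁ = c₂ * C₁ * c₂ := by ring
  have h2 : c₂ * C₁ ^ 3 = c₂ * C₁ * C₁ ^ 2 := by ring
  rw [h1, h2]
  exact mul_le_mul_of_nonneg_left (hc.trans (le_self_pow₀ hC₁ two_ne_zero)) (by positivity)

/-- The accuracy to which the population expectations are estimated. -/
noncomputable def samplingAccuracy (n : ℕ) (ε : ℝ) : ℝ :=
  ε / (10 ^ 8 * n ^ 3)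

/-- The standing assumptions hold with threshold `α = 10⁻⁶ c₂ / C₁`, once the noise is small
compared to `c₂² / C₁³`. -/
lemma regime_of_bounds [IsProbabilityMeasure P] (hC₁ : 1 ≤ C₁) (hc₂ : 0 < c₂) (hn : 0 < n)
    (hw : WeightAssumption P C₁ c₂ C₂) (hE₀ : ∀ i j, 0 ≤ E₀ i j) (hE₀s : symNorm E₀ ≤ 1 / 50)
    (hsparse : C₁ ^ 3 ≤ 1 / 10 ^ 22 * c₂ ^ 2 * n)
    (hinv : ∃ B : Matrix (Fin n) (Fin m) ℝ, B * Astar = 1 ∧ RowLe B p) (hp : 0 ≤ p)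
    (hν : AdversarialNoise P Cν) (hCν : 0 ≤ Cν)
    (hpN : p * rowNorm N₀ ≤ 1 / 10 ^ 22 * (c₂ ^ 2 / C₁ ^ 3))
    (hpC : p * Cν ≤ 1 / 10 ^ 22 * (c₂ ^ 2 / C₁ ^ 3)) (hB : 0 ≤ B)
    (hpB : p * B ≤ 2 / 10 ^ 14 * (c₂ ^ 2 / C₁ ^ 3)) (hε : 0 < ε) (hε' : ε < 1 / 100)
    (hω : 3 * (ω₀ + 5 * samplingAccuracy n ε * Cν) ≤ B * (c₂ / n ^ 2)) :
    Regime Astar E₀ N₀ P p (C₁ / n) (c₂ / n) (c₂ / (10 ^ 6 * C₁)) (1.1 * p * Cν)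
      (1.2 * (p * (rowNorm N₀ + n * (B / n)))) (5 * samplingAccuracy n ε)
      (ω₀ + 5 * samplingAccuracy n ε * Cν) (B / n) := by
  have hn' : (1 : ℝ) ≤ n := by exact_mod_cast hn
  have hn0 : (0 : ℝ) < n := by linarith
  have hC0 : 0 < C₁ := by linarith
  have hc : c₂ ≤ C₁ := hw.c₂_le hn
  have hg : c₂ ^ 2 / C₁ ^ 3 ≤ c₂ / C₁ := sq_div_cube_le hC₁ hc₂ hc
  have hg1 : c₂ / C₁ ≤ 1 := (div_le_one hC0).2 hc
  -- the sparsity assumption, weakened to the form in which it is used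
  have hsq : C₁ ^ 2 ≤ 1 / 10 ^ 22 * (c₂ * n) := by
    have h1 : C₁ ^ 2 * C₁ ≤ 1 / 10 ^ 22 * (c₂ * n) * C₁ := by
      have h2 : c₂ * (c₂ * n) ≤ C₁ * (c₂ * n) := mul_le_mul_of_nonneg_right hc (by positivity)
      linarith
    exact le_of_mul_le_mul_right h1 hC0
  have hcn : 1 ≤ c₂ * n := by linarith [one_le_pow₀ hC₁ (n := 2)]
  have hθ : 3 * (C₁ / n) / (c₂ / (10 ^ 6 * C₁)) = 3 * 10 ^ 6 * C₁ ^ 2 / (c₂ * n) := by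
    field_simp
  have hnθ : n * (3 * (C₁ / n) / (c₂ / (10 ^ 6 * C₁))) = 3 * 10 ^ 6 * C₁ ^ 2 / c₂ := by
    field_simp
  have hρ : 1.2 * (p * (rowNorm N₀ + n * (B / n))) ≤ 3 / 10 ^ 14 * (c₂ ^ 2 / C₁ ^ 3) := by
    rw [mul_div_cancel₀ _ hn0.ne']
    have : 0 ≤ c₂ ^ 2 / C₁ ^ 3 := by positivity
    linarith
  have hαeq : c₂ / (10 ^ 6 * C₁) = 1 / 10 ^ 6 * (c₂ / C₁) := by field_simp
  have hβ : 1.1 * p * Cν ≤ 1.1 / 10 ^ 22 * (c₂ ^ 2 / C₁ ^ 3) := by linarith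
  have hg0 : 0 ≤ c₂ / C₁ := by positivity
  have hkey : 3 * 10 ^ 6 * C₁ ^ 2 / c₂ * (c₂ ^ 2 / C₁ ^ 3) = 3 * 10 ^ 6 * (c₂ / C₁) := by
    field_simp
  have hτ0 : 0 ≤ samplingAccuracy n ε := by unfold samplingAccuracy; positivity
  refine
    { n_pos := hn'
      weights := hw.sparseWeights
      μ_nonneg := by positivity
      c_pos := by positivity
      le_second := hw.le_second
      noise := fun v hv => hν.abs_sum_mul_le hCν hv
      E₀_nonneg := hE₀
      E₀_row := fun i => (rowLe_rowNorm _ i).trans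
        ((le_max_right _ _).trans (hE₀s.trans (by norm_num)))
      E₀_col := fun i => (colLe_colNorm _ i).trans
        ((le_max_left _ _).trans (hE₀s.trans (by norm_num)))
      p_nonneg := hp
      leftInv := hinv
      b_nonneg := by positivity
      α_pos := by positivity
      μ_sq_le := ?_
      α_mul_μ_le := le_of_eq ?_
      θ_le := ?_
      le_ρ := le_rfl
      ρ_le := by linarith
      ρ_le_α := by rw [hαeq]; linarith
      ρ_mul_le := ?_
      β_nonneg := by positivity
      β_le := by rw [hαeq]; linarith
      β_mul_le := ?_
      τ_nonneg := by linarith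
      τ_le := ?_
      ω_le := ?_ }
  · rw [div_pow, div_le_iff₀ (by positivity)]
    have : (0.000001 : ℝ) * (c₂ / n) * n ^ 2 = 0.000001 * (c₂ * n) := by field_simp
    rw [this]
    linarith
  · field_simp
    norm_num
  · rw [hθ, div_le_iff₀ (by positivity)]
    linarith
  · rw [hnθ]
    refine (mul_le_mul_of_nonneg_left hρ (by positivity)).trans ?_
    rw [mul_left_comm, hkey]
    linarith
  · rw [hnθ, ← mul_assoc]
    refine (mul_le_mul_of_nonneg_right (mul_le_mul_of_nonneg_left hβ (by positivity))
      (by positivity)).trans ?_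
    rw [mul_left_comm, hkey]
    have h1 : c₂ / C₁ * (C₁ / n) = c₂ / n := by field_simp
    have h2 : 0 ≤ c₂ / n := by positivity
    have h3 : 1.1 / 10 ^ 22 * (3 * 10 ^ 6 * (c₂ / C₁)) * (C₁ / n)
        = 1.1 / 10 ^ 22 * (3 * 10 ^ 6) * (c₂ / n) := by rw [← h1]; ring
    rw [h3]
    linarith
  · have h1 : (n : ℝ) * (5 * samplingAccuracy n ε) = 5 / 10 ^ 8 * (ε / n) * (1 / n) := by
      unfold samplingAccuracy
      field_simp
    have h2 : ε / n ≤ 1 := (div_le_one hn0).2 (by linarith)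
    have h3 : (0.000001 : ℝ) * (c₂ / n) = 0.000001 * c₂ * n * (1 / n) * (1 / n) := by field_simp
    have h4 : 5 / 10 ^ 8 * ε ≤ 0.000001 * c₂ * n := by linarith
    have h5 : 5 / 10 ^ 8 * (ε / n) * (1 / n) = 5 / 10 ^ 8 * ε * (1 / n) * (1 / n) := by ring
    rw [h1, h3, h5]
    exact mul_le_mul_of_nonneg_right (mul_le_mul_of_nonneg_right h4 (by positivity)) (by positivity)
  · have h1 : B / n * (c₂ / n) = B * (c₂ / n ^ 2) := by field_simp
    rw [h1]
    exact hω

end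

/-! ### The guarantee -/

section
variable {n m : ℕ} {Astar A₀ : Matrix (Fin m) (Fin n) ℝ} {E₀ : Matrix (Fin n) (Fin n) ℝ}
  {N₀ : Matrix (Fin m) (Fin n) ℝ} {P : Measure (Draw n m)} {C₁ c₂ C₂ Cν : ℝ} {σ₀ : Fin n → ℝ}

/-- Union bound over the first `M` batches. The set of bad batches need not be measurable. -/
lemma infinitePi_not_forall_le {Ω : Type*} [MeasurableSpace Ω] (Q : Measure Ω)
    [IsProbabilityMeasure Q] (R : Ω → Prop) (M : ℕ) {δ : ℝ}
    (hR : Q {z | ¬ R z} ≤ ENNReal.ofReal δ) :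
    Measure.infinitePi (fun _ : ℕ => Q) {ω | ¬ ∀ k < M, R (ω k)} ≤ ENNReal.ofReal (M * δ) := by
  have hsub : {ω : ℕ → Ω | ¬ ∀ k < M, R (ω k)}
      ⊆ ⋃ k ∈ Finset.range M, Function.eval k ⁻¹' {z | ¬ R z} := by
    intro ω hω
    simp only [Set.mem_ofPred_eq, not_forall] at hω
    obtain ⟨k, hk, h⟩ := hω
    exact Set.mem_biUnion (Finset.mem_coe.2 (Finset.mem_range.2 hk)) h
  calc Measure.infinitePi (fun _ : ℕ => Q) {ω | ¬ ∀ k < M, R (ω k)}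
      ≤ ∑ k ∈ Finset.range M,
          Measure.infinitePi (fun _ : ℕ => Q) (Function.eval k ⁻¹' {z | ¬ R z}) :=
        (measure_mono hsub).trans (measure_biUnion_finset_le _ _)
    _ ≤ ∑ _k ∈ Finset.range M, ENNReal.ofReal δ := Finset.sum_le_sum fun k _ =>
        ((measurePreserving_eval_infinitePi (fun _ : ℕ => Q) k).measure_preimage_le _).trans hR
    _ = ENNReal.ofReal (M * δ) := by
        rw [Finset.sum_const, Finset.card_range, nsmul_eq_mul, ENNReal.ofReal_mul (by positivity),
          ENNReal.ofReal_natCast]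

/-- The batch size that suffices, as a polynomial in `n`, `m`, `1 / ε` and `1 / δ`. -/
noncomputable def batchSize : MvPolynomial (Fin 4) ℝ :=
  MvPolynomial.C (16 * 10 ^ 27) * (MvPolynomial.X 0 + MvPolynomial.X 1) ^ 7 *
    MvPolynomial.X 0 ^ 10 * MvPolynomial.X 2 ^ 4 * MvPolynomial.X 3

lemma eval_batchSize (hn : 0 < n) {ε δ : ℝ} (hε : 0 < ε) (hδ : 0 < δ) :
    MvPolynomial.eval ![(n : ℝ), (m : ℝ), 1 / ε, 1 / δ] batchSize
      = 8000 * ((n : ℝ) + m) ^ 7 / (samplingAccuracy n ε ^ 3 * (ε * δ / (2 * n))) := by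
  have hn' : (n : ℝ) ≠ 0 := by positivity
  simp [batchSize, samplingAccuracy]
  field_simp
  norm_num

lemma pos_of_sparse {G : ℝ} (hC₁ : 1 ≤ C₁) (hsparse : C₁ ^ 3 ≤ G * c₂ ^ 2 * n) : 0 < n := by
  rcases Nat.eq_zero_or_pos n with rfl | h
  · have : 0 < C₁ ^ 3 := by positivity
    simp only [CharP.cast_eq_zero, mul_zero] at hsparse
    linarith
  · exact h

lemma le_mul_of_sparse (hC₁ : 1 ≤ C₁) (hc₂ : 0 < c₂) (hc : c₂ ≤ C₁)
    (hsparse : C₁ ^ 3 ≤ 1 / 10 ^ 22 * c₂ ^ 2 * n) : C₁ ≤ c₂ * n := by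
  have h1 : C₁ * c₂ ≤ c₂ * n * c₂ := by
    have h2 : C₁ * c₂ ≤ C₁ * C₁ := mul_le_mul_of_nonneg_left hc (by linarith)
    have h3 : C₁ * C₁ ≤ C₁ ^ 3 := by
      rw [← sq]
      exact pow_le_pow_right₀ hC₁ (by norm_num)
    have h4 : 0 ≤ c₂ ^ 2 * n := by positivity
    linarith
  exact le_of_mul_le_mul_right h1 hc₂

/-- The guarantee with threshold `α = 10⁻⁶ c₂ / C₁`, step size `3 / 4`, one iteration per column
update and initial `λ = C₁ / n`, for an abstract bound `B` on the growth of the noise. The number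
`ω₀` bounds the population covariances of the noise with the decoded coordinates; it is the only
place where adversarial and unbiased noise differ. -/
theorem equilibrationGuarantee_of_bounds [IsProbabilityMeasure P] {B : ℝ → ℝ} (hC₁ : 1 ≤ C₁)
    (hc₂ : 0 < c₂) (hA : LinearIndependent ℝ Astar.col) (hw : WeightAssumption P C₁ c₂ C₂)
    (hA₀ : InitAssumption Astar A₀ (1 / 50) σ₀ E₀ N₀) (hσ₀ : ∀ i, σ₀ i ≤ 1 + 1 / 50)
    (hE₀ : ∀ i j, 0 ≤ E₀ i j) (hsparse : C₁ ^ 3 ≤ 1 / 10 ^ 22 * c₂ ^ 2 * n)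
    (hν : AdversarialNoise P Cν)
    (hsmall : 0 < pinvNorm Astar → ∀ x ≤ max Cν (rowNorm N₀),
      pinvNorm Astar * x ≤ 1 / 10 ^ 22 * (c₂ ^ 2 / C₁ ^ 3))
    (hB : ∀ ε, 0 < pinvNorm Astar → 0 ≤ Cν → 0 < ε → ε < 1 / 100 →
      0 ≤ B ε ∧ pinvNorm Astar * B ε ≤ 2 / 10 ^ 14 * (c₂ ^ 2 / C₁ ^ 3) ∧
      ∃ ω₀, 3 * (ω₀ + 5 * samplingAccuracy n ε * Cν) ≤ B ε * (c₂ / n ^ 2) ∧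
        ∀ u v, ∑ j, |u j| ≤ 3 / 2 → ∑ k, |v k| ≤ 1.1 * pinvNorm Astar → ∀ k,
          |∫ z, z.2 k * feature (c₂ / (10 ^ 6 * C₁)) u v z ∂P
            - (∫ z, z.2 k ∂P) * ∫ z, feature (c₂ / (10 ^ 6 * C₁)) u v z ∂P| ≤ ω₀) :
    EquilibrationGuarantee (1 / 100) batchSize Astar A₀ P (3 / 2) (1 / 50)
      fun ε => 2 * max (rowNorm N₀) (B ε) := by
  have hC0 : 0 < C₁ := by linarith
  have hn : 0 < n := pos_of_sparse hC₁ hsparse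
  have hn0 : (0 : ℝ) < n := by exact_mod_cast hn
  have hn1 : (1 : ℝ) ≤ n := by exact_mod_cast hn
  have hc : c₂ ≤ C₁ := hw.c₂_le hn
  refine ⟨c₂ / (10 ^ 6 * C₁), 3 / 4, 1, C₁ / n, by positivity, by norm_num, by norm_num,
    by positivity, fun pinv hpinv ε δ N hε hε' hδ hδ' hN => ?_⟩
  have hp := hpinv.pinvNorm_pos hA hn
  have hCν := hν.nonneg hp hpinv hA
  obtain ⟨hB0, hpB, ω₀, hω, hcov⟩ := hB ε hp hCν hε hε'
  have hR := regime_of_bounds (N₀ := N₀) hC₁ hc₂ hn hw hE₀ hA₀.sym_le hsparse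
    ⟨pinv Astar, hpinv.left_inv _ hA, fun i => (rowLe_rowNorm _ i).trans (hpinv.rowNorm_eq hA).le⟩
    hp.le hν hCν (hsmall hp _ (le_max_right _ _)) (hsmall hp _ (le_max_left _ _)) hB0 hpB hε hε' hω
  have hτ0 : 0 < samplingAccuracy n ε := by unfold samplingAccuracy; positivity
  have hτ1 : samplingAccuracy n ε ≤ 1 := by
    unfold samplingAccuracy
    rw [div_le_one (by positivity)]
    have : (1 : ℝ) ≤ n ^ 3 := one_le_pow₀ hn1
    linarith
  have hα1 : c₂ / (10 ^ 6 * C₁) ≤ 1 := by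
    rw [div_le_one (by positivity)]
    linarith
  have hδ1 : ε * δ / (2 * n) ≤ 1 := by
    rw [div_le_one (by positivity)]
    nlinarith
  rw [eval_batchSize hn hε hδ] at hN
  have hbad := measure_not_representative_le hw.sparseWeights hν hCν hR.α_pos
    (hR.β_le.trans (by linarith [hR.α_pos])) hα1 hn hcov hτ0 hτ1
    (show 0 < ε * δ / (2 * n) by positivity) hδ1 hN
  -- the number of batches that the program reads is at most `M`
  set L : ℝ := C₁ / n / (0.8 * (c₂ / n) * ε) + n + 2 with hL
  set M : ℕ := ⌊L⌋₊ + 1 with hM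
  have hL0 : 0 ≤ L := by positivity
  have hCc : C₁ ≤ c₂ * n := le_mul_of_sparse hC₁ hc₂ hc hsparse
  have hMδ : M * (ε * δ / (2 * n)) ≤ δ := by
    have h1 : C₁ / n / (0.8 * (c₂ / n) * ε) ≤ 1.25 * n / ε := by
      have h2 : C₁ / n / (0.8 * (c₂ / n) * ε) = C₁ / (0.8 * c₂ * ε) := by field_simp
      rw [h2, div_le_div_iff₀ (by positivity) hε]
      nlinarith
    have h2 : (M : ℝ) ≤ L + 1 := by
      rw [hM]
      push_cast
      linarith [Nat.floor_le hL0]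
    have h3 : (M : ℝ) * ε ≤ 2 * n := by
      have h4 : 1.25 * n / ε * ε = 1.25 * n := div_mul_cancel₀ _ hε.ne'
      have h5 := mul_le_mul_of_nonneg_right (h2.trans (by linarith :
        L + 1 ≤ 1.25 * n / ε + n + 3)) hε.le
      nlinarith
    calc M * (ε * δ / (2 * n)) = M * ε * (δ / (2 * n)) := by ring
      _ ≤ 2 * n * (δ / (2 * n)) := mul_le_mul_of_nonneg_right h3 (by positivity)
      _ = δ := by field_simp
  refine le_trans (measure_mono ?_) ((infinitePi_not_forall_le _ _ M hbad).trans
    (ENNReal.ofReal_le_ofReal hMδ))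
  intro ω hω hY
  refine hω ?_
  refine exists_goodOutput hR hpinv hA₀ hσ₀ ?_ hw.secondMoment_le hε hε' (fun k hk => hY k ?_) ?_
  · rw [← mul_div_assoc]
    gcongr
    linarith
  · exact Nat.lt_succ_of_le (Nat.le_floor hk)
  · rw [mul_div_cancel₀ _ hn0.ne']
    linarith [le_max_left (rowNorm N₀) (B ε), le_max_right (rowNorm N₀) (B ε)]

end

theorem mainTheorem3 :
    ∃ G : ℝ, 0 < G ∧ ∃ K : ℝ, 0 < K ∧ ∃ ε₀ : ℝ, 0 < ε₀ ∧ ε₀ ≤ 1 ∧ ∃ q : MvPolynomial (Fin 4) ℝ,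
      ∀ (n m : ℕ) (Astar A0 : Matrix (Fin m) (Fin n) ℝ)
        (P : Measure (Draw n m)) [IsProbabilityMeasure P] (C₁ c₂ C₂ Cν : ℝ)
        (σ₀ : Fin n → ℝ) (E₀ : Matrix (Fin n) (Fin n) ℝ) (N₀ : Matrix (Fin m) (Fin n) ℝ),
        1 ≤ C₁ → 0 < c₂ →
        LinearIndependent ℝ Astar.col →
        WeightAssumption P C₁ c₂ C₂ →
        InitAssumption Astar A0 (1 / 50) σ₀ E₀ N₀ →
        (∀ i, σ₀ i ≤ 1 + 1 / 50) →
        (∀ i j, 0 ≤ E₀ i j) →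
        C₁ ^ 3 ≤ G * c₂ ^ 2 * n →
        (AdversarialNoise P Cν →
          max Cν (rowNorm N₀) ≤ G * c₂ ^ 4 / (C₁ ^ 5 * n * pinvNorm Astar) →
          EquilibrationGuarantee ε₀ q Astar A0 P (3 / 2) (1 / 50)
            (fun _ => 2 * max (rowNorm N₀) (K * (n * C₁ ^ 2 / c₂ ^ 2) * Cν))) ∧
        (UnbiasedNoise P Cν →
          max Cν (rowNorm N₀) ≤
            min (Real.sqrt (G * c₂ ^ 4 / (C₁ ^ 5 * n)) * (1 / pinvNorm Astar))
              (G * c₂ ^ 2 / (C₁ ^ 3 * pinvNorm Astar)) →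
          EquilibrationGuarantee ε₀ q Astar A0 P (3 / 2) (1 / 50)
            (fun ε => 2 * max (rowNorm N₀)
              (K * (n * C₁ ^ 2 / c₂ ^ 2) * pinvNorm Astar * Cν ^ 2 + ε * Cν))) := by
  refine ⟨1 / 10 ^ 22, by positivity, 10 ^ 8, by positivity, 1 / 100, by norm_num, by norm_num,
    batchSize, ?_⟩
  intro n m Astar A0 P _ C₁ c₂ C₂ Cν σ₀ E₀ N₀ hC₁ hc₂ hA hw hA₀ hσ₀ hE₀ hsparse
  have hC0 : 0 < C₁ := by linarith
  have hn : 0 < n := pos_of_sparse hC₁ hsparse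
  have hn0 : (0 : ℝ) < n := by exact_mod_cast hn
  have hn1 : (1 : ℝ) ≤ n := by exact_mod_cast hn
  have hc : c₂ ≤ C₁ := hw.c₂_le hn
  have hcn : 1 ≤ c₂ * n := hC₁.trans (le_mul_of_sparse hC₁ hc₂ hc hsparse)
  set p := pinvNorm Astar with hp_def
  have hscale : n * C₁ ^ 2 / c₂ ^ 2 * (c₂ ^ 4 / (C₁ ^ 5 * n)) = c₂ ^ 2 / C₁ ^ 3 := by
    field_simp
  have hg0 : 0 ≤ c₂ ^ 2 / C₁ ^ 3 := by positivity
  have hgα : c₂ ^ 2 / C₁ ^ 3 ≤ c₂ / C₁ := sq_div_cube_le hC₁ hc₂ hc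
  have hα : c₂ / (10 ^ 6 * C₁) = 1 / 10 ^ 6 * (c₂ / C₁) := by field_simp
  have hτ : ∀ ε, 0 < ε → 15 * samplingAccuracy n ε ≤ ε / n ^ 3 := fun ε hε => by
    have h1 : samplingAccuracy n ε = 1 / 10 ^ 8 * (ε / n ^ 3) := by
      unfold samplingAccuracy
      field_simp
    have h2 : 0 ≤ ε / n ^ 3 := by positivity
    rw [h1]
    linarith
  constructor
  · intro hν hN
    have hpX : 0 < p → ∀ x ≤ max Cν (rowNorm N₀),
        p * x ≤ 1 / 10 ^ 22 * (c₂ ^ 4 / (C₁ ^ 5 * n)) := by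
      intro hp x hx
      refine (mul_le_mul_of_nonneg_left (hx.trans hN) hp.le).trans (le_of_eq ?_)
      field_simp
    have hsmall : 0 < p → ∀ x ≤ max Cν (rowNorm N₀),
        p * x ≤ 1 / 10 ^ 22 * (c₂ ^ 2 / C₁ ^ 3) := by
      intro hp x hx
      refine (hpX hp x hx).trans (mul_le_mul_of_nonneg_left ?_ (by positivity))
      rw [← hscale]
      refine le_mul_of_one_le_left (by positivity) ?_
      rw [one_le_div (by positivity)]
      exact (pow_le_pow_left₀ hc₂.le hc 2).trans (le_mul_of_one_le_left (by positivity) hn1)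
    refine equilibrationGuarantee_of_bounds hC₁ hc₂ hA hw hA₀ hσ₀ hE₀ hsparse hν hsmall ?_
    intro ε hp hCν hε hε'
    refine ⟨by positivity, ?_, 3 * (Cν * (C₁ / n)), ?_, fun u v hu hv k =>
      hν.abs_covariance_le hCν hw.sparseWeights (by positivity) ?_ hu hv k⟩
    · have h1 := mul_le_mul_of_nonneg_left (hpX hp _ (le_max_left _ _))
        (show 0 ≤ n * C₁ ^ 2 / c₂ ^ 2 by positivity)
      have h2 : n * C₁ ^ 2 / c₂ ^ 2 * (1 / 10 ^ 22 * (c₂ ^ 4 / (C₁ ^ 5 * n)))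
          = 1 / 10 ^ 22 * (c₂ ^ 2 / C₁ ^ 3) := by rw [← hscale]; ring
      rw [h2] at h1
      linarith
    · have h1 : 10 ^ 8 * (n * C₁ ^ 2 / c₂ ^ 2) * Cν * (c₂ / n ^ 2)
          = 10 ^ 8 * (Cν * (C₁ / n * (C₁ / c₂))) := by field_simp
      have h2 : C₁ / n ≤ C₁ / n * (C₁ / c₂) :=
        le_mul_of_one_le_right (by positivity) ((one_le_div hc₂).2 hc)
      have h3 : ε / n ^ 3 ≤ C₁ / n :=
        div_le_div₀ hC0.le (by linarith) hn0 (le_self_pow₀ hn1 (by norm_num))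
      have h4 := mul_le_mul_of_nonneg_left ((hτ ε hε).trans (h3.trans h2)) hCν
      have h5 := mul_le_mul_of_nonneg_left h2 hCν
      have h6 : 0 ≤ Cν * (C₁ / n) := by positivity
      rw [h1]
      linarith
    · have h1 := hsmall hp _ (le_max_left _ _)
      rw [hα]
      linarith
  · intro hν hN
    have hpX : 0 < p → ∀ x ≤ max Cν (rowNorm N₀),
        p * x ≤ Real.sqrt (1 / 10 ^ 22 * c₂ ^ 4 / (C₁ ^ 5 * n)) := by
      intro hp x hx
      refine (mul_le_mul_of_nonneg_left ((hx.trans hN).trans (min_le_left _ _)) hp.le).trans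
        (le_of_eq ?_)
      field_simp
    have hsmall : 0 < p → ∀ x ≤ max Cν (rowNorm N₀),
        p * x ≤ 1 / 10 ^ 22 * (c₂ ^ 2 / C₁ ^ 3) := by
      intro hp x hx
      refine (mul_le_mul_of_nonneg_left ((hx.trans hN).trans (min_le_right _ _)) hp.le).trans
        (le_of_eq ?_)
      field_simp
    refine equilibrationGuarantee_of_bounds hC₁ hc₂ hA hw hA₀ hσ₀ hE₀ hsparse hν.1 hsmall ?_
    intro ε hp hCν hε hε'
    refine ⟨by positivity, ?_, Cν * (1.1 * p * Cν * (3 * (C₁ / n) / (c₂ / (10 ^ 6 * C₁)))), ?_,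
      fun u v hu hv k => hν.abs_covariance_le hCν hw.sparseWeights (by positivity) (by positivity)
        (by positivity) ?_ hu hv k⟩
    · have h1 := pow_le_pow_left₀ (by positivity) (hpX hp _ (le_max_left _ _)) 2
      rw [Real.sq_sqrt (by positivity)] at h1
      have h2 := mul_le_mul_of_nonneg_left h1 (show 0 ≤ n * C₁ ^ 2 / c₂ ^ 2 by positivity)
      have h3 : n * C₁ ^ 2 / c₂ ^ 2 * (1 / 10 ^ 22 * c₂ ^ 4 / (C₁ ^ 5 * n))
          = 1 / 10 ^ 22 * (c₂ ^ 2 / C₁ ^ 3) := by rw [← hscale]; ring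
      rw [h3] at h2
      have h4 : ε * (p * Cν) ≤ 1 * (1 / 10 ^ 22 * (c₂ ^ 2 / C₁ ^ 3)) :=
        mul_le_mul (by linarith) (hsmall hp _ (le_max_left _ _)) (by positivity) zero_le_one
      linarith
    · have h1 : (10 ^ 8 * (n * C₁ ^ 2 / c₂ ^ 2) * p * Cν ^ 2 + ε * Cν) * (c₂ / n ^ 2)
          = 10 ^ 8 * (p * Cν ^ 2 * (C₁ ^ 2 / (c₂ * n))) + Cν * (ε / n ^ 3 * (c₂ * n)) := by
        field_simp
      have h2 : Cν * (1.1 * p * Cν * (3 * (C₁ / n) / (c₂ / (10 ^ 6 * C₁))))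
          = 1.1 * 3 * 10 ^ 6 * (p * Cν ^ 2 * (C₁ ^ 2 / (c₂ * n))) := by
        field_simp
      have h3 : ε / n ^ 3 ≤ ε / n ^ 3 * (c₂ * n) := le_mul_of_one_le_right (by positivity) hcn
      have h4 := mul_le_mul_of_nonneg_left ((hτ ε hε).trans h3) hCν
      have h5 : 0 ≤ p * Cν ^ 2 * (C₁ ^ 2 / (c₂ * n)) := by positivity
      rw [h1, h2]
      linarith
    · have h1 := hsmall hp _ (le_max_left _ _)
      rw [hα]
      linarith
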